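/- Let $W$ be the Weyl group of a nonzero (crystallographic) root system spanning a real vector space $E$ of dimension $l\ge 1$, with a $W$-invariant inner product $(\ ,\ )$ on $E$. For a finite group $G$ let $R(G)$ be the Grothendieck group of its finite-dimensional complex representations, with the character pairing $\langle\chi,\psi\rangle_G=\frac1{|G|}\sum_{g}\chi(g)\psi(g^{-1})$. Let $\langle\sigma,\sigma'\rangle^{\mathrm{ell}}_W=\frac1{|W|}\sum_{w\in W}\sigma(w)\sigma'(w)\det_E(1-w)$ be the elliptic pairing on $R(W)$ and $\overline R(W)=R(W)/\mathrm{rad}\langle\ ,\ \rangle_W^{\mathrm{ell}}$. The elliptic fake degree of a class $[\pi]\in\overline R(W)$ is the rational function $$F_{[\pi]}=\frac{(q-1)^l}{|W|}\sum_{w\in W}\pi(w)\,\frac{\det_E(1-w)}{\det_E(1-qw)}.$$ Let $C(E)$ be the Clifford algebra with relations $\xi\xi'+\xi'\xi=-2(\xi,\xi')$, let $\epsilon$ be its automorphism equal to $+1$ on $C(E)_{\mathrm{even}}$ and $-1$ on $C(E)_{\mathrm{odd}}$, and ${}^t$ its anti-automorphism with $\xi^t=-\xi$ for $\xi\in E$.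 Let $\mathrm{Pin}(E)=\{a\in C(E)^\times:\epsilon(a)Ea^{-1}\subset E,\ a^t=a^{-1}\}$ and $p:\mathrm{Pin}(E)\to O(E)$, $p(a)(\xi)=\epsilon(a)\xi a^{-1}$. Put $\widetilde W=p^{-1}(W)$, and let $\widetilde W'=\widetilde W$ if $l$ is odd and $\widetilde W'=\widetilde W\cap C(E)_{\mathrm{even}}$ if $l$ is even. Let $S^+,S^-$ be the two inequivalent simple complex modules of $C(E)$ if $l$ is odd, respectively of $C(E)_{\mathrm{even}}$ if $l$ is even (in either order), restricted to $\widetilde W'$. A representation of $\widetilde W'$ is genuine if $-1$ acts by $-1$. Two representations $\tau^\pm$ of $\widetilde W'$ are associate if $\tau^-\cong\tau^+\otimes(\det\circ p)$ when $l$ is odd, and if $\tau^-$ is isomorphic to the conjugate of $\tau^+$ by the elements of $\widetilde W\setminus\widetilde W'$ when $l$ is even; they are orthogonal if $\langle\tau^+,\tau^-\rangle_{\widetilde W'}=0$. Then for every class $[\pi]\in\overline R(W)$ there is a pair $(\widetilde\sigma^+_\pi,\widetilde\sigma^-_\pi)$, unique up to isomorphism, of associate, orthogonal genuine $\widetilde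 W'$-representations such that $\pi'\otimes(S^+-S^-)=\widetilde\sigma^+_\pi-\widetilde\sigma^-_\pi$ for every representative $\pi'\in R(W)$ of $[\pi]$, and for every representative $\pi$ of the class $$F_{[\pi]}=\tfrac12\,(q-1)^l\,\big\langle\widetilde\sigma^+_\pi-\widetilde\sigma^-_\pi,\ S_qE\otimes(S^+-S^-)\big\rangle_{\widetilde W'},$$ where $S_qE=\sum_{i\ge0}q^iS^iE$, the pairing is extended $q$-linearly, so that the right-hand side is a formal power series in $q$, and the left-hand side is identified with its expansion at $q=0$. -/

import Mathlib

noncomputable section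

open scoped PowerSeries

namespace EllipticSpin

/-! ### Characters of finite groups -/

section Characters

variable (G : Type*) [Group G]

/-- `χ` is the character of a finite-dimensional complex representation of `G`. -/
def IsCharacter (χ : G → ℂ) : Prop :=
  ∃ (n : ℕ) (ρ : Representation ℂ G (Fin n → ℂ)), ρ.character = χ

/-- The Grothendieck group `R(G)` of finite-dimensional complex representations of a finite group
`G`, realised as the group of virtual characters. -/
def virtualCharacters : AddSubgroup (G → ℂ) :=
  AddSubgroup.closure {χ | IsCharacter G χ}

variable {G}

/-- The character pairing `⟨χ, ψ⟩_G = |G|⁻¹ ∑_g χ(g) ψ(g⁻¹)`; for characters of representations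
`V` and `U` of a finite group it is the dimension of `Hom_G(U, V)`. -/
def charPairing (χ ψ : G → ℂ) : ℂ :=
  (Nat.card G : ℂ)⁻¹ * ∑ᶠ g : G, χ g * ψ g⁻¹

end Characters

/-! ### Elliptic representation theory of a finite linear group -/

section Elliptic

variable {E : Type*} [AddCommGroup E] [Module ℝ E]

/-- `det_E(1 - w)`. -/
def detOneSub (w : E ≃ₗ[ℝ] E) : ℝ :=
  LinearMap.det (1 - (w : E →ₗ[ℝ] E))

/-- The polynomial `det_E(1 - q w)` in `q`, with coefficients viewed in `ℂ`
(`Matrix.charpolyRev M` is `det (1 - X • M)`). -/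
def detOneSubX [FiniteDimensional ℝ E] (w : E ≃ₗ[ℝ] E) : Polynomial ℂ :=
  (LinearMap.toMatrix (Module.finBasis ℝ E) (Module.finBasis ℝ E)
    (w : E →ₗ[ℝ] E)).charpolyRev.map (algebraMap ℝ ℂ)

variable (W : Subgroup (E ≃ₗ[ℝ] E))

variable {W} in
/-- The elliptic pairing `|W|⁻¹ ∑_w σ(w) τ(w) det(1 - w)`. -/
def ellipticPairing (σ τ : W → ℂ) : ℂ :=
  (Nat.card W : ℂ)⁻¹ * ∑ᶠ w : W, σ w * τ w * (detOneSub (w : E ≃ₗ[ℝ] E) : ℂ)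

/-- The radical of the elliptic pairing on `R(W)`. -/
def ellipticRadical [Finite W] : AddSubgroup (virtualCharacters W) where
  carrier := {σ | ∀ τ : virtualCharacters W, ellipticPairing (σ : W → ℂ) (τ : W → ℂ) = 0}
  zero_mem' := fun τ => by simp [ellipticPairing]
  add_mem' := fun {a b} ha hb τ => by
    have h := congrArg₂ (· + ·) (ha τ) (hb τ)
    simp only [ellipticPairing, add_zero] at h ⊢
    rw [← mul_add, ← finsum_add_distrib (Set.toFinite _) (Set.toFinite _)] at h
    simpa [add_mul] using h
  neg_mem' := fun {a} ha τ => by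
    have h := congrArg Neg.neg (ha τ)
    simp only [ellipticPairing, neg_zero] at h ⊢
    rw [← mul_neg, ← finsum_neg_distrib] at h
    simpa using h

/-- The group `R̄(W) = R(W) / rad` of virtual elliptic representations. -/
abbrev EllipticQuotient [Finite W] : Type _ :=
  virtualCharacters W ⧸ ellipticRadical W

variable {W} in
/-- The elliptic fake degree
`F_{[π]} = (q-1)^l |W|⁻¹ ∑_w π(w) det(1-w) / det(1-qw)`, a rational function of `q`. -/
def ellipticFakeDegree [FiniteDimensional ℝ E] (π : W → ℂ) : RatFunc ℂ :=
  (RatFunc.X - 1) ^ Module.finrank ℝ E *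
    (RatFunc.C (Nat.card W : ℂ)⁻¹ *
      ∑ᶠ w : W, RatFunc.C (π w * (detOneSub (w : E ≃ₗ[ℝ] E) : ℂ)) /
        algebraMap (Polynomial ℂ) (RatFunc ℂ) (detOneSubX (w : E ≃ₗ[ℝ] E)))

end Elliptic

/-! ### Symmetric powers -/

section SymPow

variable {k V : Type*} [Field k] [AddCommGroup V] [Module k V]

variable (k V) in
/-- The symmetric power `S^i V`, as the degree `i` part of the symmetric algebra. -/
def symPow (i : ℕ) : Submodule k (SymmetricAlgebra k V) :=
  LinearMap.range (SymmetricAlgebra.ι k V) ^ i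

/-- The algebra endomorphism of the symmetric algebra induced by a linear endomorphism. -/
def symMap (f : V →ₗ[k] V) : SymmetricAlgebra k V →ₐ[k] SymmetricAlgebra k V :=
  SymmetricAlgebra.lift (SymmetricAlgebra.ι k V ∘ₗ f)

theorem symMap_mem_symPow (f : V →ₗ[k] V) (i : ℕ) :
    ∀ x ∈ symPow k V i, (symMap f).toLinearMap x ∈ symPow k V i := by
  have h1 : (LinearMap.range (SymmetricAlgebra.ι k V)).map (symMap f).toLinearMap ≤
      LinearMap.range (SymmetricAlgebra.ι k V) := by
    rintro _ ⟨_, ⟨v, rfl⟩, rfl⟩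
    exact ⟨f v, by simp [symMap]⟩
  intro x hx
  have h2 : (symPow k V i).map (symMap f).toLinearMap ≤ symPow k V i := by
    unfold symPow
    rw [Submodule.map_pow]
    exact pow_le_pow_left' h1 i
  exact h2 ⟨x, hx, rfl⟩

/-- The endomorphism of `S^i V` induced by a linear endomorphism of `V`. -/
def symPowMap (f : V →ₗ[k] V) (i : ℕ) : symPow k V i →ₗ[k] symPow k V i :=
  (symMap f).toLinearMap.restrict (symMap_mem_symPow f i)

end SymPow

/-- The character of `W` on the symmetric power `S^i E` of its (complexified) reflection
representation; `S_q E = ∑ q^i S^i E` has graded character `∑ q^i symPowCharacter W i`. -/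
def symPowCharacter {E : Type*} [AddCommGroup E] [Module ℝ E] (W : Subgroup (E ≃ₗ[ℝ] E))
    (i : ℕ) (w : W) : ℂ :=
  LinearMap.trace ℂ _
    (symPowMap (LinearMap.baseChange ℂ ((w : E ≃ₗ[ℝ] E) : E →ₗ[ℝ] E)) i)

/-! ### Clifford algebra, pin group and pin covers -/

section Clifford

variable (E : Type*) [NormedAddCommGroup E] [InnerProductSpace ℝ E]

/-- The quadratic form `ξ ↦ -(ξ, ξ)`. -/
def cliffordForm : QuadraticForm ℝ E :=
  -LinearMap.BilinMap.toQuadraticMap (innerₗ E)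

/-- The Clifford algebra `C(E)`, with relations `ξ ξ' + ξ' ξ = -2 (ξ, ξ')`. -/
abbrev Cl : Type _ := CliffordAlgebra (cliffordForm E)

/-- The inclusion of `E` in `C(E)`. -/
abbrev clι : E →ₗ[ℝ] Cl E := CliffordAlgebra.ι (cliffordForm E)

theorem clι_mul_add_swap (x y : E) :
    clι E x * clι E y + clι E y * clι E x = algebraMap ℝ (Cl E) (-2 * inner ℝ x y) := by
  rw [CliffordAlgebra.ι_mul_ι_add_swap]
  congr 1
  simp only [QuadraticMap.polar, cliffordForm, neg_apply,
    LinearMap.BilinMap.toQuadraticMap_apply, innerₗ_apply_apply, inner_add_left, inner_add_right,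
    real_inner_comm x y]
  ring

theorem clι_injective : Function.Injective (clι E) := by
  intro x y h
  have h' := congrArg (CliffordAlgebra.equivExterior (cliffordForm E)) h
  simpa [CliffordAlgebra.equivExterior, CliffordAlgebra.changeFormEquiv,
    CliffordAlgebra.changeForm_ι] using h'

/-- The twisted conjugation `x ↦ ε(a) x a⁻¹`. -/
def twistedConj (a : (Cl E)ˣ) : Cl E →ₗ[ℝ] Cl E :=
  LinearMap.mulLeft ℝ (CliffordAlgebra.involute (a : Cl E)) ∘ₗ
    LinearMap.mulRight ℝ ((a⁻¹ : (Cl E)ˣ) : Cl E)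

theorem twistedConj_apply (a : (Cl E)ˣ) (x : Cl E) :
    twistedConj E a x = CliffordAlgebra.involute (a : Cl E) * x * ((a⁻¹ : (Cl E)ˣ) : Cl E) := by
  simp [twistedConj, mul_assoc]

theorem twistedConj_one : twistedConj E 1 = LinearMap.id := by
  ext x
  simp [twistedConj_apply]

theorem twistedConj_mul (a b : (Cl E)ˣ) :
    twistedConj E (a * b) = twistedConj E a ∘ₗ twistedConj E b := by
  refine LinearMap.ext fun x => ?_
  simp [twistedConj_apply, mul_assoc]

/-- `C(E)` if `dim E` is odd, and the even part of `C(E)` if `dim E` is even. -/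
def spinAlgebra : Subalgebra ℝ (Cl E) :=
  open Classical in
  if Odd (Module.finrank ℝ E) then ⊤ else CliffordAlgebra.even (cliffordForm E)

theorem star_mem_spinAlgebra {x : Cl E} (hx : x ∈ spinAlgebra E) : star x ∈ spinAlgebra E := by
  unfold spinAlgebra at *
  split_ifs at * with h
  · trivial
  · rw [← Subalgebra.mem_toSubmodule, CliffordAlgebra.even_toSubmodule] at *
    rw [CliffordAlgebra.star_def, CliffordAlgebra.reverse_mem_evenOdd_iff,
      CliffordAlgebra.involute_mem_evenOdd_iff]
    exact hx

variable [FiniteDimensional ℝ E]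

/-- The pin group `{a ∈ C(E)ˣ : ε(a) E a⁻¹ ⊆ E, aᵗ = a⁻¹}`; here `star` is the anti-automorphism
`ᵗ` of `C(E)` with `ξᵗ = -ξ` for `ξ ∈ E`, and `involute` is `ε`. -/
def Pin : Subgroup (Cl E)ˣ where
  carrier := {a | (∀ ξ : E, CliffordAlgebra.involute (a : Cl E) * clι E ξ *
      ((a⁻¹ : (Cl E)ˣ) : Cl E) ∈ LinearMap.range (clι E)) ∧
    star (a : Cl E) = ((a⁻¹ : (Cl E)ˣ) : Cl E)}
  one_mem' := ⟨fun ξ => by simp, by simp⟩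
  mul_mem' := by
    rintro a b ⟨ha, ha'⟩ ⟨hb, hb'⟩
    refine ⟨fun ξ => ?_, by simp [ha', hb']⟩
    obtain ⟨η, hη⟩ := hb ξ
    have := ha η
    rw [hη] at this
    simpa [mul_assoc] using this
  inv_mem' := by
    rintro a ⟨ha, ha'⟩
    refine ⟨fun ξ => ?_, by rw [inv_inv, ← ha', star_star]⟩
    have hle : (LinearMap.range (clι E)).map (twistedConj E a) ≤ LinearMap.range (clι E) := by
      rintro _ ⟨_, ⟨v, rfl⟩, rfl⟩
      rw [twistedConj_apply]
      exact ha v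
    have hinv : ∀ x, twistedConj E a⁻¹ (twistedConj E a x) = x := fun x => by
      rw [← LinearMap.comp_apply, ← twistedConj_mul, inv_mul_cancel, twistedConj_one]
      rfl
    have hinj : Function.Injective (twistedConj E a) := fun x y h => by
      rw [← hinv x, h, hinv]
    have heq := Submodule.eq_of_le_of_finrank_eq hle
      (Submodule.equivMapOfInjective _ hinj _).finrank_eq.symm
    have hξ : clι E ξ ∈ LinearMap.range (clι E) := ⟨ξ, rfl⟩
    rw [← heq] at hξ
    obtain ⟨y, hy, hy'⟩ := hξ
    rw [← twistedConj_apply, ← hy', hinv]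
    exact hy

variable {E}

/-- The linear map `p(a) : E → E`, `p(a)(ξ) = ε(a) ξ a⁻¹`, for `a` in the pin group. -/
def pinAct (a : Pin E) : E →ₗ[ℝ] E :=
  (LinearEquiv.ofInjective (clι E) (clι_injective E)).symm.toLinearMap ∘ₗ
    LinearMap.codRestrict (LinearMap.range (clι E)) (twistedConj E (a : (Cl E)ˣ) ∘ₗ clι E)
      (fun ξ => by
        rw [LinearMap.comp_apply, twistedConj_apply]
        exact a.2.1 ξ)

theorem clι_pinAct (a : Pin E) (ξ : E) :
    clι E (pinAct a ξ) = CliffordAlgebra.involute ((a : (Cl E)ˣ) : Cl E) * clι E ξ *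
      (((a : (Cl E)ˣ)⁻¹ : (Cl E)ˣ) : Cl E) := by
  rw [← twistedConj_apply]
  have h := LinearEquiv.apply_symm_apply (LinearEquiv.ofInjective (clι E) (clι_injective E))
    ⟨twistedConj E (a : (Cl E)ˣ) (clι E ξ), by rw [twistedConj_apply]; exact a.2.1 ξ⟩
  exact congrArg Subtype.val h

variable (E)

/-- The homomorphism `p` from the pin group to the linear automorphisms of `E`. -/
def pinHom : Pin E →* (E ≃ₗ[ℝ] E) :=
  (LinearMap.GeneralLinearGroup.generalLinearEquiv ℝ E).toMonoidHom.comp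
    (MonoidHom.toHomUnits (M := Module.End ℝ E)
      { toFun := pinAct
        map_one' := by
          refine LinearMap.ext fun ξ => clι_injective E ?_
          rw [clι_pinAct]
          simp
        map_mul' := fun a b => by
          refine LinearMap.ext fun ξ => clι_injective E ?_
          rw [Module.End.mul_apply, clι_pinAct, clι_pinAct, clι_pinAct]
          simp [mul_assoc] })

theorem clι_pinHom (a : Pin E) (ξ : E) :
    clι E (pinHom E a ξ) = CliffordAlgebra.involute ((a : (Cl E)ˣ) : Cl E) * clι E ξ *
      (((a : (Cl E)ˣ)⁻¹ : (Cl E)ˣ) : Cl E) :=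
  clι_pinAct a ξ

variable {E}
variable (W : Subgroup (E ≃ₗ[ℝ] E))

/-- The pin cover `W̃ = p⁻¹(W)` of `W`. -/
def pinCover : Subgroup (Pin E) :=
  W.comap (pinHom E)

/-- The group `W̃'`: it is `W̃` if `dim E` is odd and `W̃ ∩ C(E)_even` if `dim E` is even. -/
def pinCover' : Subgroup (Pin E) where
  carrier := {a | a ∈ pinCover W ∧ ((a : (Cl E)ˣ) : Cl E) ∈ spinAlgebra E}
  one_mem' := ⟨one_mem _, by simp⟩
  mul_mem' := fun ha hb => ⟨mul_mem ha.1 hb.1, by simpa using mul_mem ha.2 hb.2⟩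
  inv_mem' := fun {a} ha => ⟨inv_mem ha.1, by
    have := star_mem_spinAlgebra E ha.2
    rw [a.2.2] at this
    simpa using this⟩

/-- The projection `W̃' → W`. -/
def coverProj : pinCover' W →* W :=
  ((pinHom E).comp (pinCover' W).subtype).codRestrict W (fun a => a.2.1)

/-- An element of `W̃'`, as an element of `C(E)` (`dim E` odd) or `C(E)_even` (`dim E` even). -/
def toSpinAlgebra (g : pinCover' W) : spinAlgebra E :=
  ⟨(((g : Pin E) : (Cl E)ˣ) : Cl E), g.2.2⟩

/-- `χ` is the character of a genuine representation of `W̃'`: `-1` acts by `-1`. -/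
def IsGenuineCharacter (χ : pinCover' W → ℂ) : Prop :=
  ∃ (n : ℕ) (ρ : Representation ℂ (pinCover' W) (Fin n → ℂ)),
    (∀ z : pinCover' W, (((z : Pin E) : (Cl E)ˣ) : Cl E) = -1 → ρ z = -1) ∧ ρ.character = χ

/-- Two characters of `W̃'` are associate. If `dim E` is odd, this means that they differ by the
twist with the sign character `det ∘ p` of `W̃' = W̃`; if `dim E` is even, that they are conjugate
under the elements of `W̃` outside the index two subgroup `W̃'`. -/
def IsAssociate (χ₁ χ₂ : pinCover' W → ℂ) : Prop :=
  (Odd (Module.finrank ℝ E) → ∀ g : pinCover' W,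
    χ₂ g = ((LinearMap.det ((coverProj W g : E ≃ₗ[ℝ] E) : E →ₗ[ℝ] E) : ℝ) : ℂ) * χ₁ g) ∧
  (Even (Module.finrank ℝ E) → ∀ x ∈ pinCover W, x ∉ pinCover' W →
    ∀ g h : pinCover' W, (h : Pin E) = x * g * x⁻¹ → χ₂ h = χ₁ g)

end Clifford

/-! ### Spin modules and the map `ι` -/

section Spin

variable {A : Type*} [Ring A] [Algebra ℝ A]

/-- A complex module `S` over the real algebra `A`, given by `ρ`, is simple. -/
def IsSimpleModuleHom {S : Type*} [AddCommGroup S] [Module ℂ S]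
    (ρ : A →ₐ[ℝ] Module.End ℂ S) : Prop :=
  Nontrivial S ∧ ∀ U : Submodule ℂ S, (∀ a : A, ∀ v ∈ U, ρ a v ∈ U) → U = ⊥ ∨ U = ⊤

/-- Two complex modules over the real algebra `A` are isomorphic. -/
def AreIsomorphic {S T : Type*} [AddCommGroup S] [Module ℂ S] [AddCommGroup T] [Module ℂ T]
    (ρ : A →ₐ[ℝ] Module.End ℂ S) (τ : A →ₐ[ℝ] Module.End ℂ T) : Prop :=
  ∃ f : S ≃ₗ[ℂ] T, ∀ (a : A) (v : S), f (ρ a v) = τ a (f v)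

variable {E : Type*} [NormedAddCommGroup E] [InnerProductSpace ℝ E] [FiniteDimensional ℝ E]
  (W : Subgroup (E ≃ₗ[ℝ] E))

/-- The character of `W̃'` on the restriction of a complex module over `C(E)` (`dim E` odd) or
`C(E)_even` (`dim E` even). -/
def spinCharacter {S : Type*} [AddCommGroup S] [Module ℂ S]
    (ρ : spinAlgebra E →ₐ[ℝ] Module.End ℂ S) (g : pinCover' W) : ℂ :=
  LinearMap.trace ℂ S (ρ (toSpinAlgebra W g))

/-- `ι(π) = π ⊗ (S⁺ - S⁻)`, where `δ` is the virtual character `S⁺ - S⁻` of `W̃'`. -/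
def spinInduct (δ : pinCover' W → ℂ) (π : W → ℂ) : pinCover' W → ℂ :=
  fun g => π (coverProj W g) * δ g

/-- `σ = (σ⁺, σ⁻)` is a pair of (characters of) associate, orthogonal genuine representations of
`W̃'` such that `ι([π]) = σ⁺ - σ⁻`, i.e. `π' ⊗ (S⁺ - S⁻) = σ⁺ - σ⁻` for every `π' ∈ R(W)` in the
class `c = [π]`. Here `δ` is the virtual character `S⁺ - S⁻`. -/
structure IsSpinPair [Finite W] (δ : pinCover' W → ℂ) (c : EllipticQuotient W)
    (σ : (pinCover' W → ℂ) × (pinCover' W → ℂ)) : Prop where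
  genuine_fst : IsGenuineCharacter W σ.1
  genuine_snd : IsGenuineCharacter W σ.2
  associate : IsAssociate W σ.1 σ.2
  orthogonal : charPairing σ.1 σ.2 = 0
  induct_eq : ∀ π : virtualCharacters W, (QuotientAddGroup.mk π : EllipticQuotient W) = c →
    spinInduct W δ (π : W → ℂ) = σ.1 - σ.2

/-- The pairing `⟨χ, S_q E ⊗ δ⟩_{W̃'} = ∑_i q^i ⟨χ, S^i E ⊗ δ⟩_{W̃'}`. -/
def symPairing (χ δ : pinCover' W → ℂ) : ℂ⟦X⟧ :=
  PowerSeries.mk fun i => charPairing χ (spinInduct W δ (symPowCharacter W i))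

end Spin

/-! ### Weyl groups -/

section Weyl

variable {I E N : Type*} [AddCommGroup E] [Module ℝ E] [AddCommGroup N] [Module ℝ N]

/-- The Weyl group of a root system in `E`, as a group of linear automorphisms of `E`. -/
def weylGroup (P : RootPairing I ℝ E N) : Subgroup (E ≃ₗ[ℝ] E) :=
  Subgroup.closure (Set.range P.reflection)

instance finite_weylGroup [Finite I] (P : RootPairing I ℝ E N) [P.IsRootSystem] :
    Finite (weylGroup P) := by
  have key : ∀ w ∈ weylGroup P, ∀ i, w (P.root i) ∈ Set.range P.root := by
    intro w hw
    induction hw using Subgroup.closure_induction'' with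
    | one => exact fun i => ⟨i, rfl⟩
    | mem x hx =>
      obtain ⟨j, rfl⟩ := hx
      exact fun i => ⟨_, P.root_reflectionPerm j i⟩
    | inv_mem x hx =>
      obtain ⟨j, rfl⟩ := hx
      exact fun i => by
        rw [P.reflection_inv]
        exact ⟨_, P.root_reflectionPerm j i⟩
    | mul x y _ _ hx hy =>
      intro i
      obtain ⟨k, hk⟩ := hy i
      rw [LinearEquiv.mul_apply, ← hk]
      exact hx k
  refine Finite.of_injective
    (fun (w : weylGroup P) (i : I) => (⟨_, key w w.2 i⟩ : Set.range P.root)) ?_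
  intro w w' h
  have h' : ∀ i, (w : E ≃ₗ[ℝ] E) (P.root i) = (w' : E ≃ₗ[ℝ] E) (P.root i) := fun i =>
    congrArg Subtype.val (congrFun h i)
  apply Subtype.ext
  apply LinearEquiv.toLinearMap_injective
  apply LinearMap.ext_on_range (RootPairing.IsRootSystem.span_root_eq_top (P := P))
  exact h'

end Weyl

end EllipticSpin

end

open scoped PowerSeries LaurentSeries
open EllipticSpin

/-! Write δ = S⁺ - S⁻, and let c = 2 for l odd, c = 1 for l even. The theorem rests on δ(g) δ(g⁻¹) =
c det(1 - p(g)) on W̃' (`spinCharacter_mul_inv`). It turns ½⟨π ⊗ δ, S_qE ⊗ δ⟩ into c/2 times the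
average over W̃' of π(w) det(1 - w) tr(w⁻¹, S_qE), w = p(g). For l odd, p maps W̃' onto W. For l
even the image is the subgroup det = 1, of index two, and det(1 - w) vanishes off it. Either way the
result is the average over W (`inv_card_mul_sum_coverProj`), and Molien's formula tr(w, S_qE) =
1/det(1 - qw) identifies it with the fake degree.

For the identity, the algebra C(E) or C(E)_even is generated by an odd number m of anticommuting
square roots of -1 (`exists_spin_system`). A trace functional on it kills all ordered products of
generators except 1 and the full product φ, so two values determine it
(`IsCliffordSystem.tracial_ext`). Averaging over the generators expresses dim Hom(S, T) through
these values, and Schur's lemma yields δ(1) = 0 and δ(φ)² = ±2^(m+1)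
(`IsCliffordSystem.moduleTrace_sub`). With θ = ε^(l+1), the form (a, b) ↦ tr(x ↦ a θ(x) b) on C(E)
is also a trace in each variable. It vanishes when one variable is 1 and the other has the parity of
l. Comparison at φ gives δ(a) δ(b) = c tr(x ↦ a θ(x) b) (`spin_mul_spin`). If a has the parity of l
and b = a⁻¹, this operator is the algebra automorphism extending -p(a), whose trace is det(1 - p(a))
(`trace_of_ι_comp`). For l odd and g even both sides of the identity vanish.

The identity also shows det(1 - w) ≥ 0. Pairing a radical element r with its dual then gives ∑
|r(w)|² det(1 - w) = 0, hence r ⊗ δ = 0, and π ⊗ δ depends only on the class of π. A difference of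
genuine characters is in exactly one way a difference of orthogonal ones (`exists_orthogonal_parts`,
`orthogonal_parts_unique`). Twisting by det (l odd) or conjugating by an odd element (l even)
negates π ⊗ δ, so by uniqueness it swaps the two parts, which are therefore associate. -/

noncomputable section

open scoped PowerSeries TensorProduct

namespace EllipticSpin

/-! ### Ordered products of anticommuting elements -/

section Words

variable {k A : Type*} [Field k] [Ring A] [Algebra k A]

/-- The ordered product of those `f i` for which `I i` holds. -/
def word {m : ℕ} (f : Fin m → A) (I : Fin m → Bool) : A :=
  (List.ofFn fun i => if I i then f i else 1).prod

theorem word_succ {m : ℕ} (f : Fin (m + 1) → A) (I : Fin (m + 1) → Bool) :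
    word f I = (if I 0 then f 0 else 1) * word (Fin.tail f) (Fin.tail I) := by
  simp only [word, List.ofFn_succ, List.prod_cons, Fin.tail]
  rfl

theorem word_false {m : ℕ} (f : Fin m → A) : word f (fun _ => false) = 1 := by
  simp [word]

theorem word_true {m : ℕ} (f : Fin m → A) : word f (fun _ => true) = (List.ofFn f).prod := by
  simp [word]

theorem mul_ofFn_prod {m : ℕ} (x : A) (y : Fin m → A) (s : Fin m → k)
    (h : ∀ j, x * y j = s j • (y j * x)) :
    x * (List.ofFn y).prod = (∏ j, s j) • ((List.ofFn y).prod * x) := by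
  induction m with
  | zero => simp
  | succ m ih =>
    rw [List.ofFn_succ, List.prod_cons, Fin.prod_univ_succ, ← mul_assoc, h 0, smul_mul_assoc,
      mul_assoc, ih (fun i => y i.succ) (fun i => s i.succ) fun j => h j.succ]
    simp [mul_smul, mul_assoc]

/-- A generator moves past the others at the cost of scalar corrections. Only scalar anticommutators
are assumed, so that the result also applies to an eigenbasis that is not orthogonal. -/
theorem mul_mem_span_word (h2 : (2 : k) ≠ 0) {m : ℕ} (f : Fin m → A)
    (hf : ∀ i j, ∃ c : k, f i * f j + f j * f i = algebraMap k A c) (i : Fin m) {x : A}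
    (hx : x ∈ Submodule.span k (Set.range (word f))) :
    f i * x ∈ Submodule.span k (Set.range (word f)) := by
  induction m generalizing x with
  | zero => exact i.elim0
  | succ m ih =>
    set M' := Submodule.span k (Set.range (word (Fin.tail f)))
    -- A word is its first letter, 1 or `f 0`, times a word in the remaining generators.
    have key : ∀ u : A, (u = 1 ∨ u = f 0) → ∀ y ∈ M',
        u * y ∈ Submodule.span k (Set.range (word f)) := by
      intro u hu y hy
      induction hy using Submodule.span_induction with
      | mem y hy =>
        obtain ⟨I, rfl⟩ := hy
        apply Submodule.subset_span
        rcases hu with rfl | rfl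
        · exact ⟨Fin.cons false I, by simp [word_succ]⟩
        · exact ⟨Fin.cons true I, by simp [word_succ]⟩
      | zero => simp
      | add y z _ _ hy hz => rw [mul_add]; exact add_mem hy hz
      | smul c y _ hy => rw [mul_smul_comm]; exact Submodule.smul_mem _ _ hy
    have k1 : ∀ y ∈ M', y ∈ Submodule.span k (Set.range (word f)) := fun y hy => by
      simpa using key 1 (Or.inl rfl) y hy
    have ih' : ∀ i, ∀ y ∈ M', f (Fin.succ i) * y ∈ M' := fun i y hy =>
      ih (Fin.tail f) (fun i j => hf i.succ j.succ) i hy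
    induction hx using Submodule.span_induction with
    | mem y hy =>
      obtain ⟨I, rfl⟩ := hy
      rw [word_succ]
      have hw : word (Fin.tail f) (Fin.tail I) ∈ M' := Submodule.subset_span ⟨_, rfl⟩
      generalize word (Fin.tail f) (Fin.tail I) = w at hw
      refine Fin.cases ?_ (fun i => ?_) i
      · split_ifs
        · obtain ⟨c, hc⟩ := hf 0 0
          have : f 0 * f 0 = algebraMap k A (c / 2) := by
            rw [div_eq_inv_mul, map_mul, ← hc, ← Algebra.smul_def, ← two_smul k, smul_smul,
              inv_mul_cancel₀ h2, one_smul]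
          rw [← mul_assoc, this, ← Algebra.smul_def]
          exact Submodule.smul_mem _ _ (k1 _ hw)
        · rw [one_mul]; exact key _ (Or.inr rfl) _ hw
      · split_ifs
        · obtain ⟨c, hc⟩ := hf i.succ 0
          rw [← mul_assoc, eq_sub_of_add_eq hc, sub_mul, ← Algebra.smul_def, mul_assoc]
          exact sub_mem (Submodule.smul_mem _ _ (k1 _ hw)) (key _ (Or.inr rfl) _ (ih' i _ hw))
        · rw [one_mul]; exact k1 _ (ih' i _ hw)
    | zero => simp
    | add y z _ _ hy hz => rw [mul_add]; exact add_mem hy hz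
    | smul c y _ hy => rw [mul_smul_comm]; exact Submodule.smul_mem _ _ hy

theorem span_word_eq_top (h2 : (2 : k) ≠ 0) {m : ℕ} (f : Fin m → A)
    (hf : ∀ i j, ∃ c : k, f i * f j + f j * f i = algebraMap k A c)
    (hgen : Algebra.adjoin k (Set.range f) = ⊤) :
    Submodule.span k (Set.range (word f)) = ⊤ := by
  rw [eq_top_iff]
  rintro x -
  have hx : x ∈ Algebra.adjoin k (Set.range f) := hgen ▸ trivial
  suffices ∀ y ∈ Submodule.span k (Set.range (word f)),
      x * y ∈ Submodule.span k (Set.range (word f)) by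
    simpa using this 1 (Submodule.subset_span ⟨_, word_false f⟩)
  induction hx using Algebra.adjoin_induction with
  | mem x hx =>
    obtain ⟨i, rfl⟩ := hx
    exact fun y hy => mul_mem_span_word h2 f hf i hy
  | algebraMap r =>
    intro y hy
    rw [← Algebra.smul_def]
    exact Submodule.smul_mem _ _ hy
  | add a b _ _ ha hb =>
    intro y hy
    rw [add_mul]
    exact add_mem (ha y hy) (hb y hy)
  | mul a b _ _ ha hb =>
    intro y hy
    rw [mul_assoc]
    exact ha _ (hb y hy)

end Words

/-! ### Algebras generated by an odd number of anticommuting square roots of `-1` -/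

section Anticommuting

variable (k : Type*) {A : Type*} [Field k] [CharZero k] [Ring A] [Algebra k A]

/-- The elements `f i` anticommute, have square `-1` and generate the algebra. -/
structure IsCliffordSystem {m : ℕ} (f : Fin m → A) : Prop where
  sq : ∀ i, f i * f i = -1
  anti : ∀ i j, i ≠ j → f i * f j = -(f j * f i)
  gen : Algebra.adjoin k (Set.range f) = ⊤

variable {k} {m : ℕ} {f : Fin m → A}

theorem IsCliffordSystem.span_word (hf : IsCliffordSystem k f) :
    Submodule.span k (Set.range (word f)) = ⊤ := by
  refine span_word_eq_top two_ne_zero f (fun i j => ?_) hf.gen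
  rcases eq_or_ne i j with rfl | h
  · exact ⟨-2, by rw [hf.sq, map_neg, map_ofNat]; norm_num⟩
  · exact ⟨0, by rw [hf.anti i j h]; simp⟩

omit [CharZero k] in
theorem IsCliffordSystem.mul_word (hf : IsCliffordSystem k f) (i : Fin m) (I : Fin m → Bool) :
    f i * word f I =
      ((-1 : k) ^ (Finset.univ.filter fun j => I j = true ∧ j ≠ i).card) • (word f I * f i) := by
  unfold word
  rw [mul_ofFn_prod (f i) _ (fun j => if I j = true ∧ j ≠ i then (-1 : k) else 1)]
  · simp [Finset.prod_ite]
  · intro j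
    by_cases h : I j = true <;> by_cases hj : j = i
    · subst hj; simp
    · simp [h, hj, hf.anti i j (Ne.symm hj)]
    · simp [h]
    · simp [h]

omit [CharZero k] in
-- A word of even length anticommutes with each of its letters, a word of odd length with each
-- generator missing from it.
theorem IsCliffordSystem.exists_anticommute (hf : IsCliffordSystem k f)
    (I : Fin m → Bool) (h0 : I ≠ fun _ => false) (h1 : I ≠ fun _ => true) :
    ∃ i, f i * word f I = -(word f I * f i) := by
  rcases Nat.even_or_odd (Finset.univ.filter fun j => I j = true).card with h | h
  · obtain ⟨i, hi⟩ : ∃ i, I i = true := by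
      by_contra hc
      exact h0 (funext fun i => by simpa using not_exists.1 hc i)
    refine ⟨i, ?_⟩
    have : (Finset.univ.filter fun j => I j = true ∧ j ≠ i) =
        (Finset.univ.filter fun j => I j = true).erase i := by
      ext j; simp [and_comm]
    rw [hf.mul_word, this, Finset.card_erase_of_mem (by simp [hi]), Odd.neg_one_pow]
    · simp
    · refine Nat.Even.sub_odd ?_ h odd_one
      exact Finset.card_pos.2 ⟨i, by simp [hi]⟩
  · obtain ⟨i, hi⟩ : ∃ i, I i = false := by
      by_contra hc
      exact h1 (funext fun i => by simpa using not_exists.1 hc i)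
    refine ⟨i, ?_⟩
    have : (Finset.univ.filter fun j => I j = true ∧ j ≠ i) =
        (Finset.univ.filter fun j => I j = true) := by
      ext j
      simp only [Finset.mem_filter, Finset.mem_univ, true_and, and_iff_left_iff_imp]
      rintro hj rfl
      simp [hi] at hj
    rw [hf.mul_word, this, Odd.neg_one_pow h]
    simp

/-- A tracial functional vanishes on all words but the empty and the full one. -/
theorem IsCliffordSystem.tracial_word (hf : IsCliffordSystem k f)
    {M : Type*} [AddCommGroup M] [Module k M] (T : A →ₗ[k] M) (hT : ∀ u v, T (u * v) = T (v * u))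
    (I : Fin m → Bool) (h0 : I ≠ fun _ => false) (h1 : I ≠ fun _ => true) :
    T (word f I) = 0 := by
  obtain ⟨i, hi⟩ := hf.exists_anticommute I h0 h1
  have e1 : f i * word f I * f i = word f I := by
    rw [hi, neg_mul, mul_assoc, hf.sq]; simp
  have e2 : T (word f I) = -T (word f I) := by
    conv_lhs => rw [← e1, hT, ← mul_assoc, hf.sq]
    simp
  have e3 : (2 : k) • T (word f I) = 0 := by
    rw [two_smul]; nth_rewrite 1 [e2]; simp
  exact (smul_eq_zero.1 e3).resolve_left two_ne_zero

/-- By `tracial_word` the trace functionals with values in k form a space of dimension at most two;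
all comparisons of traces below go through this. -/
theorem IsCliffordSystem.tracial_ext (hf : IsCliffordSystem k f)
    {M : Type*} [AddCommGroup M] [Module k M] {T T' : A →ₗ[k] M}
    (hT : ∀ u v, T (u * v) = T (v * u)) (hT' : ∀ u v, T' (u * v) = T' (v * u))
    (h1 : T 1 = T' 1) (h2 : T (List.ofFn f).prod = T' (List.ofFn f).prod) : T = T' := by
  apply LinearMap.ext_on_range hf.span_word
  intro I
  by_cases hI : I = fun _ => false
  · rw [hI, word_false, h1]
  by_cases hI' : I = fun _ => true
  · rw [hI', word_true, h2]
  rw [hf.tracial_word T hT I hI hI', hf.tracial_word T' hT' I hI hI']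

omit [CharZero k] in
-- Each generator changes sign past the m - 1 others, an even number.
theorem IsCliffordSystem.commute_prod (hf : IsCliffordSystem k f) (hm : Odd m) (x : A) :
    Commute x (List.ofFn f).prod := by
  have hx : x ∈ Algebra.adjoin k (Set.range f) := hf.gen ▸ trivial
  induction hx using Algebra.adjoin_induction with
  | mem x hx =>
    obtain ⟨i, rfl⟩ := hx
    have h := hf.mul_word i (fun _ => true)
    have : (Finset.univ.filter fun j : Fin m => true = true ∧ j ≠ i) =
        (Finset.univ : Finset (Fin m)).erase i := by
      ext j; simp
    rw [this, Finset.card_erase_of_mem (Finset.mem_univ _), Even.neg_one_pow, one_smul,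
      word_true] at h
    · exact h
    · simpa using Nat.Odd.sub_odd hm odd_one
  | algebraMap r => exact Algebra.commutes r _
  | add a b _ _ ha hb => exact ha.add_left hb
  | mul a b _ _ ha hb => exact ha.mul_left hb

omit [CharZero k] in
-- The sign η depends on m, but only η² = 1 matters later.
theorem ofFn_prod_mul_self {m : ℕ} (f : Fin m → A) (hsq : ∀ i, f i * f i = -1)
    (hanti : ∀ i j, i ≠ j → f i * f j = -(f j * f i)) :
    ∃ η : k, η * η = 1 ∧ (List.ofFn f).prod * (List.ofFn f).prod = algebraMap k A η := by
  induction m with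
  | zero => exact ⟨1, by simp⟩
  | succ m ih =>
    obtain ⟨η, h1, h2⟩ := ih (fun i => f i.succ) (fun i => hsq i.succ)
      (fun i j h => hanti _ _ (by simpa using h))
    have h3 := mul_ofFn_prod (f 0) (fun i : Fin m => f i.succ) (fun _ => (-1 : k))
      (fun j => by rw [hanti _ _ (Fin.succ_ne_zero j).symm]; simp)
    rw [Finset.prod_const, Finset.card_univ, Fintype.card_fin] at h3
    rw [List.ofFn_succ, List.prod_cons]
    set w := (List.ofFn fun i : Fin m => f i.succ).prod
    have hs : ((-1 : k) ^ m) * (-1) ^ m = 1 := by rw [← mul_pow]; simp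
    -- Moving `f 0` past the m other factors gives (-1)^m, and its square gives the remaining -1.
    refine ⟨-((-1) ^ m * η), by linear_combination hs * (η * η) + h1, ?_⟩
    calc f 0 * w * (f 0 * w) = f 0 * w * ((-1 : k) ^ m • (w * f 0)) := by rw [h3]
      _ = (-1 : k) ^ m • (f 0 * (w * w) * f 0) := by simp [mul_assoc]
      _ = _ := by
        rw [h2, ← Algebra.commutes, mul_assoc, hsq, ← Algebra.smul_def, smul_smul, map_neg,
          Algebra.algebraMap_eq_smul_one, smul_neg]

end Anticommuting

/-! ### Simple modules -/

section Schur

variable {A : Type*} [Ring A] [Algebra ℝ A]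
  {S T : Type*} [AddCommGroup S] [Module ℂ S] [AddCommGroup T] [Module ℂ T]

/-- The space of `A`-linear maps between two complex modules. -/
def intertwiners (ρ : A →ₐ[ℝ] Module.End ℂ S) (τ : A →ₐ[ℝ] Module.End ℂ T) :
    Submodule ℂ (S →ₗ[ℂ] T) where
  carrier := {h | ∀ a v, τ a (h v) = h (ρ a v)}
  zero_mem' := fun a v => by simp
  add_mem' := fun hx hy a v => by simp [hx a v, hy a v]
  smul_mem' := fun c x hx a v => by simp [hx a v]

/-- Schur's lemma: an eigenspace of an intertwiner is a nonzero submodule, hence everything. -/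
theorem intertwiners_self_eq_smul [FiniteDimensional ℂ S] {ρ : A →ₐ[ℝ] Module.End ℂ S}
    (hρ : IsSimpleModuleHom ρ) {h : S →ₗ[ℂ] S} (hh : h ∈ intertwiners ρ ρ) :
    ∃ z : ℂ, h = z • 1 := by
  have := hρ.1
  obtain ⟨z, hz⟩ := Module.End.exists_eigenvalue h
  refine ⟨z, ?_⟩
  have h1 : ∀ a, ∀ v ∈ Module.End.eigenspace h z, ρ a v ∈ Module.End.eigenspace h z := by
    intro a v hv
    rw [Module.End.mem_eigenspace_iff] at hv ⊢
    rw [← hh a v, hv, map_smul]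
  rcases hρ.2 _ h1 with h2 | h2
  · exact absurd h2 hz
  · ext v
    have : v ∈ Module.End.eigenspace h z := h2 ▸ trivial
    rw [Module.End.mem_eigenspace_iff] at this
    simpa using this

theorem finrank_intertwiners_self [FiniteDimensional ℂ S] {ρ : A →ₐ[ℝ] Module.End ℂ S}
    (hρ : IsSimpleModuleHom ρ) : Module.finrank ℂ (intertwiners ρ ρ) = 1 := by
  have := hρ.1
  refine finrank_eq_one (⟨1, fun a v => rfl⟩ : intertwiners ρ ρ) ?_ ?_
  · intro h
    exact one_ne_zero (congrArg Subtype.val h)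
  · rintro ⟨h, hh⟩
    obtain ⟨z, rfl⟩ := intertwiners_self_eq_smul hρ hh
    exact ⟨z, rfl⟩

theorem intertwiners_eq_bot {ρ : A →ₐ[ℝ] Module.End ℂ S} {τ : A →ₐ[ℝ] Module.End ℂ T}
    (hρ : IsSimpleModuleHom ρ) (hτ : IsSimpleModuleHom τ) (hne : ¬ AreIsomorphic ρ τ) :
    intertwiners ρ τ = ⊥ := by
  rw [eq_bot_iff]
  intro h hh
  rw [Submodule.mem_bot]
  by_contra h0
  refine hne ?_
  have hk : LinearMap.ker h = ⊥ := by
    refine (hρ.2 (LinearMap.ker h) fun a v hv => ?_).resolve_right fun ht => ?_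
    · rw [LinearMap.mem_ker] at hv ⊢
      rw [← hh a v, hv, map_zero]
    · exact h0 (LinearMap.ker_eq_top.1 ht)
  have hr : LinearMap.range h = ⊤ := by
    refine (hτ.2 (LinearMap.range h) fun a v hv => ?_).resolve_left fun ht => ?_
    · obtain ⟨u, rfl⟩ := hv
      exact ⟨ρ a u, (hh a u).symm⟩
    · exact h0 (LinearMap.range_eq_bot.1 ht)
  exact ⟨LinearEquiv.ofBijective h ⟨LinearMap.ker_eq_bot.1 hk, LinearMap.range_eq_top.1 hr⟩,
    fun a v => (hh a v).symm⟩

/-- The trace of a module over a real algebra, as a real linear functional. -/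
def moduleTrace (ρ : A →ₐ[ℝ] Module.End ℂ S) : A →ₗ[ℝ] ℂ :=
  (LinearMap.trace ℂ S).restrictScalars ℝ ∘ₗ ρ.toLinearMap

theorem moduleTrace_apply (ρ : A →ₐ[ℝ] Module.End ℂ S) (a : A) :
    moduleTrace ρ a = LinearMap.trace ℂ S (ρ a) := rfl

theorem moduleTrace_mul_comm (ρ : A →ₐ[ℝ] Module.End ℂ S) (u v : A) :
    moduleTrace ρ (u * v) = moduleTrace ρ (v * u) := by
  simp only [moduleTrace_apply, map_mul]
  exact LinearMap.trace_mul_comm ℂ _ _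

/-- The representation of the unit group on a module. -/
def unitsRep (ρ : A →ₐ[ℝ] Module.End ℂ S) : Representation ℂ Aˣ S :=
  (ρ : A →* Module.End ℂ S).comp (Units.coeHom A)

theorem unitsRep_apply (ρ : A →ₐ[ℝ] Module.End ℂ S) (u : Aˣ) : unitsRep ρ u = ρ u := rfl

end Schur

/-! ### Averaging over the generators; traces of simple modules -/

section Average

theorem ofFn_one_add_prod {R : Type*} [Ring R] {m : ℕ} (c : Fin m → R) :
    (List.ofFn fun i => 1 + c i).prod = ∑ I, word c I := by
  induction m with
  | zero => simp [word]
  | succ m ih =>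
    rw [List.ofFn_succ, List.prod_cons, ih, ← (Fin.consEquiv fun _ => Bool).sum_comp,
      Fintype.sum_prod_type]
    simp [word_succ, Fin.consEquiv, add_mul, Finset.mul_sum, add_comm, Fin.tail_def, Finset.sum_add_distrib]

theorem mul_prod_eq_of_mem {R : Type*} [Ring R] (x : R) (L : List R)
    (hc : ∀ y ∈ L, Commute x y) (hx : ∃ y ∈ L, x * y = y) : x * L.prod = L.prod := by
  induction L with
  | nil => simp at hx
  | cons a L ih =>
    rw [List.prod_cons]
    obtain ⟨y, hy, hxy⟩ := hx
    rcases List.mem_cons.1 hy with rfl | hy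
    · rw [← mul_assoc, hxy]
    · rw [← mul_assoc, (hc a (by simp)).eq, mul_assoc,
        ih (fun z hz => hc z (by simp [hz])) ⟨y, hy, hxy⟩]

variable {A : Type*} [Ring A] [Algebra ℝ A] {m : ℕ} {f : Fin m → A}
  {S T : Type*} [AddCommGroup S] [Module ℂ S] [AddCommGroup T] [Module ℂ T]

/-- The units underlying a Clifford system. -/
def IsCliffordSystem.unit (hf : IsCliffordSystem ℝ f) (i : Fin m) : Aˣ where
  val := f i
  inv := -f i
  val_inv := by rw [mul_neg, hf.sq, neg_neg]
  inv_val := by rw [neg_mul, hf.sq, neg_neg]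

/-- The operator `∏ᵢ (1 + conj (f i))` on `Hom(S, T)`. -/
def IsCliffordSystem.conjSum (hf : IsCliffordSystem ℝ f) (ρ : A →ₐ[ℝ] Module.End ℂ S)
    (τ : A →ₐ[ℝ] Module.End ℂ T) : Module.End ℂ (S →ₗ[ℂ] T) :=
  (List.ofFn fun i => 1 + (unitsRep ρ).linHom (unitsRep τ) (hf.unit i)).prod

theorem IsCliffordSystem.linHom_apply (hf : IsCliffordSystem ℝ f) (ρ : A →ₐ[ℝ] Module.End ℂ S)
    (τ : A →ₐ[ℝ] Module.End ℂ T) (i : Fin m) (h : S →ₗ[ℂ] T) (v : S) :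
    (unitsRep ρ).linHom (unitsRep τ) (hf.unit i) h v = τ (f i) (h (ρ (-f i) v)) := rfl

/-- Conjugations by the generators are commuting involutions of Hom(S, T), because the scalar -1
acts trivially by conjugation. Half of 1 plus an involution projects onto its fixed vectors, and the
vectors fixed by all of them are the intertwiners. -/
theorem IsCliffordSystem.conjSum_isProj (hf : IsCliffordSystem ℝ f)
    (ρ : A →ₐ[ℝ] Module.End ℂ S) (τ : A →ₐ[ℝ] Module.End ℂ T) :
    LinearMap.IsProj (intertwiners ρ τ) (((2 : ℂ) ^ m)⁻¹ • hf.conjSum ρ τ) := by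
  constructor
  · intro h
    refine Submodule.smul_mem _ _ ?_
    have key : ∀ i, (unitsRep ρ).linHom (unitsRep τ) (hf.unit i) (hf.conjSum ρ τ h) =
        hf.conjSum ρ τ h := by
      intro i
      rw [← Module.End.mul_apply]
      congr 1
      refine mul_prod_eq_of_mem _ _ (fun y hy => ?_) ?_
      · obtain ⟨j, rfl⟩ := List.mem_ofFn.1 hy
        refine (Commute.one_right _).add_right ?_
        rcases eq_or_ne i j with rfl | hij
        · exact Commute.refl _
        have : hf.unit i * hf.unit j = -(hf.unit j * hf.unit i) :=
          Units.ext (hf.anti i j hij)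
        rw [Commute, SemiconjBy, ← map_mul, ← map_mul, this]
        ext h v
        simp [Representation.linHom_apply, unitsRep_apply]
      · refine ⟨_, List.mem_ofFn.2 ⟨i, rfl⟩, ?_⟩
        have : hf.unit i * hf.unit i = -1 := Units.ext (hf.sq i)
        rw [mul_add, mul_one, ← map_mul, this, add_comm]
        congr 1
        ext h v
        simp [Representation.linHom_apply, unitsRep_apply]
    generalize hf.conjSum ρ τ h = g at key
    intro a
    have ha : a ∈ Algebra.adjoin ℝ (Set.range f) := hf.gen ▸ trivial
    induction ha using Algebra.adjoin_induction with
    | mem x hx =>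
      obtain ⟨i, rfl⟩ := hx
      intro v
      have := congrArg (fun u : S →ₗ[ℂ] T => u (ρ (f i) v)) (key i)
      simp only [hf.linHom_apply, ← Module.End.mul_apply, ← map_mul, neg_mul, hf.sq] at this
      simpa using this
    | algebraMap r => intro v; simp [Algebra.algebraMap_eq_smul_one]
    | add a b _ _ ha hb => intro v; simp [ha v, hb v]
    | mul a b _ _ ha hb => intro v; simp [ha, hb]
  · intro h hh
    have h1 : ∀ i, (unitsRep ρ).linHom (unitsRep τ) (hf.unit i) h = h := by
      intro i
      ext v
      rw [hf.linHom_apply, hh, ← Module.End.mul_apply, ← map_mul, mul_neg, hf.sq]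
      simp
    have h2 : ∀ (n : ℕ) (c : Fin n → Module.End ℂ (S →ₗ[ℂ] T)), (∀ i, c i h = h) →
        (List.ofFn fun i => 1 + c i).prod h = (2 : ℂ) ^ n • h := by
      intro n c hc
      induction n with
      | zero => simp
      | succ n ih =>
        rw [List.ofFn_succ, List.prod_cons, Module.End.mul_apply, ih _ fun i => hc _]
        simp [hc, pow_succ, mul_smul, two_smul]
    rw [LinearMap.smul_apply, IsCliffordSystem.conjSum, h2 m _ h1, smul_smul,
      inv_mul_cancel₀ (pow_ne_zero _ two_ne_zero), one_smul]

/-- The dimension is the trace of the projector. Expanded over words u, conjugation by u has trace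
tr ρ(u⁻¹) tr τ(u), and by `tracial_word` only the empty and the full word contribute; these differ
because m > 0. -/
theorem IsCliffordSystem.finrank_intertwiners [FiniteDimensional ℂ S] [FiniteDimensional ℂ T]
    (hf : IsCliffordSystem ℝ f) (hm : 0 < m) (ρ : A →ₐ[ℝ] Module.End ℂ S)
    (τ : A →ₐ[ℝ] Module.End ℂ T) {η : ℝ} (hη : η * η = 1)
    (hφ : (List.ofFn f).prod * (List.ofFn f).prod = algebraMap ℝ A η) :
    (2 : ℂ) ^ m * Module.finrank ℂ (intertwiners ρ τ) =
      Module.finrank ℂ S * Module.finrank ℂ T +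
        η * moduleTrace ρ (List.ofFn f).prod * moduleTrace τ (List.ofFn f).prod := by
  rw [← (hf.conjSum_isProj ρ τ).trace, map_smul, smul_eq_mul,
    mul_inv_cancel_left₀ (pow_ne_zero _ two_ne_zero), IsCliffordSystem.conjSum, ofFn_one_add_prod,
    map_sum]
  have hw : ∀ I, ∃ u : Aˣ, (u : A) = word f I ∧
      word (fun i => (unitsRep ρ).linHom (unitsRep τ) (hf.unit i)) I =
        (unitsRep ρ).linHom (unitsRep τ) u := by
    intro I
    refine ⟨(List.ofFn fun i => if I i then hf.unit i else 1).prod, ?_, ?_⟩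
    · rw [← Units.coeHom_apply, map_list_prod, List.map_ofFn, word]
      congr 2
      ext i
      by_cases h : I i <;> simp [h, IsCliffordSystem.unit]
    · rw [map_list_prod, List.map_ofFn, word]
      congr 2
      funext i
      by_cases h : I i <;> simp [h]
  have ht : ∀ u : Aˣ, LinearMap.trace ℂ _ ((unitsRep ρ).linHom (unitsRep τ) u) =
      moduleTrace ρ (u⁻¹ : Aˣ) * moduleTrace τ u := fun u =>
    Representation.char_linHom (unitsRep ρ) (unitsRep τ) u
  have hne : (fun _ : Fin m => false) ≠ fun _ => true := fun h => by
    simpa using congrFun h ⟨0, hm⟩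
  rw [Fintype.sum_eq_add _ _ hne]
  · obtain ⟨u, hu, hu'⟩ := hw fun _ => false
    obtain ⟨v, hv, hv'⟩ := hw fun _ => true
    rw [hu', hv', ht, ht]
    rw [word_false] at hu
    obtain rfl : u = 1 := Units.ext hu
    rw [word_true] at hv
    -- From φ² = η and η² = 1 the inverse of φ is η φ.
    have hv2 : ((v⁻¹ : Aˣ) : A) = η • (v : A) := by
      rw [← mul_one ((v⁻¹ : Aˣ) : A), Units.inv_mul_eq_iff_eq_mul, mul_smul_comm, hv, hφ,
        Algebra.algebraMap_eq_smul_one, smul_smul, hη, one_smul]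
    rw [hv2, hv, map_smul]
    simp [moduleTrace_apply]
  · rintro I ⟨h0, h1⟩
    obtain ⟨u, hu, hu'⟩ := hw I
    rw [hu', ht, hu, hf.tracial_word (moduleTrace τ) (moduleTrace_mul_comm τ) I h0 h1, mul_zero]

theorem IsCliffordSystem.exists_scalar [FiniteDimensional ℂ S] (hf : IsCliffordSystem ℝ f)
    (hm : Odd m) {ρ : A →ₐ[ℝ] Module.End ℂ S} (hρ : IsSimpleModuleHom ρ) {η : ℝ}
    (hφ : (List.ofFn f).prod * (List.ofFn f).prod = algebraMap ℝ A η) :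
    ∃ z : ℂ, moduleTrace ρ (List.ofFn f).prod = z * Module.finrank ℂ S ∧ z * z = η := by
  have := hρ.1
  have h1 : ρ (List.ofFn f).prod ∈ intertwiners ρ ρ := fun a v => by
    rw [← Module.End.mul_apply, ← map_mul, (hf.commute_prod hm a).eq, map_mul]; rfl
  obtain ⟨z, hz⟩ := intertwiners_self_eq_smul hρ h1
  refine ⟨z, by simp [moduleTrace_apply, hz], ?_⟩
  have h2 := congrArg ρ hφ
  rw [map_mul, hz, AlgHom.commutes] at h2
  obtain ⟨v, hv⟩ := exists_ne (0 : S)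
  have h3 := congrArg (fun u : Module.End ℂ S => u v) h2
  simp only [smul_mul_smul_comm, mul_one, LinearMap.smul_apply, Module.End.one_apply,
    Algebra.algebraMap_eq_smul_one] at h3
  have h4 : (z * z - η) • v = 0 := by
    rw [sub_smul, h3]; simp
  exact sub_eq_zero.1 ((smul_eq_zero.1 h4).resolve_right hv)

/-- The virtual trace of two inequivalent simple modules. -/
theorem IsCliffordSystem.moduleTrace_sub [FiniteDimensional ℂ S] [FiniteDimensional ℂ T]
    (hf : IsCliffordSystem ℝ f) (hm : Odd m) {ρ : A →ₐ[ℝ] Module.End ℂ S}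
    {τ : A →ₐ[ℝ] Module.End ℂ T} (hρ : IsSimpleModuleHom ρ) (hτ : IsSimpleModuleHom τ)
    (hne : ¬ AreIsomorphic ρ τ) {η : ℝ} (hη : η * η = 1)
    (hφ : (List.ofFn f).prod * (List.ofFn f).prod = algebraMap ℝ A η) :
    (moduleTrace ρ - moduleTrace τ) 1 = 0 ∧
      ((moduleTrace ρ - moduleTrace τ) (List.ofFn f).prod) ^ 2 = 2 ^ (m + 1) * η := by
  have := hρ.1
  have hη' : (η : ℂ) * η = 1 := by exact_mod_cast hη
  obtain ⟨z, hz, hzz⟩ := hf.exists_scalar hm hρ hφ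
  obtain ⟨y, hy, hyy⟩ := hf.exists_scalar hm hτ hφ
  have e1 := hf.finrank_intertwiners hm.pos ρ ρ hη hφ
  have e2 := hf.finrank_intertwiners hm.pos τ τ hη hφ
  have e3 := hf.finrank_intertwiners hm.pos ρ τ hη hφ
  rw [finrank_intertwiners_self hρ, hz] at e1
  rw [finrank_intertwiners_self hτ, hy] at e2
  rw [intertwiners_eq_bot hρ hτ hne, hz, hy, finrank_bot] at e3
  -- With z² = y² = η, both self-intertwiner formulas read 2^m = 2 d², so the dimensions agree.
  have hd : Module.finrank ℂ S = Module.finrank ℂ T := by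
    have : (Module.finrank ℂ S : ℂ) ^ 2 = (Module.finrank ℂ T : ℂ) ^ 2 := by
      push_cast at e1 e2
      linear_combination (e2 - e1) / 2 - (Module.finrank ℂ S : ℂ) ^ 2 / 2 * η * hzz +
        (Module.finrank ℂ T : ℂ) ^ 2 / 2 * η * hyy -
        ((Module.finrank ℂ S : ℂ) ^ 2 / 2 - (Module.finrank ℂ T : ℂ) ^ 2 / 2) * hη'
    have : (Module.finrank ℂ S) ^ 2 = (Module.finrank ℂ T) ^ 2 := by exact_mod_cast this
    exact Nat.pow_left_injective (n := 2) (by norm_num) this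
  have hd0 : (Module.finrank ℂ S : ℂ) ≠ 0 := by
    exact_mod_cast (Module.finrank_pos (R := ℂ) (M := S)).ne'
  rw [← hd] at e2 e3 hy
  simp only [LinearMap.sub_apply, hz, hy]
  constructor
  · simp [moduleTrace_apply, hd]
  · have e4 : 1 + η * z * y = 0 := by
      have : (Module.finrank ℂ S : ℂ) ^ 2 * (1 + η * z * y) = 0 := by
        push_cast at e3
        linear_combination -e3
      exact (mul_eq_zero.1 this).resolve_left (pow_ne_zero _ hd0)
    push_cast at e1
    rw [pow_succ]
    linear_combination (Module.finrank ℂ S : ℂ) ^ 2 * (hyy - hzz) - 2 * η * e1 -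
      2 * (Module.finrank ℂ S : ℂ) ^ 2 * (z ^ 2 * hη' + η * e4 - z * y * hη')

end Average

/-! ### Diagonalizable endomorphisms -/

section Diagonal

variable {k V κ : Type*} [Field k] [AddCommGroup V] [Module k V]

theorem toMatrix_eq_diagonal [Fintype κ] [DecidableEq κ] (b : Module.Basis κ k V)
    {f : Module.End k V} {μ : κ → k}
    (h : ∀ i, f (b i) = μ i • b i) : LinearMap.toMatrix b b f = Matrix.diagonal μ := by
  ext i j
  simp [LinearMap.toMatrix_apply, h, Matrix.diagonal_apply, Finsupp.single_apply, eq_comm]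
  aesop

theorem trace_eq_sum_of_basis [Fintype κ] (b : Module.Basis κ k V) {f : Module.End k V}
    {μ : κ → k} (h : ∀ i, f (b i) = μ i • b i) : LinearMap.trace k V f = ∑ i, μ i := by
  classical
  rw [LinearMap.trace_eq_matrix_trace k b, toMatrix_eq_diagonal b h, Matrix.trace_diagonal]

theorem det_eq_prod_of_basis [Fintype κ] (b : Module.Basis κ k V) {f : Module.End k V}
    {μ : κ → k} (h : ∀ i, f (b i) = μ i • b i) : LinearMap.det f = ∏ i, μ i := by
  classical
  rw [← LinearMap.det_toMatrix b, toMatrix_eq_diagonal b h, Matrix.det_diagonal]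

end Diagonal

/-- X^n - 1 is separable over ℂ, so f is semisimple. -/
theorem exists_eigenbasis_of_pow_eq_one {V : Type*} [AddCommGroup V] [Module ℂ V]
    [FiniteDimensional ℂ V] {f : Module.End ℂ V} {n : ℕ} (hn : 0 < n) (hf : f ^ n = 1) :
    ∃ (b : Module.Basis (Fin (Module.finrank ℂ V)) ℂ V) (μ : Fin (Module.finrank ℂ V) → ℂ),
      (∀ i, f (b i) = μ i • b i) ∧ ∀ i, μ i ^ n = 1 := by
  have hs : f.IsSemisimple := by
    refine Module.End.isSemisimple_of_squarefree_aeval_eq_zero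
      (p := (Polynomial.X ^ n - Polynomial.C 1 : Polynomial ℂ)) ?_ ?_
    · exact (Polynomial.separable_X_pow_sub_C 1 (by exact_mod_cast hn.ne') one_ne_zero).squarefree
    · simp [hf]
  classical
  have hI := DirectSum.isInternal_submodule_of_iSupIndep_of_iSup_eq_top
    f.eigenspaces_iSupIndep hs.iSup_eigenspace_eq_top
  let c := hI.collectedBasis fun μ => Module.finBasis ℂ (f.eigenspace μ)
  let e := c.indexEquiv (Module.finBasis ℂ V)
  have hc : ∀ i, f (c i) = i.1 • c i := fun i =>
    Module.End.mem_eigenspace_iff.1 (hI.collectedBasis_mem _ i)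
  refine ⟨c.reindex e, fun i => (e.symm i).1, fun i => by simp [hc], fun i => ?_⟩
  have h1 : ∀ m : ℕ, (f ^ m) (c (e.symm i)) = (e.symm i).1 ^ m • c (e.symm i) := by
    intro m
    induction m with
    | zero => simp
    | succ m ih => rw [pow_succ', Module.End.mul_apply, ih, map_smul, hc, smul_smul, pow_succ]
  have h2 := h1 n
  rw [hf, Module.End.one_apply] at h2
  have h3 : ((e.symm i).1 ^ n - 1) • c (e.symm i) = 0 := by rw [sub_smul, ← h2, one_smul, sub_self]
  exact sub_eq_zero.1 ((smul_eq_zero.1 h3).resolve_right (c.ne_zero _))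

theorem inv_eq_conj_of_pow_eq_one {z : ℂ} {n : ℕ} (hn : 0 < n) (hz : z ^ n = 1) :
    z⁻¹ = (starRingEnd ℂ) z := by
  have : ‖z‖ = 1 := Complex.norm_eq_one_of_pow_eq_one hz hn.ne'
  rw [Complex.inv_def, Complex.normSq_eq_norm_sq, this]
  simp

/-! ### Traces of endomorphisms of a Clifford algebra -/

section CliffordTrace

variable {E : Type*} [AddCommGroup E] [Module ℝ E] [FiniteDimensional ℝ E] (Q : QuadraticForm ℝ E)

instance finite_cliffordAlgebra : Module.Finite ℝ (CliffordAlgebra Q) :=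
  Module.Finite.of_basis ((Module.finBasis ℝ E).ExteriorAlgebra.map
    (CliffordAlgebra.equivExterior Q).symm)

theorem finrank_cliffordAlgebra :
    Module.finrank ℝ (CliffordAlgebra Q) = 2 ^ Module.finrank ℝ E := by
  rw [Module.finrank_eq_card_basis ((Module.finBasis ℝ E).ExteriorAlgebra.map
    (CliffordAlgebra.equivExterior Q).symm)]
  simp

omit [FiniteDimensional ℝ E] in
theorem baseChange_ι_mul_add (x y : ℂ ⊗[ℝ] E) : ∃ c : ℂ,
    (CliffordAlgebra.ι Q).baseChange ℂ x * (CliffordAlgebra.ι Q).baseChange ℂ y +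
      (CliffordAlgebra.ι Q).baseChange ℂ y * (CliffordAlgebra.ι Q).baseChange ℂ x =
        algebraMap ℂ (ℂ ⊗[ℝ] CliffordAlgebra Q) c := by
  induction x with
  | zero => exact ⟨0, by simp⟩
  | add x x' hx hx' =>
    obtain ⟨c, hc⟩ := hx
    obtain ⟨c', hc'⟩ := hx'
    exact ⟨c + c', by rw [map_add, map_add, ← hc, ← hc', add_mul, mul_add]; abel⟩
  | tmul z v =>
    induction y with
    | zero => exact ⟨0, by simp⟩
    | add x x' hx hx' =>
      obtain ⟨c, hc⟩ := hx
      obtain ⟨c', hc'⟩ := hx'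
      exact ⟨c + c', by rw [map_add, map_add, ← hc, ← hc', add_mul, mul_add]; abel⟩
    | tmul w u =>
      refine ⟨z * w * QuadraticMap.polar Q v u, ?_⟩
      simp only [LinearMap.baseChange_tmul, Algebra.TensorProduct.tmul_mul_tmul]
      rw [mul_comm w z, ← TensorProduct.tmul_add, CliffordAlgebra.ι_mul_ι_add_swap,
        Algebra.algebraMap_eq_smul_one, TensorProduct.tmul_smul, TensorProduct.smul_tmul',
        Algebra.TensorProduct.algebraMap_apply]
      simp [mul_comm]

omit [FiniteDimensional ℝ E] in
theorem adjoin_baseChange_ι {κ : Type*} (b : Module.Basis κ ℂ (ℂ ⊗[ℝ] E)) :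
    Algebra.adjoin ℂ (Set.range fun i => (CliffordAlgebra.ι Q).baseChange ℂ (b i)) = ⊤ := by
  set B := Algebra.adjoin ℂ (Set.range fun i => (CliffordAlgebra.ι Q).baseChange ℂ (b i))
  have h1 : ∀ x, (CliffordAlgebra.ι Q).baseChange ℂ x ∈ B := by
    intro x
    induction b.mem_span x using Submodule.span_induction with
    | mem x hx =>
      obtain ⟨i, rfl⟩ := hx
      exact Algebra.subset_adjoin ⟨i, rfl⟩
    | zero => rw [map_zero]; exact zero_mem _
    | add x y _ _ hx hy => rw [map_add]; exact add_mem hx hy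
    | smul c x _ hx => rw [map_smul]; exact Subalgebra.smul_mem _ hx _
  have h2 : ∀ x : CliffordAlgebra Q, (1 : ℂ) ⊗ₜ[ℝ] x ∈ B := by
    intro x
    induction x using CliffordAlgebra.induction with
    | algebraMap r =>
      rw [Algebra.algebraMap_eq_smul_one, TensorProduct.tmul_smul, TensorProduct.smul_tmul',
        show (r • (1 : ℂ)) ⊗ₜ[ℝ] (1 : CliffordAlgebra Q) = algebraMap ℂ _ (r • 1) from rfl]
      exact Subalgebra.algebraMap_mem _ _
    | ι v => simpa using h1 (1 ⊗ₜ v)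
    | mul a b ha hb => simpa using mul_mem ha hb
    | add a b ha hb => rw [TensorProduct.tmul_add]; exact add_mem ha hb
  rw [eq_top_iff]
  rintro x -
  induction x with
  | zero => exact zero_mem _
  | add x y hx hy => exact add_mem hx hy
  | tmul z x => simpa [TensorProduct.smul_tmul'] using Subalgebra.smul_mem _ (h2 x) z

theorem sum_word_prod {m : ℕ} (μ : Fin m → ℂ) :
    ∑ I : Fin m → Bool, ∏ i, (if I i then μ i else 1) = ∏ i, (1 + μ i) := by
  have h : ∀ i, 1 + μ i = ∑ c : Bool, if c then μ i else 1 := fun i => by simp [add_comm]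
  simp_rw [h]
  rw [Finset.prod_univ_sum, Fintype.piFinset_univ]

/-- The trace of the endomorphism of a Clifford algebra induced by `u` is `det (1 + u)`. -/
theorem trace_of_ι_comp {Ψ : CliffordAlgebra Q →ₐ[ℝ] CliffordAlgebra Q} {u : Module.End ℝ E}
    (hΨ : ∀ x, Ψ (CliffordAlgebra.ι Q x) = CliffordAlgebra.ι Q (u x)) {n : ℕ} (hn : 0 < n)
    (hu : u ^ n = 1) :
    LinearMap.trace ℝ (CliffordAlgebra Q) Ψ.toLinearMap = LinearMap.det (1 + u) := by
  have hu' : (u.baseChange ℂ) ^ n = 1 := by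
    rw [← LinearMap.baseChange_pow, hu, LinearMap.baseChange_one]
  -- A real map of finite order is in general diagonalizable only over ℂ. The words in an eigenbasis
  -- span the complexified Clifford algebra, and there are as many of them as its dimension, so they
  -- form a basis.
  obtain ⟨b, μ, hb, -⟩ := exists_eigenbasis_of_pow_eq_one hn hu'
  let v : Fin (Module.finrank ℂ (ℂ ⊗[ℝ] E)) → ℂ ⊗[ℝ] CliffordAlgebra Q := fun i => (CliffordAlgebra.ι Q).baseChange ℂ (b i)
  have hspan := span_word_eq_top two_ne_zero v (fun i j => baseChange_ι_mul_add Q _ _)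
    (adjoin_baseChange_ι Q b)
  let c := basisOfTopLeSpanOfCardEqFinrank (word v) hspan.ge (by
    simp [finrank_cliffordAlgebra])
  let F := Algebra.TensorProduct.map (AlgHom.id ℂ ℂ) Ψ
  have hF : F.toLinearMap = Ψ.toLinearMap.baseChange ℂ := by
    refine LinearMap.ext fun x => ?_
    induction x with
    | zero => simp
    | add x y hx hy => rw [map_add, map_add, hx, hy]
    | tmul z x => rfl
  have hFι : ∀ x, F ((CliffordAlgebra.ι Q).baseChange ℂ x) =
      (CliffordAlgebra.ι Q).baseChange ℂ (u.baseChange ℂ x) := by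
    intro x
    induction x with
    | zero => simp
    | add x y hx hy => simp only [map_add, hx, hy]
    | tmul z x => simp [F, hΨ]
  -- A word in eigenvectors is an eigenvector for the product of their eigenvalues; the sum of these
  -- products over all words is ∏ (1 + μ i).
  have hFw : ∀ I, F.toLinearMap (c I) = (∏ i, if I i then μ i else 1) • c I := by
    intro I
    simp only [c, coe_basisOfTopLeSpanOfCardEqFinrank]
    have key : ∀ (r : ℕ) (y : Fin r → ℂ ⊗[ℝ] CliffordAlgebra Q) (s : Fin r → ℂ),
        (∀ i, F (y i) = s i • y i) → F (List.ofFn y).prod = (∏ i, s i) • (List.ofFn y).prod := by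
      intro r y s h
      induction r with
      | zero => simp
      | succ r ih =>
        rw [List.ofFn_succ, List.prod_cons, map_mul, h, ih _ _ fun i => h i.succ,
          Fin.prod_univ_succ, smul_mul_smul_comm]
    refine key _ _ _ fun i => ?_
    by_cases h : I i = true
    · simp only [h, if_true, v, hFι, hb, map_smul]
    · simp [h]
  have h1 := LinearMap.trace_baseChange Ψ.toLinearMap ℂ
  rw [← hF, trace_eq_sum_of_basis c hFw, sum_word_prod] at h1
  have h2 : LinearMap.det ((1 + u).baseChange ℂ) = ∏ i, (1 + μ i) := by
    refine det_eq_prod_of_basis b fun i => ?_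
    rw [LinearMap.baseChange_add, LinearMap.baseChange_one, LinearMap.add_apply, hb, add_smul]
    simp
  rw [LinearMap.det_baseChange] at h2
  exact (algebraMap ℝ ℂ).injective (h1.symm.trans h2.symm)

end CliffordTrace

/-! ### Graded traces on symmetric powers -/

section SymTrace

variable {k V κ : Type*} [Field k] [AddCommGroup V] [Module k V] [Fintype κ] [DecidableEq κ]

omit [DecidableEq κ] in
theorem symmetricAlgebra_basis_apply (b : Module.Basis κ k V) (m : κ →₀ ℕ) :
    b.symmetricAlgebra m = ∏ i, SymmetricAlgebra.ι k V (b i) ^ m i := by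
  rw [Module.Basis.symmetricAlgebra, Module.Basis.map_apply, MvPolynomial.coe_basisMonomials]
  simp [MvPolynomial.monomial_eq, Finsupp.prod_fintype]

theorem symPow_eq_span (b : Module.Basis κ k V) (i : ℕ) :
    symPow k V i = Submodule.span k (b.symmetricAlgebra '' {m | ∑ j, m j = i}) := by
  have hr : LinearMap.range (SymmetricAlgebra.ι k V) =
      Submodule.span k (Set.range fun j => SymmetricAlgebra.ι k V (b j)) := by
    rw [LinearMap.range_eq_map, ← b.span_eq, Submodule.map_span, ← Set.range_comp]
    rfl
  apply le_antisymm
  · induction i with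
    | zero =>
      rw [symPow, pow_zero, Submodule.one_le]
      refine Submodule.subset_span ⟨0, by simp, by simp [symmetricAlgebra_basis_apply]⟩
    | succ i ih =>
      rw [symPow, pow_succ]
      refine (mul_le_mul_left ih _).trans ?_
      rw [hr, Submodule.span_mul_span, Submodule.span_le]
      rintro _ ⟨_, ⟨m, hm, rfl⟩, _, ⟨j, rfl⟩, rfl⟩
      refine Submodule.subset_span ⟨m + Finsupp.single j 1, ?_, ?_⟩
      · simp only [Set.mem_ofPred_eq] at hm ⊢
        simp [Finset.sum_add_distrib, hm, Finsupp.single_apply]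
      · simp only [symmetricAlgebra_basis_apply, Finsupp.add_apply, pow_add,
          Finset.prod_mul_distrib, Finsupp.single_apply]
        congr 1
        rw [Finset.prod_eq_single j] <;> simp +contextual [eq_comm]
  · rw [Submodule.span_le]
    rintro _ ⟨m, hm, rfl⟩
    rw [SetLike.mem_coe, symmetricAlgebra_basis_apply, symPow, ← hm]
    have : ∀ s : Finset κ, ∏ j ∈ s, SymmetricAlgebra.ι k V (b j) ^ m j ∈
        LinearMap.range (SymmetricAlgebra.ι k V) ^ ∑ j ∈ s, m j := by
      intro s
      induction s using Finset.induction_on with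
      | empty => simp [Submodule.one_le.1 le_rfl]
      | insert a s ha ih =>
        rw [Finset.prod_insert ha, Finset.sum_insert ha, pow_add]
        exact Submodule.mul_mem_mul (Submodule.pow_mem_pow _ (LinearMap.mem_range_self _ _) _) ih
    exact this _

theorem trace_symPowMap (b : Module.Basis κ k V) {f : V →ₗ[k] V} {μ : κ → k}
    (h : ∀ j, f (b j) = μ j • b j) (i : ℕ) :
    LinearMap.trace k _ (symPowMap f i) =
      ∑ m ∈ Finset.finsuppAntidiag Finset.univ i, ∏ j, μ j ^ m j := by
  let s : Finset (κ →₀ ℕ) := Finset.finsuppAntidiag Finset.univ i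
  have hs : (s : Set (κ →₀ ℕ)) = {m | ∑ j, m j = i} := by
    ext m; simp [s, Finset.mem_finsuppAntidiag]
  have hli : LinearIndependent k fun m : s => b.symmetricAlgebra m.1 :=
    b.symmetricAlgebra.linearIndependent.comp _ Subtype.val_injective
  have hsp : symPow k V i = Submodule.span k (Set.range fun m : s => b.symmetricAlgebra m.1) := by
    rw [symPow_eq_span b, ← hs]
    congr 1
    ext x; simp
  let c : Module.Basis s k (symPow k V i) :=
    (Module.Basis.span hli).map (LinearEquiv.ofEq _ _ hsp.symm)
  have hc : ∀ m : s, ((c m : symPow k V i) : SymmetricAlgebra k V) = b.symmetricAlgebra m.1 := by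
    intro m
    simp [c, Module.Basis.span_apply]
  rw [trace_eq_sum_of_basis c (μ := fun m => ∏ j, μ j ^ m.1 j), Finset.sum_coe_sort s
    (fun m => ∏ j, μ j ^ m j)]
  intro m
  apply Subtype.ext
  rw [Submodule.coe_smul, hc]
  change symMap f (c m : SymmetricAlgebra k V) = _
  rw [hc, symmetricAlgebra_basis_apply, map_prod, ← Finset.prod_smul]
  refine Finset.prod_congr rfl fun j _ => ?_
  rw [map_pow, symMap, SymmetricAlgebra.lift_ι_apply, LinearMap.comp_apply, h, map_smul, smul_pow]

/-- Molien's formula: the monomials in an eigenbasis diagonalize each symmetric power, so the graded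
trace is a product of geometric series. -/
theorem mk_trace_symPowMap_mul (b : Module.Basis κ k V) {f : V →ₗ[k] V} {μ : κ → k}
    (h : ∀ j, f (b j) = μ j • b j) :
    (PowerSeries.mk fun i => LinearMap.trace k _ (symPowMap f i)) *
      ∏ j, (1 - PowerSeries.C (μ j) * PowerSeries.X) = 1 := by
  have h1 : (PowerSeries.mk fun i => LinearMap.trace k _ (symPowMap f i)) =
      ∏ j, PowerSeries.mk fun n => μ j ^ n := by
    ext i
    rw [PowerSeries.coeff_prod, PowerSeries.coeff_mk, trace_symPowMap b h]
    simp
  rw [h1, ← Finset.prod_mul_distrib]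
  refine Finset.prod_eq_one fun j _ => ?_
  ext n
  rw [mul_sub, mul_one, ← mul_assoc, mul_comm _ (PowerSeries.C _), mul_assoc]
  cases n with
  | zero => simp
  | succ n => simp [PowerSeries.coeff_succ_mul_X, pow_succ', PowerSeries.coeff_one]

end SymTrace

/-! ### The polynomial det(1 - q w) -/

section DetOneSub

variable {E : Type*} [AddCommGroup E] [Module ℝ E] [FiniteDimensional ℝ E]

theorem detOneSubX_eq_prod {κ : Type*} [Fintype κ] (w : E ≃ₗ[ℝ] E)
    (b : Module.Basis κ ℂ (ℂ ⊗[ℝ] E)) {μ : κ → ℂ}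
    (h : ∀ j, (w : E →ₗ[ℝ] E).baseChange ℂ (b j) = μ j • b j) :
    detOneSubX w = ∏ j, (1 - Polynomial.C (μ j) * Polynomial.X) := by
  classical
  have h1 : ((LinearMap.toMatrix (Module.finBasis ℝ E) (Module.finBasis ℝ E)
      (w : E →ₗ[ℝ] E)).charpoly).map (algebraMap ℝ ℂ) =
      ∏ j, (Polynomial.X - Polynomial.C (μ j)) := by
    rw [LinearMap.charpoly_toMatrix, ← LinearMap.charpoly_baseChange, ← LinearMap.charpoly_toMatrix _ b,
      toMatrix_eq_diagonal b h, Matrix.charpoly_diagonal]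
  -- `charpolyRev` is the reverse of the characteristic polynomial, and reversal is multiplicative
  -- over a domain.
  have h2 : ∀ s : Finset κ, (∏ j ∈ s, (Polynomial.X - Polynomial.C (μ j))).reverse =
      ∏ j ∈ s, (1 - Polynomial.C (μ j) * Polynomial.X) := by
    intro s
    induction s using Finset.induction_on with
    | empty => simp [← Polynomial.C_1, -map_one]
    | insert a s ha ih =>
      rw [Finset.prod_insert ha, Finset.prod_insert ha, Polynomial.reverse_mul_of_domain, ih]
      congr 1
      have hX : (Polynomial.X : Polynomial ℂ).reverse = 1 := by
        rw [← one_mul Polynomial.X, Polynomial.reverse_mul_X, ← Polynomial.C_1,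
          Polynomial.reverse_C]
      rw [sub_eq_add_neg, ← map_neg, Polynomial.reverse_add_C, hX]
      simp [sub_eq_add_neg]
  rw [detOneSubX, ← Matrix.reverse_charpoly, ← h2, ← h1]
  rw [Polynomial.reverse, Polynomial.reverse, Polynomial.reflect_map,
    Polynomial.natDegree_map_eq_of_injective (algebraMap ℝ ℂ).injective]

omit [FiniteDimensional ℝ E] in
theorem coe_pow_eq_one {w : E ≃ₗ[ℝ] E} {n : ℕ} (hw : w ^ n = 1) : (w : E →ₗ[ℝ] E) ^ n = 1 := by
  have := congrArg (LinearEquiv.automorphismGroup.toLinearMapMonoidHom (R := ℝ) (M := E)) hw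
  rwa [map_pow, map_one] at this

omit [FiniteDimensional ℝ E] in
theorem baseChange_pow_eq_one {w : E ≃ₗ[ℝ] E} {n : ℕ} (hw : w ^ n = 1) :
    ((w : E →ₗ[ℝ] E).baseChange ℂ) ^ n = 1 := by
  rw [← LinearMap.baseChange_pow, coe_pow_eq_one hw, LinearMap.baseChange_one]

/-- For `w` of finite order, `∑ qⁱ tr(w, Sⁱ E)` is the inverse of `det (1 - q w)`. -/
theorem mk_trace_symPow_mul_detOneSubX {w : E ≃ₗ[ℝ] E} {n : ℕ} (hn : 0 < n) (hw : w ^ n = 1) :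
    (PowerSeries.mk fun i => LinearMap.trace ℂ _
      (symPowMap ((w : E →ₗ[ℝ] E).baseChange ℂ) i)) * (detOneSubX w : ℂ⟦X⟧) = 1 := by
  obtain ⟨b, μ, hb, -⟩ := exists_eigenbasis_of_pow_eq_one hn (baseChange_pow_eq_one hw)
  rw [detOneSubX_eq_prod w b hb]
  convert mk_trace_symPowMap_mul b hb using 2
  rw [← Polynomial.coeToPowerSeries.ringHom_apply, map_prod]
  simp

/-- The eigenvalues are roots of unity, so those of w⁻¹ are their conjugates, while det(1 - q w) has
real coefficients. -/
theorem detOneSubX_inv {w : E ≃ₗ[ℝ] E} {n : ℕ} (hn : 0 < n) (hw : w ^ n = 1) :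
    detOneSubX w⁻¹ = detOneSubX w := by
  obtain ⟨b, μ, hb, hμ⟩ := exists_eigenbasis_of_pow_eq_one hn (baseChange_pow_eq_one hw)
  have hb' : ∀ j, ((w⁻¹ : E ≃ₗ[ℝ] E) : E →ₗ[ℝ] E).baseChange ℂ (b j) =
      (starRingEnd ℂ) (μ j) • b j := by
    intro j
    have h0 : μ j ≠ 0 := fun h0 => by
      have := hμ j
      rw [h0, zero_pow hn.ne'] at this
      exact zero_ne_one this
    rw [← inv_eq_conj_of_pow_eq_one hn (hμ j)]
    have h1 : (w : E →ₗ[ℝ] E).baseChange ℂ ((μ j)⁻¹ • b j) = b j := by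
      rw [map_smul, hb, smul_smul, inv_mul_cancel₀ h0, one_smul]
    conv_lhs => rw [← h1]
    rw [← LinearMap.comp_apply, ← LinearMap.baseChange_comp]
    have : ((w⁻¹ : E ≃ₗ[ℝ] E) : E →ₗ[ℝ] E) ∘ₗ (w : E →ₗ[ℝ] E) = LinearMap.id := by
      ext x
      exact w.symm_apply_apply x
    rw [this, LinearMap.baseChange_id, LinearMap.id_apply]
  have h2 : (detOneSubX w).map (starRingEnd ℂ) = detOneSubX w := by
    rw [detOneSubX, Polynomial.map_map]
    congr 1
    ext x
    simp
  rw [detOneSubX_eq_prod _ b hb', ← h2, detOneSubX_eq_prod _ b hb, Polynomial.map_prod]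
  simp

end DetOneSub

/-! ### Characters with prescribed central elements -/

section CharacterTheory

/-- `χ` is the character of a representation of `G` in which the elements of `Z` act by `-1`. -/
def IsCharacterOn {G : Type*} [Group G] (Z : Set G) (χ : G → ℂ) : Prop :=
  ∃ (n : ℕ) (ρ : Representation ℂ G (Fin n → ℂ)), (∀ z ∈ Z, ρ z = -1) ∧ ρ.character = χ

variable {G : Type*} [Group G] {Z : Set G}
  {V U : Type*} [AddCommGroup V] [Module ℂ V] [FiniteDimensional ℂ V]
  [AddCommGroup U] [Module ℂ U] [FiniteDimensional ℂ U]

theorem isCharacter_iff {χ : G → ℂ} : IsCharacter G χ ↔ IsCharacterOn ∅ χ := by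
  simp [IsCharacter, IsCharacterOn]

theorem IsCharacterOn.isCharacter {χ : G → ℂ} (h : IsCharacterOn Z χ) : IsCharacter G χ := by
  obtain ⟨n, ρ, -, h⟩ := h
  exact ⟨n, ρ, h⟩

theorem isCharacterOn_character {ρ : Representation ℂ G V} (hρ : ∀ z ∈ Z, ρ z = -1) :
    IsCharacterOn Z ρ.character := by
  let e : V ≃ₗ[ℂ] (Fin (Module.finrank ℂ V) → ℂ) := (Module.finBasis ℂ V).equivFun
  refine ⟨Module.finrank ℂ V, (e.conjRingEquiv : Module.End ℂ V →*
    Module.End ℂ (Fin (Module.finrank ℂ V) → ℂ)).comp ρ, fun z hz => ?_, ?_⟩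
  · ext v
    simp [hρ z hz]
  · ext g
    exact LinearMap.trace_conj' (ρ g) e

theorem isCharacter_character (ρ : Representation ℂ G V) : IsCharacter G ρ.character :=
  isCharacter_iff.2 (isCharacterOn_character (by simp))

theorem IsCharacterOn.add {χ ψ : G → ℂ} (hχ : IsCharacterOn Z χ) (hψ : IsCharacterOn Z ψ) :
    IsCharacterOn Z (χ + ψ) := by
  obtain ⟨n, ρ, hρ, rfl⟩ := hχ
  obtain ⟨m, τ, hτ, rfl⟩ := hψ
  have : ρ.character + τ.character = (ρ.prod τ).character := by
    ext g
    exact (LinearMap.trace_prodMap' (ρ g) (τ g)).symm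
  rw [this]
  refine isCharacterOn_character fun z hz => ?_
  ext v <;> simp [hρ z hz, hτ z hz]

theorem IsCharacterOn.comp {H : Type*} [Group H] {Y : Set H} {χ : G → ℂ} (hχ : IsCharacterOn Z χ)
    (φ : H →* G) (hφ : ∀ y ∈ Y, φ y ∈ Z) : IsCharacterOn Y (χ ∘ φ) := by
  obtain ⟨n, ρ, hρ, rfl⟩ := hχ
  exact ⟨n, ρ.comp φ, fun y hy => hρ _ (hφ y hy), rfl⟩

theorem IsCharacterOn.comp_mul {H : Type*} [Group H] {χ : H → ℂ} {ψ : G → ℂ}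
    (hχ : IsCharacter H χ) (hψ : IsCharacterOn Z ψ) (φ : G →* H) (hφ : ∀ z ∈ Z, φ z = 1) :
    IsCharacterOn Z fun g => χ (φ g) * ψ g := by
  obtain ⟨n, ρ, rfl⟩ := hχ
  obtain ⟨m, τ, hτ, rfl⟩ := hψ
  have : (fun g => ρ.character (φ g) * τ.character g) =
      (Representation.tprod (ρ.comp φ) τ).character := by
    rw [Representation.char_tensor]; rfl
  rw [this]
  refine isCharacterOn_character fun z hz => ?_
  rw [Representation.tprod_apply, hτ z hz, MonoidHom.comp_apply, hφ z hz, map_one]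
  ext
  simp [TensorProduct.tmul_neg]

theorem isCharacter_inv {χ : G → ℂ} (hχ : IsCharacter G χ) : IsCharacter G fun g => χ g⁻¹ := by
  obtain ⟨n, ρ, rfl⟩ := hχ
  convert isCharacter_character ρ.dual using 1
  ext g
  rw [Representation.char_dual]

theorem exists_sub_of_mem_virtualCharacters {χ : G → ℂ} (hχ : χ ∈ virtualCharacters G) :
    ∃ a b, IsCharacter G a ∧ IsCharacter G b ∧ χ = a - b := by
  have h0 : IsCharacter G (0 : G → ℂ) :=
    ⟨0, 1, by ext g; simp [Representation.character]⟩
  induction hχ using AddSubgroup.closure_induction with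
  | mem x hx => exact ⟨x, 0, hx, h0, by simp⟩
  | zero => exact ⟨0, 0, h0, h0, by simp⟩
  | add x y _ _ hx hy =>
    obtain ⟨a, b, ha, hb, rfl⟩ := hx
    obtain ⟨c, d, hc, hd, rfl⟩ := hy
    rw [isCharacter_iff] at ha hb hc hd
    exact ⟨a + c, b + d, isCharacter_iff.2 (ha.add hc), isCharacter_iff.2 (hb.add hd), by abel⟩
  | neg x _ hx =>
    obtain ⟨a, b, ha, hb, rfl⟩ := hx
    exact ⟨b, a, hb, ha, by abel⟩

theorem inv_mem_virtualCharacters {χ : G → ℂ} (hχ : χ ∈ virtualCharacters G) :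
    (fun g => χ g⁻¹) ∈ virtualCharacters G := by
  obtain ⟨a, b, ha, hb, rfl⟩ := exists_sub_of_mem_virtualCharacters hχ
  exact sub_mem (AddSubgroup.subset_closure (isCharacter_inv ha))
    (AddSubgroup.subset_closure (isCharacter_inv hb))

variable [Finite G]

theorem trace_inv_eq_conj {f g : Module.End ℂ V} (hfg : f * g = 1) {n : ℕ} (hn : 0 < n)
    (hf : f ^ n = 1) : LinearMap.trace ℂ V g = (starRingEnd ℂ) (LinearMap.trace ℂ V f) := by
  obtain ⟨b, μ, hb, hμ⟩ := exists_eigenbasis_of_pow_eq_one hn hf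
  have hgf : g * f = 1 := mul_eq_one_comm.1 hfg
  have hg : ∀ i, g (b i) = (starRingEnd ℂ) (μ i) • b i := by
    intro i
    have h0 : μ i ≠ 0 := fun h0 => by
      have := hμ i
      rw [h0, zero_pow hn.ne'] at this
      exact zero_ne_one this
    have h1 : g (f (b i)) = b i := by rw [← Module.End.mul_apply, hgf]; rfl
    rw [hb, map_smul] at h1
    rw [← inv_eq_conj_of_pow_eq_one hn (hμ i)]
    conv_rhs => rw [← h1, smul_smul, inv_mul_cancel₀ h0, one_smul]
  rw [trace_eq_sum_of_basis b hg, trace_eq_sum_of_basis b hb, map_sum]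

theorem IsCharacter.inv_apply {χ : G → ℂ} (hχ : IsCharacter G χ) (g : G) :
    χ g⁻¹ = (starRingEnd ℂ) (χ g) := by
  obtain ⟨n, ρ, rfl⟩ := hχ
  refine trace_inv_eq_conj (f := ρ g) (by rw [← map_mul]; simp) (orderOf_pos g) ?_
  rw [← map_pow, pow_orderOf_eq_one, map_one]

theorem inv_apply_of_mem_virtualCharacters {χ : G → ℂ} (hχ : χ ∈ virtualCharacters G) (g : G) :
    χ g⁻¹ = (starRingEnd ℂ) (χ g) := by
  obtain ⟨a, b, ha, hb, rfl⟩ := exists_sub_of_mem_virtualCharacters hχ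
  simp [ha.inv_apply, hb.inv_apply]

omit [Finite G] in
theorem charPairing_eq_sum [Fintype G] (χ ψ : G → ℂ) :
    charPairing χ ψ = (Nat.card G : ℂ)⁻¹ * ∑ g, χ g * ψ g⁻¹ := by
  rw [charPairing, finsum_eq_sum_of_fintype]

theorem charPairing_comm (χ ψ : G → ℂ) : charPairing χ ψ = charPairing ψ χ := by
  have := Fintype.ofFinite G
  rw [charPairing_eq_sum, charPairing_eq_sum, ← Equiv.sum_comp (Equiv.inv G)]
  simp [mul_comm]

theorem charPairing_comp_equiv {H : Type*} [Group H] (e : H ≃* G) (χ ψ : G → ℂ) :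
    charPairing (χ ∘ e) (ψ ∘ e) = charPairing χ ψ := by
  have := Fintype.ofFinite G
  have := Fintype.ofEquiv G e.symm.toEquiv
  rw [charPairing_eq_sum, charPairing_eq_sum, Nat.card_congr e.toEquiv,
    ← Equiv.sum_comp e.toEquiv]
  simp

theorem charPairing_add_right (χ ψ φ : G → ℂ) :
    charPairing χ (ψ + φ) = charPairing χ ψ + charPairing χ φ := by
  have := Fintype.ofFinite G
  simp [charPairing_eq_sum, mul_add, Finset.sum_add_distrib]

theorem charPairing_character (ρ : Representation ℂ G V) (τ : Representation ℂ G U) :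
    charPairing τ.character ρ.character =
      Module.finrank ℂ (Representation.IntertwiningMap ρ τ) := by
  have := Fintype.ofFinite G
  have : Invertible (Nat.card G : ℂ) := invertibleOfNonzero (by simp)
  rw [charPairing_eq_sum, Representation.card_inv_mul_sum_char_mul_char_eq_finrank]

theorem charPairing_nonneg {χ ψ : G → ℂ} (hχ : IsCharacter G χ) (hψ : IsCharacter G ψ) :
    ∃ n : ℕ, charPairing χ ψ = n := by
  obtain ⟨n, ρ, rfl⟩ := hχ
  obtain ⟨m, τ, rfl⟩ := hψ
  exact ⟨_, charPairing_character τ ρ⟩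

/-- The two parts of a virtual character without common constituents are determined by it. -/
theorem orthogonal_parts_unique {a b a' b' : G → ℂ} (ha : IsCharacter G a) (hb : IsCharacter G b)
    (ha' : IsCharacter G a') (hb' : IsCharacter G b') (h : charPairing a b = 0)
    (h' : charPairing a' b' = 0) (hab : a - b = a' - b') : a = a' ∧ b = b' := by
  have := Fintype.ofFinite G
  have e1 : a + b' = a' + b := by
    have := congrArg (fun x => x + b + b') hab
    simpa [add_comm, add_left_comm, add_assoc] using this
  have p1 := congrArg (charPairing a) e1
  have p2 := congrArg (charPairing a') e1
  simp only [charPairing_add_right, h, h', add_zero] at p1 p2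
  obtain ⟨n, hn⟩ := charPairing_nonneg ha hb'
  obtain ⟨m, hm⟩ := charPairing_nonneg ha' hb
  -- Pairing a + b' = a' + b with a and with a', the squared norm of a - a' becomes -(⟨a, b'⟩ + ⟨a',
  -- b⟩), which is at most 0; hence it is 0.
  have e2 : charPairing (a - a') (a - a') = -((n + m : ℕ) : ℂ) := by
    have : charPairing (a - a') (a - a') = charPairing a a - charPairing a a' -
        (charPairing a' a - charPairing a' a') := by
      simp only [charPairing_eq_sum, Pi.sub_apply, ← mul_sub, ← Finset.sum_sub_distrib]
      congr 1
      exact Finset.sum_congr rfl fun g _ => by ring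
    push_cast
    rw [this, ← hn, ← hm]
    linear_combination p1 - p2
  have e3 : charPairing (a - a') (a - a') =
      (((Nat.card G : ℝ)⁻¹ * ∑ g, ‖a g - a' g‖ ^ 2 : ℝ) : ℂ) := by
    rw [charPairing_eq_sum]
    push_cast
    congr 1
    refine Finset.sum_congr rfl fun g _ => ?_
    rw [Pi.sub_apply, Pi.sub_apply, ha.inv_apply, ha'.inv_apply, ← map_sub, Complex.mul_conj']
  rw [e3] at e2
  have e4 : (Nat.card G : ℝ)⁻¹ * ∑ g, ‖a g - a' g‖ ^ 2 = -((n + m : ℕ) : ℝ) := by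
    exact_mod_cast e2
  have e5 : (0 : ℝ) ≤ ∑ g, ‖a g - a' g‖ ^ 2 := Finset.sum_nonneg fun _ _ => by positivity
  have e6 : ∑ g, ‖a g - a' g‖ ^ 2 = 0 := by
    refine le_antisymm ?_ e5
    by_contra hlt
    have : (0 : ℝ) < (Nat.card G : ℝ)⁻¹ * ∑ g, ‖a g - a' g‖ ^ 2 :=
      mul_pos (inv_pos.2 (by exact_mod_cast Nat.card_pos)) (not_le.1 hlt)
    have : (0 : ℝ) ≤ ((n + m : ℕ) : ℝ) := Nat.cast_nonneg _
    linarith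
  have e7 : a = a' := by
    ext g
    have := (Finset.sum_eq_zero_iff_of_nonneg fun _ _ => by positivity).1 e6 g (Finset.mem_univ g)
    exact sub_eq_zero.1 (norm_eq_zero.1 (pow_eq_zero_iff two_ne_zero |>.1 this))
  refine ⟨e7, ?_⟩
  rw [e7] at hab
  exact sub_right_injective hab

omit [Finite G] [FiniteDimensional ℂ V] in
theorem isCompl_toSubmodule {ρ : Representation ℂ G V} {p q : Subrepresentation ρ}
    (h : IsCompl p q) : IsCompl p.toSubmodule q.toSubmodule := by
  constructor
  · rw [disjoint_iff, ← Subrepresentation.toSubmodule_inf, h.inf_eq_bot]; rfl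
  · rw [codisjoint_iff, ← Subrepresentation.toSubmodule_sup, h.sup_eq_top]; rfl

omit [Finite G] in
theorem character_eq_add_of_isCompl {ρ : Representation ℂ G V} {p q : Subrepresentation ρ}
    (h : IsCompl p q) :
    ρ.character = p.toRepresentation.character + q.toRepresentation.character := by
  have h' := isCompl_toSubmodule h
  ext g
  rw [Pi.add_apply, Representation.character, ← LinearMap.trace_conj' (ρ g)
    (Submodule.prodEquivOfIsCompl _ _ h').symm]
  refine Eq.trans ?_ (LinearMap.trace_prodMap' (p.toRepresentation g) (q.toRepresentation g))
  congr 1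
  refine LinearMap.ext fun x => ?_
  rw [LinearEquiv.conj_apply]
  simp only [LinearMap.comp_apply, LinearEquiv.coe_coe, LinearEquiv.symm_symm]
  rw [LinearEquiv.symm_apply_eq]
  simp only [Submodule.coe_prodEquivOfIsCompl', map_add]
  rfl

/-- A difference of characters is a difference of orthogonal characters. -/
theorem exists_orthogonal_parts {a b : G → ℂ} (ha : IsCharacterOn Z a) (hb : IsCharacterOn Z b) :
    ∃ a' b', IsCharacterOn Z a' ∧ IsCharacterOn Z b' ∧ charPairing a' b' = 0 ∧
      a' - b' = a - b := by
  obtain ⟨n, ρ, hρ, rfl⟩ := ha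
  obtain ⟨m, τ, hτ, rfl⟩ := hb
  induction n using Nat.strong_induction_on generalizing m with
  | _ n ih =>
  by_cases h0 : charPairing ρ.character τ.character = 0
  · exact ⟨_, _, ⟨n, ρ, hρ, rfl⟩, ⟨m, τ, hτ, rfl⟩, h0, rfl⟩
  have hZ : ∀ {k : ℕ} (σ : Representation ℂ G (Fin k → ℂ)), (∀ z ∈ Z, σ z = -1) →
      ∀ p : Subrepresentation σ, ∀ z ∈ Z, p.toRepresentation z = -1 := by
    intro k σ hσ p z hz
    ext v : 2
    change σ z v = _
    rw [hσ z hz]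
    simp
  rw [charPairing_comm, charPairing_character] at h0
  obtain ⟨f, hf⟩ : ∃ f : Representation.IntertwiningMap ρ τ, f ≠ 0 := by
    by_contra hc
    push Not at hc
    have : Subsingleton (Representation.IntertwiningMap ρ τ) := ⟨fun f g => by rw [hc f, hc g]⟩
    exact h0 (by simp [Module.finrank_zero_of_subsingleton])
  have : NeZero (Nat.card G : ℂ) := ⟨by simp [Nat.card_pos.ne']⟩
  -- Here ρ = ker f ⊕ c and τ = im f ⊕ d with c ≅ im f. The common part cancels in the difference,
  -- leaving the pair (ker f, d), whose first member has smaller dimension because f ≠ 0.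
  obtain ⟨c, hc⟩ := ComplementedLattice.exists_isCompl f.ker
  obtain ⟨d, hd⟩ := ComplementedLattice.exists_isCompl f.range
  have hcd : c.toRepresentation.character = f.range.toRepresentation.character := by
    have hkc : IsCompl f.ker.toSubmodule c.toSubmodule := isCompl_toSubmodule hc
    let F : c.toSubmodule →ₗ[ℂ] f.range.toSubmodule :=
      (f.toLinearMap.rangeRestrict).comp c.toSubmodule.subtype
    have hF : Function.Bijective F := by
      constructor
      · rw [← LinearMap.ker_eq_bot, eq_bot_iff]
        intro x hx
        have h1 : f.toLinearMap x = 0 := congrArg Subtype.val (LinearMap.mem_ker.1 hx)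
        have h2 : (x : Fin n → ℂ) ∈ f.ker.toSubmodule ⊓ c.toSubmodule := ⟨h1, x.2⟩
        rw [hkc.inf_eq_bot] at h2
        exact Subtype.ext h2
      · rintro ⟨_, v, rfl⟩
        have hv : v ∈ f.ker.toSubmodule ⊔ c.toSubmodule := hkc.sup_eq_top ▸ trivial
        obtain ⟨x, hx, y, hy, rfl⟩ := Submodule.mem_sup.1 hv
        refine ⟨⟨y, hy⟩, Subtype.ext ?_⟩
        have h1 : f.toLinearMap x = 0 := hx
        change f.toLinearMap y = f.toLinearMap (x + y)
        rw [map_add, h1, zero_add]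
    refine Representation.char_iso (Representation.Equiv.mk (LinearEquiv.ofBijective F hF) ?_)
    intro g
    refine LinearMap.ext fun x => Subtype.ext ?_
    exact congrArg (fun u : (Fin n → ℂ) →ₗ[ℂ] (Fin m → ℂ) => u x) (f.isIntertwining' g)
  have e1 := character_eq_add_of_isCompl hc
  have e2 := character_eq_add_of_isCompl hd
  have hlt : Module.finrank ℂ f.ker.toSubmodule < n := by
    have := Submodule.finrank_lt (s := f.ker.toSubmodule) fun ht => hf (by
      refine DFunLike.ext _ _ fun v => ?_
      have hv : v ∈ f.ker.toSubmodule := ht ▸ trivial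
      exact hv)
    simpa using this
  obtain ⟨k, ρ', hρ', hk⟩ := isCharacterOn_character (hZ ρ hρ f.ker)
  obtain ⟨k', τ', hτ', hk'⟩ := isCharacterOn_character (hZ τ hτ d)
  have hkn : k < n := by
    have := congrFun hk 1
    rw [Representation.char_one, Representation.char_one] at this
    have : Module.finrank ℂ (Fin k → ℂ) = Module.finrank ℂ f.ker.toSubmodule := by
      exact_mod_cast this
    simp only [Module.finrank_fin_fun] at this
    omega
  obtain ⟨a', b', h1, h2, h3, h4⟩ := ih k hkn ρ' hρ' k' τ' hτ'
  refine ⟨a', b', h1, h2, h3, ?_⟩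
  rw [h4, hk, hk', e1, e2, hcd]
  abel

end CharacterTheory

/-! ### Generators of the Clifford algebra and of its even part -/

section Generators

theorem map_ofFn_prod {k A B : Type*} [Field k] [Ring A] [Algebra k A] [Ring B] [Algebra k B]
    (F : A →ₐ[k] B) {r : ℕ} {y : Fin r → A} {z : Fin r → B} {s : Fin r → k}
    (h : ∀ i, F (y i) = s i • z i) :
    F (List.ofFn y).prod = (∏ i, s i) • (List.ofFn z).prod := by
  induction r with
  | zero => simp
  | succ r ih =>
    rw [List.ofFn_succ, List.prod_cons, map_mul, h, ih fun i => h i.succ, List.ofFn_succ,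
      List.prod_cons, Fin.prod_univ_succ, smul_mul_smul_comm]

theorem IsCliffordSystem.of_coe {A : Type*} [Ring A] [Algebra ℝ A] {S : Subalgebra ℝ A} {m : ℕ}
    {f : Fin m → S} (hsq : ∀ i, (f i : A) * f i = -1)
    (hanti : ∀ i j, i ≠ j → (f i : A) * f j = -(f j * f i))
    (hgen : Algebra.adjoin ℝ (Set.range fun i => (f i : A)) = S) : IsCliffordSystem ℝ f where
  sq i := Subtype.ext (hsq i)
  anti i j h := Subtype.ext (hanti i j h)
  gen := by
    apply Subalgebra.map_injective (f := S.val) Subtype.val_injective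
    rw [AlgHom.map_adjoin, ← Set.range_comp, Algebra.map_top, Subalgebra.range_val]
    exact hgen

theorem coe_ofFn_prod {A : Type*} [Ring A] [Algebra ℝ A] {S : Subalgebra ℝ A} {m : ℕ}
    (f : Fin m → S) : ((List.ofFn f).prod : A) = (List.ofFn fun i => (f i : A)).prod := by
  simpa using map_ofFn_prod S.val (y := f) (z := fun i => (f i : A)) (s := fun _ => 1) (by simp)

variable {E : Type*} [NormedAddCommGroup E] [InnerProductSpace ℝ E]

theorem clι_mul_self (x : E) : clι E x * clι E x = -algebraMap ℝ (Cl E) (inner ℝ x x) := by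
  rw [CliffordAlgebra.ι_sq_scalar, ← map_neg]
  congr 1

theorem isCliffordSystem_clι {l : ℕ} (e : OrthonormalBasis (Fin l) ℝ E) :
    IsCliffordSystem ℝ fun i => clι E (e i) where
  sq i := by rw [clι_mul_self, e.inner_eq_one, map_one]
  anti i j h := by
    rw [eq_neg_iff_add_eq_zero, clι_mul_add_swap, e.inner_eq_zero h]
    simp
  gen := by
    rw [eq_top_iff, ← CliffordAlgebra.adjoin_range_ι, Algebra.adjoin_le_iff]
    rintro _ ⟨x, rfl⟩
    rw [SetLike.mem_coe, ← e.sum_repr x, map_sum]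
    refine sum_mem fun i _ => ?_
    rw [map_smul]
    exact Subalgebra.smul_mem _ (Algebra.subset_adjoin (Set.mem_range_self i)) _

/-- Even elements are generated by products of two vectors, and (e₀ eᵢ)(e₀ eⱼ) = eᵢ eⱼ for nonzero
indices. -/
theorem adjoin_clι_mul_clι {m : ℕ} (e : OrthonormalBasis (Fin (m + 1)) ℝ E) :
    Algebra.adjoin ℝ (Set.range fun j : Fin m => clι E (e 0) * clι E (e j.succ)) =
      CliffordAlgebra.even (cliffordForm E) := by
  have hc := isCliffordSystem_clι e
  set B := Algebra.adjoin ℝ (Set.range fun j : Fin m => clι E (e 0) * clι E (e j.succ))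
  apply le_antisymm
  · rw [Algebra.adjoin_le_iff]
    rintro _ ⟨j, rfl⟩
    rw [SetLike.mem_coe, ← Subalgebra.mem_toSubmodule, CliffordAlgebra.even_toSubmodule]
    exact CliffordAlgebra.ι_mul_ι_mem_evenOdd_zero _ _ _
  · have h0 : ∀ j : Fin m, clι E (e 0) * clι E (e j.succ) ∈ B := fun j =>
      Algebra.subset_adjoin ⟨j, rfl⟩
    have h1 : ∀ i j, clι E (e i) * clι E (e j) ∈ B := by
      intro i j
      refine Fin.cases ?_ (fun i => ?_) i <;> refine Fin.cases ?_ (fun j => ?_) j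
      · rw [hc.sq]; exact neg_mem (one_mem _)
      · exact h0 j
      · rw [hc.anti _ _ (Fin.succ_ne_zero i)]; exact neg_mem (h0 i)
      · have : clι E (e i.succ) * clι E (e j.succ) =
            (clι E (e 0) * clι E (e i.succ)) * (clι E (e 0) * clι E (e j.succ)) := by
          rw [hc.anti 0 i.succ (Fin.succ_ne_zero i).symm, neg_mul, mul_assoc,
            ← mul_assoc (clι E (e 0)) (clι E (e 0)), hc.sq]
          simp
        rw [this]
        exact mul_mem (h0 i) (h0 j)
    have h2 : ∀ x y, clι E x * clι E y ∈ B := by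
      intro x y
      rw [← e.sum_repr x, ← e.sum_repr y]
      simp only [map_sum, map_smul, Finset.sum_mul, Finset.mul_sum, smul_mul_smul_comm]
      exact sum_mem fun i _ => sum_mem fun j _ => Subalgebra.smul_mem _ (h1 _ _) _
    intro x hx
    rw [← Subalgebra.mem_toSubmodule, CliffordAlgebra.even_toSubmodule] at hx
    induction x, hx using CliffordAlgebra.even_induction with
    | algebraMap r => exact Subalgebra.algebraMap_mem _ _
    | add x y _ _ hx hy => exact add_mem hx hy
    | ι_mul_ι_mul a b x _ hx => exact mul_mem (h2 a b) hx

variable (E) in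
/-- The power `ε ^ (l + 1)` of the grading automorphism, `l = dim E`. -/
def spinTwist : Cl E →ₐ[ℝ] Cl E :=
  open Classical in
  if Odd (Module.finrank ℝ E) then AlgHom.id ℝ (Cl E) else CliffordAlgebra.involute

theorem spinTwist_of_odd (h : Odd (Module.finrank ℝ E)) : spinTwist E = AlgHom.id ℝ (Cl E) := by
  simp [spinTwist, h]

theorem spinTwist_of_even (h : Even (Module.finrank ℝ E)) :
    spinTwist E = CliffordAlgebra.involute := by
  simp [spinTwist, h]

theorem spinAlgebra_of_odd (h : Odd (Module.finrank ℝ E)) : spinAlgebra E = ⊤ := by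
  simp [spinAlgebra, h]

theorem spinAlgebra_of_even (h : Even (Module.finrank ℝ E)) :
    spinAlgebra E = CliffordAlgebra.even (cliffordForm E) := by
  simp [spinAlgebra, h]

theorem spinTwist_of_mem {x : Cl E} (hx : x ∈ spinAlgebra E) : spinTwist E x = x := by
  rcases Nat.even_or_odd (Module.finrank ℝ E) with h | h
  · rw [spinAlgebra_of_even h, ← Subalgebra.mem_toSubmodule,
      CliffordAlgebra.even_toSubmodule] at hx
    rw [spinTwist_of_even h, CliffordAlgebra.involute_eq_of_mem_even hx]
  · simp [spinTwist_of_odd h]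

variable [FiniteDimensional ℝ E]

variable (E) in
/-- The algebra `spinAlgebra E` is generated by an odd number of anticommuting square roots of
`-1`; their product `φ` is a volume element. -/
theorem exists_spin_system (hl : 0 < Module.finrank ℝ E) :
    ∃ (m : ℕ) (f : Fin m → spinAlgebra E), Odd m ∧ IsCliffordSystem ℝ f ∧
      (Odd (Module.finrank ℝ E) → m = Module.finrank ℝ E) ∧
      (Even (Module.finrank ℝ E) → m + 1 = Module.finrank ℝ E) ∧
      (∀ x : Cl E, ((List.ofFn f).prod : Cl E) * x = spinTwist E x * ((List.ofFn f).prod : Cl E)) ∧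
      CliffordAlgebra.involute ((List.ofFn f).prod : Cl E) =
        (-1 : ℝ) ^ Module.finrank ℝ E • ((List.ofFn f).prod : Cl E) := by
  rcases Nat.even_or_odd (Module.finrank ℝ E) with h | h
  · obtain ⟨m, hm⟩ : ∃ m, Module.finrank ℝ E = m + 1 := ⟨_, (Nat.succ_pred_eq_of_pos hl).symm⟩
    have hmo : Odd m := by
      rw [hm, Nat.even_add_one, Nat.not_even_iff_odd] at h; exact h
    let e : OrthonormalBasis (Fin (m + 1)) ℝ E := (stdOrthonormalBasis ℝ E).reindex (finCongr hm)
    have hc := isCliffordSystem_clι e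
    have hgen := adjoin_clι_mul_clι e
    rw [← spinAlgebra_of_even h] at hgen
    -- In even dimension the l - 1 products e₀ eⱼ serve as generators; they multiply like the eⱼ
    -- themselves.
    let f : Fin m → spinAlgebra E := fun j => ⟨clι E (e 0) * clι E (e j.succ), by
      rw [← hgen]; exact Algebra.subset_adjoin ⟨j, rfl⟩⟩
    have h0 : ∀ j : Fin m, clι E (e j.succ) * clι E (e 0) = -(clι E (e 0) * clι E (e j.succ)) :=
      fun j => hc.anti _ _ (Fin.succ_ne_zero j)
    have hff : ∀ i j : Fin m, clι E (e 0) * clι E (e i.succ) * (clι E (e 0) * clι E (e j.succ)) =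
        clι E (e i.succ) * clι E (e j.succ) := by
      intro i j
      rw [hc.anti 0 i.succ (Fin.succ_ne_zero i).symm, neg_mul, mul_assoc,
        ← mul_assoc (clι E (e 0)) (clι E (e 0)), hc.sq]
      simp
    refine ⟨m, f, hmo, IsCliffordSystem.of_coe ?_ ?_ hgen, fun h' => ?_, fun _ => hm.symm, ?_, ?_⟩
    · intro i
      exact (hff i i).trans (hc.sq _)
    · intro i j hij
      refine (hff i j).trans ((hc.anti _ _ fun h => hij (Fin.succ_injective _ h)).trans ?_)
      exact congrArg Neg.neg (hff j i).symm
    · exact absurd h (Nat.not_even_iff_odd.2 h')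
    · rw [spinTwist_of_even h, coe_ofFn_prod]
      set φ := (List.ofFn fun j => (f j : Cl E)).prod with hφ
      -- e₀ anticommutes with all m generators e₀ eⱼ, and m is odd; any other eᵢ anticommutes only
      -- with e₀ eᵢ.
      have key : ∀ i, φ * clι E (e i) = -clι E (e i) * φ := by
        intro i
        suffices clι E (e i) * φ = (-1 : ℝ) • (φ * clι E (e i)) by
          rw [neg_mul, this, neg_smul, neg_neg, one_smul]
        refine Fin.cases ?_ (fun i => ?_) i
        · rw [hφ, mul_ofFn_prod (k := ℝ) (clι E (e 0)) _ (fun _ => -1)]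
          · simp [hmo.neg_one_pow]
          · intro j
            simp only [f, neg_smul, one_smul]
            rw [mul_assoc _ (clι E (e j.succ)), h0, mul_neg, neg_neg]
        · rw [hφ, mul_ofFn_prod (k := ℝ) (clι E (e i.succ)) _ (fun j => if j = i then -1 else 1)]
          · simp
          · intro j
            simp only [f]
            rw [← mul_assoc, h0, neg_mul, mul_assoc, mul_assoc]
            by_cases hj : j = i
            · subst hj; simp
            · rw [hc.anti i.succ j.succ fun h => hj (Fin.succ_injective _ h).symm]
              simp [hj]
      intro x
      have hx : x ∈ Algebra.adjoin ℝ (Set.range fun i => clι E (e i)) := hc.gen ▸ trivial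
      induction hx using Algebra.adjoin_induction with
      | mem x hx =>
        obtain ⟨i, rfl⟩ := hx
        rw [CliffordAlgebra.involute_ι]
        exact key i
      | algebraMap r => rw [AlgHom.commutes]; exact (Algebra.commutes r _).symm
      | add a b _ _ ha hb => rw [mul_add, map_add, add_mul, ha, hb]
      | mul a b _ _ ha hb => rw [← mul_assoc, ha, mul_assoc, hb, map_mul, mul_assoc]
    · rw [coe_ofFn_prod, map_ofFn_prod CliffordAlgebra.involute (s := fun _ => 1)
        (z := fun j => (f j : Cl E))]
      · simp [h.neg_one_pow]
      · intro i; simp [f]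
  · have hc := isCliffordSystem_clι (stdOrthonormalBasis ℝ E)
    let f : Fin (Module.finrank ℝ E) → spinAlgebra E := fun j =>
      ⟨clι E (stdOrthonormalBasis ℝ E j), by rw [spinAlgebra_of_odd h]; trivial⟩
    refine ⟨_, f, h, IsCliffordSystem.of_coe hc.sq hc.anti
      (hc.gen.trans (spinAlgebra_of_odd h).symm), fun _ => rfl,
      fun h' => absurd h' (Nat.not_even_iff_odd.2 h), ?_, ?_⟩
    · intro x
      rw [spinTwist_of_odd h, coe_ofFn_prod]
      exact (hc.commute_prod h x).symm
    · rw [coe_ofFn_prod, map_ofFn_prod CliffordAlgebra.involute (s := fun _ => -1)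
        (z := fun j => (f j : Cl E))]
      · simp
      · intro i; simp [f]

end Generators

/-! ### The virtual spin character -/

section SpinForm

variable {E : Type*} [NormedAddCommGroup E] [InnerProductSpace ℝ E] [FiniteDimensional ℝ E]

/-- The operator `x ↦ a θ(x) b` on the Clifford algebra, where `θ` is `spinTwist`. -/
def spinOp (a b : Cl E) : Module.End ℝ (Cl E) :=
  LinearMap.mulLeft ℝ a ∘ₗ LinearMap.mulRight ℝ b ∘ₗ (spinTwist E).toLinearMap

omit [FiniteDimensional ℝ E] in
theorem spinOp_apply (a b x : Cl E) : spinOp a b x = a * (spinTwist E x * b) := rfl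

/-- The trace of the operator `x ↦ a θ(x) b`. -/
def spinForm (a b : Cl E) : ℝ := LinearMap.trace ℝ (Cl E) (spinOp a b)

omit [FiniteDimensional ℝ E] in
-- As θ fixes u, left multiplication by u splits off the operator on either side, and the trace is
-- insensitive to the order.
theorem spinForm_mul_left {u : Cl E} (hu : spinTwist E u = u) (v b : Cl E) :
    spinForm (u * v) b = spinForm (v * u) b := by
  have h1 : spinOp (u * v) b = LinearMap.mulLeft ℝ u * spinOp v b := by
    ext x; simp [spinOp_apply, mul_assoc]
  have h2 : spinOp (v * u) b = spinOp v b * LinearMap.mulLeft ℝ u := by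
    ext x; simp [spinOp_apply, mul_assoc, hu]
  rw [spinForm, spinForm, h1, h2, LinearMap.trace_mul_comm]

omit [FiniteDimensional ℝ E] in
theorem spinForm_mul_right {u : Cl E} (hu : spinTwist E u = u) (a v : Cl E) :
    spinForm a (u * v) = spinForm a (v * u) := by
  have h1 : spinOp a (v * u) = LinearMap.mulRight ℝ u * spinOp a v := by
    ext x; simp [spinOp_apply, mul_assoc]
  have h2 : spinOp a (u * v) = spinOp a v * LinearMap.mulRight ℝ u := by
    ext x; simp [spinOp_apply, mul_assoc, hu]
  rw [spinForm, spinForm, h1, h2, LinearMap.trace_mul_comm]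

theorem trace_eq_zero_of_conj_neg {V : Type*} [AddCommGroup V] [Module ℝ V]
    {T D D' : Module.End ℝ V} (h : D' * D = 1) (hT : D * T * D' = -T) :
    LinearMap.trace ℝ V T = 0 := by
  have h1 : LinearMap.trace ℝ V (D * T * D') = LinearMap.trace ℝ V T := by
    rw [LinearMap.trace_mul_comm, ← mul_assoc, h, one_mul]
  rw [hT, map_neg] at h1
  linarith

/-- Elements of the parity of `dim E`. -/
def HasSpinParity (a : Cl E) : Prop :=
  CliffordAlgebra.involute a = (-1 : ℝ) ^ Module.finrank ℝ E • a

theorem exists_unit_vector (hl : 0 < Module.finrank ℝ E) : ∃ c : E, clι E c * clι E c = -1 := by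
  have := Module.finrank_pos_iff.1 hl
  obtain ⟨x, hx⟩ := exists_norm_eq E zero_le_one
  exact ⟨x, by rw [clι_mul_self, real_inner_self_eq_norm_sq, hx]; simp⟩

/-- The operator is conjugate to its negative: for l even through left multiplication by a unit
vector, which θ negates, and for l odd through ε, since b is odd. -/
theorem spinForm_one_left (hl : 0 < Module.finrank ℝ E) {b : Cl E} (hb : HasSpinParity b) :
    spinForm 1 b = 0 := by
  rcases Nat.even_or_odd (Module.finrank ℝ E) with h | h
  · obtain ⟨c, hc⟩ := exists_unit_vector hl
    refine trace_eq_zero_of_conj_neg (D := LinearMap.mulLeft ℝ (clι E c))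
      (D' := LinearMap.mulLeft ℝ (-clι E c)) ?_ ?_
    · ext x
      simp [← mul_assoc, hc]
    · ext x
      simp [spinOp_apply, spinTwist_of_even h, ← mul_assoc, hc]
  · refine trace_eq_zero_of_conj_neg (D := CliffordAlgebra.involute.toLinearMap)
      (D' := CliffordAlgebra.involute.toLinearMap) ?_ ?_
    · ext x
      simp
    · rw [HasSpinParity, h.neg_one_pow] at hb
      ext x
      simp [spinOp_apply, spinTwist_of_odd h, hb]

theorem spinForm_one_right (hl : 0 < Module.finrank ℝ E) {a : Cl E} (ha : HasSpinParity a) :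
    spinForm a 1 = 0 := by
  rcases Nat.even_or_odd (Module.finrank ℝ E) with h | h
  · obtain ⟨c, hc⟩ := exists_unit_vector hl
    refine trace_eq_zero_of_conj_neg (D := LinearMap.mulRight ℝ (clι E c))
      (D' := LinearMap.mulRight ℝ (-clι E c)) ?_ ?_
    · ext x
      simp [mul_assoc, hc]
    · ext x
      simp [spinOp_apply, spinTwist_of_even h, mul_assoc, hc]
  · refine trace_eq_zero_of_conj_neg (D := CliffordAlgebra.involute.toLinearMap)
      (D' := CliffordAlgebra.involute.toLinearMap) ?_ ?_
    · ext x
      simp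
    · rw [HasSpinParity, h.neg_one_pow] at ha
      ext x
      simp [spinOp_apply, spinTwist_of_odd h, ha]

/-- Since θ(x) φ = φ x, the operator is the scalar φ² = η on a space of dimension 2^l. -/
theorem spinForm_self {φ : Cl E} (hφ : ∀ x : Cl E, φ * x = spinTwist E x * φ) {η : ℝ}
    (hη : φ * φ = algebraMap ℝ (Cl E) η) : spinForm φ φ = η * 2 ^ Module.finrank ℝ E := by
  have : spinOp φ φ = η • LinearMap.id := by
    ext x
    rw [spinOp_apply, ← hφ, ← mul_assoc, hη, ← Algebra.smul_def]
    rfl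
  rw [spinForm, this, map_smul, LinearMap.trace_id, finrank_cliffordAlgebra]
  simp

/-- The functional `a ↦ spinForm a b`. -/
def spinFormLeft (b : Cl E) : spinAlgebra E →ₗ[ℝ] ℂ where
  toFun a := spinForm (a : Cl E) b
  map_add' x y := by
    have : spinOp (x + y : Cl E) b = spinOp (x : Cl E) b + spinOp (y : Cl E) b := by
      ext z; simp [spinOp_apply, add_mul]
    simp [spinForm, this]
  map_smul' c x := by
    have : spinOp (c • x : Cl E) b = c • spinOp (x : Cl E) b := by
      ext z; simp [spinOp_apply]
    simp [spinForm, this]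

omit [FiniteDimensional ℝ E] in
theorem spinFormLeft_apply (a : spinAlgebra E) (b : Cl E) :
    spinFormLeft b a = spinForm (a : Cl E) b := rfl

/-- The functional `b ↦ spinForm a b`. -/
def spinFormRight (a : Cl E) : spinAlgebra E →ₗ[ℝ] ℂ where
  toFun b := spinForm a (b : Cl E)
  map_add' x y := by
    have : spinOp a (x + y : Cl E) = spinOp a (x : Cl E) + spinOp a (y : Cl E) := by
      ext z; simp [spinOp_apply, mul_add]
    simp [spinForm, this]
  map_smul' c x := by
    have : spinOp a (c • x : Cl E) = c • spinOp a (x : Cl E) := by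
      ext z; simp [spinOp_apply]
    simp [spinForm, this]

omit [FiniteDimensional ℝ E] in
theorem spinFormRight_apply (a : Cl E) (b : spinAlgebra E) :
    spinFormRight a b = spinForm a (b : Cl E) := rfl

variable {S₁ S₂ : Type*} [AddCommGroup S₁] [Module ℂ S₁] [FiniteDimensional ℂ S₁]
  [AddCommGroup S₂] [Module ℂ S₂] [FiniteDimensional ℂ S₂]
  {ρ₁ : spinAlgebra E →ₐ[ℝ] Module.End ℂ S₁} {ρ₂ : spinAlgebra E →ₐ[ℝ] Module.End ℂ S₂}

/-- `δ(a) δ(b)` is `1` or `2` times the trace of `x ↦ a θ(x) b`, for `dim E` even or odd. -/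
theorem spin_mul_spin (hl : 0 < Module.finrank ℝ E) (hρ₁ : IsSimpleModuleHom ρ₁)
    (hρ₂ : IsSimpleModuleHom ρ₂) (hρ : ¬ AreIsomorphic ρ₁ ρ₂) (a b : spinAlgebra E)
    (hb : HasSpinParity (b : Cl E)) :
    (moduleTrace ρ₁ - moduleTrace ρ₂) a * (moduleTrace ρ₁ - moduleTrace ρ₂) b =
      (open Classical in if Odd (Module.finrank ℝ E) then 2 else 1) * (spinForm (a : Cl E) b : ℂ) := by
  obtain ⟨m, f, hm, hf, hm1, hm2, hφ, hpar⟩ := exists_spin_system E hl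
  obtain ⟨η, hη, hφφ⟩ := ofFn_prod_mul_self (k := ℝ) f hf.sq hf.anti
  obtain ⟨h1, h2⟩ := hf.moduleTrace_sub hm hρ₁ hρ₂ hρ hη hφφ
  set T := moduleTrace ρ₁ - moduleTrace ρ₂ with hT
  have hTt : ∀ u v, T (u * v) = T (v * u) := fun u v => by
    simp [hT, moduleTrace_mul_comm _ u v]
  set φ := (List.ofFn f).prod with hφd
  have hs : spinForm (φ : Cl E) φ = η * 2 ^ Module.finrank ℝ E :=
    spinForm_self hφ (congrArg Subtype.val hφφ)
  -- Both sides are traces in the first variable that vanish at 1 and agree at φ; `e2` does the same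
  -- in the second variable.
  have e1 : (T φ) • spinFormLeft (b : Cl E) = (spinForm (φ : Cl E) b : ℂ) • T := by
    refine hf.tracial_ext (fun u v => ?_) (fun u v => ?_) ?_ ?_
    · have := spinForm_mul_left (spinTwist_of_mem u.2) (v : Cl E) b
      simp [spinFormLeft_apply, this]
    · simp [hTt u v]
    · simp [spinFormLeft_apply, h1, spinForm_one_left hl hb]
    · simp [spinFormLeft_apply, ← hφd, mul_comm]
  have e2 : (T φ) • spinFormRight (φ : Cl E) = (spinForm (φ : Cl E) φ : ℂ) • T := by
    refine hf.tracial_ext (fun u v => ?_) (fun u v => ?_) ?_ ?_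
    · have := spinForm_mul_right (spinTwist_of_mem u.2) (φ : Cl E) v
      simp [spinFormRight_apply, this]
    · simp [hTt u v]
    · simp [spinFormRight_apply, h1, spinForm_one_right hl hpar]
    · simp [spinFormRight_apply, ← hφd, mul_comm]
  have e3 : T φ * spinForm (a : Cl E) b = spinForm (φ : Cl E) b * T a :=
    congrArg (fun u : spinAlgebra E →ₗ[ℝ] ℂ => u a) e1
  have e4 : T φ * spinForm (φ : Cl E) b = spinForm (φ : Cl E) φ * T b :=
    congrArg (fun u : spinAlgebra E →ₗ[ℝ] ℂ => u b) e2
  have hη' : (η : ℂ) * η = 1 := by exact_mod_cast hη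
  -- Eliminating `spinForm φ b` gives T(φ)² spinForm(a, b) = η 2^l T(a) T(b), where T(φ)² = 2^(m+1)
  -- η.
  have e5 : (2 : ℂ) ^ (m + 1) * spinForm (a : Cl E) b =
      2 ^ Module.finrank ℝ E * (T a * T b) := by
    rw [hs] at e4
    push_cast at e4
    linear_combination η * (T φ * e3 + T a * e4 - spinForm (a : Cl E) b * h2) +
      (T a * T b * 2 ^ Module.finrank ℝ E - spinForm (a : Cl E) b * 2 ^ (m + 1)) * hη'
  have h20 : (2 : ℂ) ^ Module.finrank ℝ E ≠ 0 := pow_ne_zero _ two_ne_zero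
  refine mul_left_cancel₀ h20 ?_
  rw [← e5]
  split_ifs with h
  · rw [hm1 h, pow_succ, mul_assoc]
  · rw [hm2 (Nat.not_odd_iff_even.1 h), one_mul]

/-- An automorphism that negates the volume element negates the virtual spin character. -/
theorem spin_comp_neg (hl : 0 < Module.finrank ℝ E) (hρ₁ : IsSimpleModuleHom ρ₁)
    (hρ₂ : IsSimpleModuleHom ρ₂) (hρ : ¬ AreIsomorphic ρ₁ ρ₂)
    (F : Cl E →ₐ[ℝ] Cl E) (hFS : ∀ x ∈ spinAlgebra E, F x ∈ spinAlgebra E)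
    (hF : ∀ φ : Cl E, (∀ x : Cl E, φ * x = spinTwist E x * φ) → HasSpinParity φ → F φ = -φ)
    (a b : spinAlgebra E) (hab : (b : Cl E) = F a) :
    (moduleTrace ρ₁ - moduleTrace ρ₂) b = -(moduleTrace ρ₁ - moduleTrace ρ₂) a := by
  obtain ⟨m, f, hm, hf, -, -, hφ, hpar⟩ := exists_spin_system E hl
  obtain ⟨η, hη, hφφ⟩ := ofFn_prod_mul_self (k := ℝ) f hf.sq hf.anti
  obtain ⟨h1, -⟩ := hf.moduleTrace_sub hm hρ₁ hρ₂ hρ hη hφφ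
  set T := moduleTrace ρ₁ - moduleTrace ρ₂ with hT
  have hTt : ∀ u v, T (u * v) = T (v * u) := fun u v => by
    simp [hT, moduleTrace_mul_comm _ u v]
  let G : spinAlgebra E →ₐ[ℝ] spinAlgebra E :=
    (F.comp (spinAlgebra E).val).codRestrict _ fun x => hFS x x.2
  have hG : G (List.ofFn f).prod = -(List.ofFn f).prod := Subtype.ext (hF _ hφ hpar)
  have key : T ∘ₗ G.toLinearMap = -T := by
    refine hf.tracial_ext (fun u v => ?_) (fun u v => ?_) ?_ ?_
    · simp [hTt (G u)]
    · simp [hTt u v]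
    · simp [h1]
    · simp [hG]
  obtain rfl : b = G a := Subtype.ext hab
  exact congrArg (fun u : spinAlgebra E →ₗ[ℝ] ℂ => u a) key

end SpinForm

/-! ### The kernel of the pin cover -/

section PinKernel

variable {E : Type*} [NormedAddCommGroup E] [InnerProductSpace ℝ E] [FiniteDimensional ℝ E]

/-- An element with `ε(a) ξ = ξ a` for all `ξ` in `E` is a scalar. -/
theorem eq_algebraMap_of_twisted_commute {a : Cl E}
    (ha : ∀ ξ, CliffordAlgebra.involute a * clι E ξ = clι E ξ * a) :
    ∃ r : ℝ, a = algebraMap ℝ (Cl E) r := by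
  have hc := isCliffordSystem_clι (stdOrthonormalBasis ℝ E)
  set c := fun i => clι E (stdOrthonormalBasis ℝ E i) with hcd
  let b := basisOfTopLeSpanOfCardEqFinrank (word c) hc.span_word.ge
    (by simp [finrank_cliffordAlgebra])
  have hb : ∀ I, b I = word c I := fun I => by simp [b]
  -- x ↦ -cᵢ ε(x) cᵢ is diagonal on words, with eigenvalue -1 exactly on those containing cᵢ. It
  -- fixes a for every i, so only the empty word occurs in a.
  let D : Fin (Module.finrank ℝ E) → Module.End ℝ (Cl E) := fun i =>
    -(LinearMap.mulLeft ℝ (c i) ∘ₗ LinearMap.mulRight ℝ (c i) ∘ₗ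
      CliffordAlgebra.involute.toLinearMap)
  have hD : ∀ i x, D i x = -(c i * (CliffordAlgebra.involute x * c i)) := fun i x => rfl
  have hDb : ∀ i I, I i = true → D i (b I) = -b I := by
    intro i I hI
    have h1 : CliffordAlgebra.involute (word c I) =
        (-1 : ℝ) ^ (Finset.univ.filter fun j => I j = true).card • word c I := by
      rw [word, map_ofFn_prod CliffordAlgebra.involute (z := fun i => if I i then c i else 1)
        (s := fun i => if I i = true then (-1 : ℝ) else 1)]
      · simp [Finset.prod_ite]
      · intro j
        by_cases h : I j = true <;> simp [h, hcd]
    have h2 : (Finset.univ.filter fun j => I j = true ∧ j ≠ i) =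
        (Finset.univ.filter fun j => I j = true).erase i := by
      ext j; simp [and_comm]
    have h3 := Finset.card_erase_add_one (s := Finset.univ.filter fun j => I j = true) (a := i)
      (by simp [hI])
    rw [hb, hD, h1, smul_mul_assoc, mul_smul_comm, ← mul_assoc, hc.mul_word, h2, ← h3,
      smul_mul_assoc, mul_assoc, hc.sq, smul_smul, ← pow_add]
    rw [show ∀ n : ℕ, n + 1 + n = 2 * n + 1 by intro n; ring, pow_succ, pow_mul]
    simp
  have hDn : ∀ i I, I i = false → D i (b I) = b I := by
    intro i I hI
    have h1 : CliffordAlgebra.involute (word c I) =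
        (-1 : ℝ) ^ (Finset.univ.filter fun j => I j = true).card • word c I := by
      rw [word, map_ofFn_prod CliffordAlgebra.involute (z := fun i => if I i then c i else 1)
        (s := fun i => if I i = true then (-1 : ℝ) else 1)]
      · simp [Finset.prod_ite]
      · intro j
        by_cases h : I j = true <;> simp [h, hcd]
    have h2 : (Finset.univ.filter fun j => I j = true ∧ j ≠ i) =
        (Finset.univ.filter fun j => I j = true) := by
      ext j
      simp only [Finset.mem_filter, Finset.mem_univ, true_and, and_iff_left_iff_imp]
      rintro hj rfl
      simp [hI] at hj
    rw [hb, hD, h1, smul_mul_assoc, mul_smul_comm, ← mul_assoc, hc.mul_word, h2,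
      smul_mul_assoc, mul_assoc, hc.sq, smul_smul, ← pow_add, ← two_mul, pow_mul]
    simp
  have hDa : ∀ i, D i a = a := by
    intro i
    rw [hD, ha, ← mul_assoc, hc.sq]
    simp
  have hrepr : ∀ i x I, b.repr (D i x) I = (if I i = true then -1 else 1) * b.repr x I := by
    intro i x I
    have : (Finsupp.lapply I ∘ₗ b.repr.toLinearMap) ∘ₗ D i =
        (if I i = true then (-1 : ℝ) else 1) • (Finsupp.lapply I ∘ₗ b.repr.toLinearMap) := by
      refine b.ext fun J => ?_
      by_cases hJ : J i = true
      · rw [LinearMap.comp_apply, hDb i J hJ]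
        by_cases hIJ : J = I
        · subst hIJ; simp [hJ]
        · split_ifs <;> simp [hIJ]
      · rw [LinearMap.comp_apply, hDn i J (by simpa using hJ)]
        by_cases hIJ : J = I
        · subst hIJ; simp [hJ]
        · split_ifs <;> simp [hIJ]
    exact congrArg (fun u : Cl E →ₗ[ℝ] ℝ => u x) this
  have hz : ∀ I, I ≠ (fun _ => false) → b.repr a I = 0 := by
    intro I hI
    obtain ⟨i, hi⟩ : ∃ i, I i = true := by
      by_contra hc
      exact hI (funext fun i => by simpa using not_exists.1 hc i)
    have := hrepr i a I
    rw [hDa, if_pos hi] at this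
    linarith
  refine ⟨b.repr a fun _ => false, ?_⟩
  conv_lhs => rw [← b.sum_repr a]
  rw [Finset.sum_eq_single (fun _ => false)]
  · rw [hb, word_false, Algebra.algebraMap_eq_smul_one]
  · intro I _ hI
    rw [hz I hI, zero_smul]
  · simp

theorem eq_one_or_neg_one_of_pinHom_eq_one {a : Pin E} (ha : pinHom E a = 1) :
    ((a : (Cl E)ˣ) : Cl E) = 1 ∨ ((a : (Cl E)ˣ) : Cl E) = -1 := by
  obtain ⟨r, hr⟩ := eq_algebraMap_of_twisted_commute (a := ((a : (Cl E)ˣ) : Cl E)) fun ξ => by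
    have h := clι_pinHom E a ξ
    rw [ha] at h
    change clι E ξ = _ at h
    conv_rhs => rw [h]
    simp
  have h1 := a.2.2
  -- The anti-automorphism ᵗ fixes scalars and inverts pin elements, so the scalar has square 1.
  have h2 : ((a : (Cl E)ˣ) : Cl E) * ((a : (Cl E)ˣ) : Cl E) = 1 := by
    have h0 : star ((a : (Cl E)ˣ) : Cl E) = ((a : (Cl E)ˣ) : Cl E) := by
      rw [hr, CliffordAlgebra.star_algebraMap]
    nth_rewrite 2 [← h0]
    rw [h1, Units.mul_inv]
  rw [hr, ← map_mul, ← map_one (algebraMap ℝ (Cl E))] at h2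
  have h3 : r * r = 1 := (algebraMap ℝ (Cl E)).injective h2
  rcases mul_self_eq_one_iff.1 h3 with h | h
  · left; rw [hr, h, map_one]
  · right; rw [hr, h, map_neg, map_one]

/-- A unit vector, as an element of the pin group. -/
def pinOfUnit (u : E) (hu : ‖u‖ = 1) : Pin E :=
  have huu : clι E u * clι E u = -1 := by
    rw [clι_mul_self, real_inner_self_eq_norm_sq, hu]; simp
  ⟨⟨clι E u, -clι E u, by rw [mul_neg, huu, neg_neg], by rw [neg_mul, huu, neg_neg]⟩, fun ξ =>
    ⟨ξ - (2 * inner ℝ u ξ) • u, by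
      have h := clι_mul_add_swap E u ξ
      rw [CliffordAlgebra.involute_ι]
      change clι E (ξ - (2 * inner ℝ u ξ) • u) = -clι E u * clι E ξ * -clι E u
      rw [neg_mul, neg_mul_neg, eq_sub_of_add_eq h, sub_mul, mul_assoc, huu,
        ← Algebra.smul_def, map_sub, map_smul, mul_neg, mul_one]
      module⟩,
    CliffordAlgebra.star_ι _⟩

theorem coe_pinOfUnit (u : E) (hu : ‖u‖ = 1) : ((pinOfUnit u hu : (Cl E)ˣ) : Cl E) = clι E u := rfl

theorem pinHom_pinOfUnit (u : E) (hu : ‖u‖ = 1) (ξ : E) :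
    pinHom E (pinOfUnit u hu) ξ = ξ - (2 * inner ℝ u ξ) • u := by
  apply clι_injective E
  have huu : clι E u * clι E u = -1 := by
    rw [clι_mul_self, real_inner_self_eq_norm_sq, hu]; simp
  have h := clι_mul_add_swap E u ξ
  rw [clι_pinHom, coe_pinOfUnit, CliffordAlgebra.involute_ι]
  change -clι E u * clι E ξ * -clι E u = _
  rw [neg_mul, neg_mul_neg, eq_sub_of_add_eq h, sub_mul, mul_assoc, huu,
    ← Algebra.smul_def, map_sub, map_smul, mul_neg, mul_one]
  module

theorem det_sub_inner_smul {u : E} (hu : ‖u‖ = 1) (f : E →ₗ[ℝ] E)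
    (hf : ∀ ξ, f ξ = ξ - (2 * inner ℝ u ξ) • u) : LinearMap.det f = -1 := by
  have : f = (ℝ ∙ u)ᗮ.reflection.toLinearMap := by
    ext ξ
    rw [hf]
    have := Submodule.reflection_orthogonal_apply (K := ℝ ∙ u) ξ
    refine Eq.trans ?_ this.symm
    rw [Submodule.reflection_singleton_apply, hu]
    simp [two_mul, add_smul, two_smul]
  rw [this, Submodule.det_reflection, Submodule.orthogonal_orthogonal, finrank_span_singleton]
  · simp
  · rintro rfl; simp at hu

/-- The pin element `a` is homogeneous, of parity given by the determinant of its image. -/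
def IsHomogeneousPin (a : Pin E) : Prop :=
  (CliffordAlgebra.involute ((a : (Cl E)ˣ) : Cl E) = ((a : (Cl E)ˣ) : Cl E) ∧
    LinearMap.det (pinHom E a : E →ₗ[ℝ] E) = 1) ∨
  (CliffordAlgebra.involute ((a : (Cl E)ˣ) : Cl E) = -((a : (Cl E)ˣ) : Cl E) ∧
    LinearMap.det (pinHom E a : E →ₗ[ℝ] E) = -1)

theorem IsHomogeneousPin.mul {a b : Pin E} (ha : IsHomogeneousPin a) (hb : IsHomogeneousPin b) :
    IsHomogeneousPin (a * b) := by
  have hd : LinearMap.det (pinHom E (a * b) : E →ₗ[ℝ] E) =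
      LinearMap.det (pinHom E a : E →ₗ[ℝ] E) * LinearMap.det (pinHom E b : E →ₗ[ℝ] E) := by
    rw [← map_mul LinearMap.det, map_mul]; rfl
  unfold IsHomogeneousPin at *
  rw [hd]
  rcases ha with ⟨h1, h2⟩ | ⟨h1, h2⟩ <;> rcases hb with ⟨h3, h4⟩ | ⟨h3, h4⟩ <;>
    simp [h1, h2, h3, h4]

theorem isHomogeneousPin_of_eq {a : Pin E}
    (ha : ((a : (Cl E)ˣ) : Cl E) = 1 ∨ ((a : (Cl E)ˣ) : Cl E) = -1) (h : pinHom E a = 1) :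
    IsHomogeneousPin a := by
  left
  refine ⟨?_, by rw [h]; exact LinearMap.det_id⟩
  rcases ha with ha | ha <;> simp [ha]

/-- Two lifts differ by ±1, which is even and acts trivially. -/
theorem IsHomogeneousPin.of_pinHom_eq {a b : Pin E} (ha : IsHomogeneousPin a)
    (h : pinHom E a = pinHom E b) : IsHomogeneousPin b := by
  have h1 : pinHom E (a⁻¹ * b) = 1 := by rw [map_mul, map_inv, h, inv_mul_cancel]
  have := ha.mul (isHomogeneousPin_of_eq (eq_one_or_neg_one_of_pinHom_eq_one h1) h1)
  rwa [mul_inv_cancel_left] at this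

variable {I N : Type*} [AddCommGroup N] [Module ℝ N] (P : RootPairing I ℝ E N)

theorem exists_pinOfUnit_eq_reflection
    (hP : ∀ (i : I) (x y : E), inner ℝ (P.reflection i x) (P.reflection i y) = inner ℝ x y)
    (i : I) : ∃ (u : E) (hu : ‖u‖ = 1), pinHom E (pinOfUnit u hu) = P.reflection i := by
  set r := P.root i with hr
  have hr0 : r ≠ 0 := P.ne_zero i
  have hn : ‖r‖ ≠ 0 := norm_ne_zero_iff.2 hr0
  refine ⟨‖r‖⁻¹ • r, by rw [norm_smul, norm_inv, norm_norm, inv_mul_cancel₀ hn], ?_⟩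
  refine LinearEquiv.ext fun ξ => ?_
  rw [pinHom_pinOfUnit, RootPairing.reflection_apply, ← hr]
  -- Invariance tested against the root r, which the reflection negates, forces the coroot to be
  -- 2(r, ·)/(r, r).
  have h1 := hP i ξ r
  rw [RootPairing.reflection_apply, hr, RootPairing.reflection_apply_self, ← hr, inner_neg_right,
    inner_sub_left, inner_smul_left, real_inner_self_eq_norm_sq] at h1
  have h2 : (P.coroot' i ξ) * ‖r‖ ^ 2 = 2 * inner ℝ r ξ := by
    rw [real_inner_comm r ξ] at h1
    simp only [conj_trivial] at h1
    linarith
  rw [inner_smul_left, smul_smul]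
  congr 2
  simp only [conj_trivial]
  field_simp
  linarith

/-- Every element of the Weyl group lifts to a homogeneous element of the pin group. -/
theorem exists_pin_lift
    (hP : ∀ (i : I) (x y : E), inner ℝ (P.reflection i x) (P.reflection i y) = inner ℝ x y)
    {w : E ≃ₗ[ℝ] E} (hw : w ∈ weylGroup P) : ∃ a : Pin E, pinHom E a = w ∧ IsHomogeneousPin a := by
  have h1 : ∀ i, ∃ a : Pin E, pinHom E a = P.reflection i ∧ IsHomogeneousPin a := by
    intro i
    obtain ⟨u, hu, h⟩ := exists_pinOfUnit_eq_reflection P hP i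
    refine ⟨_, h, Or.inr ⟨?_, det_sub_inner_smul hu _ fun ξ => pinHom_pinOfUnit u hu ξ⟩⟩
    rw [coe_pinOfUnit, CliffordAlgebra.involute_ι]
  induction hw using Subgroup.closure_induction'' with
  | one => exact ⟨1, map_one _, isHomogeneousPin_of_eq (Or.inl rfl) (map_one _)⟩
  | mem x hx =>
    obtain ⟨i, rfl⟩ := hx
    exact h1 i
  | inv_mem x hx =>
    obtain ⟨i, rfl⟩ := hx
    rw [P.reflection_inv]
    exact h1 i
  | mul x y _ _ hx hy =>
    obtain ⟨a, rfl, ha⟩ := hx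
    obtain ⟨b, rfl, hb⟩ := hy
    exact ⟨a * b, map_mul _ _ _, ha.mul hb⟩

end PinKernel

/-! ### The pin cover -/

section PinCover

variable {E : Type*} [NormedAddCommGroup E] [InnerProductSpace ℝ E]

theorem mem_spinAlgebra_iff_of_even (h : Even (Module.finrank ℝ E)) {x : Cl E} :
    x ∈ spinAlgebra E ↔ CliffordAlgebra.involute x = x := by
  rw [spinAlgebra_of_even h, ← Subalgebra.mem_toSubmodule, CliffordAlgebra.even_toSubmodule]
  refine ⟨fun hx => CliffordAlgebra.involute_eq_of_mem_even hx, fun hx => ?_⟩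
  have htop := (CliffordAlgebra.evenOdd_isCompl (Q := cliffordForm E)).sup_eq_top
  obtain ⟨y, hy, z, hz, rfl⟩ := Submodule.mem_sup.1 (htop ▸ Submodule.mem_top (x := x))
  rw [map_add, CliffordAlgebra.involute_eq_of_mem_even hy,
    CliffordAlgebra.involute_eq_of_mem_odd hz, add_right_inj, neg_eq_iff_add_eq_zero,
    ← two_smul ℝ, smul_eq_zero] at hx
  rw [hx.resolve_left two_ne_zero, add_zero]
  exact hy

theorem mem_spinAlgebra_of_odd (h : Odd (Module.finrank ℝ E)) (x : Cl E) : x ∈ spinAlgebra E := by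
  rw [spinAlgebra_of_odd h]; trivial

theorem involute_units_inv {u : (Cl E)ˣ} {r : ℝ} (hr : r * r = 1)
    (h : CliffordAlgebra.involute (u : Cl E) = r • (u : Cl E)) :
    CliffordAlgebra.involute ((u⁻¹ : (Cl E)ˣ) : Cl E) = r • ((u⁻¹ : (Cl E)ˣ) : Cl E) := by
  have h1 : CliffordAlgebra.involute ((u⁻¹ : (Cl E)ˣ) : Cl E) * (r • (u : Cl E)) = 1 := by
    rw [← h, ← map_mul, Units.inv_mul, map_one]
  have h2 : (r • (u : Cl E)) * (r • ((u⁻¹ : (Cl E)ˣ) : Cl E)) = 1 := by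
    rw [smul_mul_smul_comm, hr, Units.mul_inv, one_smul]
  rw [← mul_one (CliffordAlgebra.involute ((u⁻¹ : (Cl E)ˣ) : Cl E)), ← h2, ← mul_assoc, h1, one_mul]

theorem eval_detOneSubX [FiniteDimensional ℝ E] (w : E ≃ₗ[ℝ] E) :
    (detOneSubX w).eval 1 = (detOneSub w : ℂ) := by
  set M := LinearMap.toMatrix (Module.finBasis ℝ E) (Module.finBasis ℝ E) (w : E →ₗ[ℝ] E) with hM
  have h1 : M.charpolyRev.eval 1 = detOneSub w := by
    rw [Matrix.charpolyRev, ← Polynomial.coe_evalRingHom, RingHom.map_det, detOneSub,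
      ← LinearMap.det_toMatrix (Module.finBasis ℝ E),
      map_sub (LinearMap.toMatrix (Module.finBasis ℝ E) (Module.finBasis ℝ E)), ← hM, LinearMap.toMatrix_one]
    congr 1
    ext i j
    rcases eq_or_ne i j with h | h <;> simp [h]
  rw [detOneSubX, ← hM, ← h1, Polynomial.eval_map, ← map_one (algebraMap ℝ ℂ),
    Polynomial.eval₂_at_apply]
  simp

variable [FiniteDimensional ℝ E]

theorem detOneSub_inv {w : E ≃ₗ[ℝ] E} {n : ℕ} (hn : 0 < n) (hw : w ^ n = 1) :
    detOneSub w⁻¹ = detOneSub w := by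
  have := congrArg (Polynomial.eval 1) (detOneSubX_inv hn hw)
  rw [eval_detOneSubX, eval_detOneSubX] at this
  exact_mod_cast this

/-- This is the determinant of 1 - w = -w (1 - w⁻¹). -/
theorem detOneSub_eq_mul_inv (w : E ≃ₗ[ℝ] E) : detOneSub w =
    (-1) ^ Module.finrank ℝ E * LinearMap.det (w : E →ₗ[ℝ] E) * detOneSub w⁻¹ := by
  have : (1 - (w : E →ₗ[ℝ] E)) = (-1 : ℝ) • ((w : E →ₗ[ℝ] E) * (1 - ((w⁻¹ : E ≃ₗ[ℝ] E) : E →ₗ[ℝ] E))) := by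
    ext x
    simp
  rw [detOneSub, this, LinearMap.det_smul, map_mul, detOneSub, mul_assoc]

/-- `det (1 - w)` vanishes if `w` has finite order and `det w = (-1)^(l+1)`. -/
theorem detOneSub_eq_zero {w : E ≃ₗ[ℝ] E} {n : ℕ} (hn : 0 < n) (hw : w ^ n = 1)
    (h : LinearMap.det (w : E →ₗ[ℝ] E) = (-1) ^ (Module.finrank ℝ E + 1)) : detOneSub w = 0 := by
  have h1 := detOneSub_eq_mul_inv w
  rw [detOneSub_inv hn hw, h, ← pow_add, show Module.finrank ℝ E + (Module.finrank ℝ E + 1) =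
    2 * Module.finrank ℝ E + 1 by ring, pow_succ, pow_mul] at h1
  norm_num at h1
  linarith

/-- For `a` of the parity of `dim E`, the trace of `x ↦ a θ(x) a⁻¹` is `det (1 - p(a))`. -/
theorem spinForm_inv {a : Pin E} (ha : HasSpinParity ((a : (Cl E)ˣ) : Cl E)) {n : ℕ} (hn : 0 < n)
    (hw : pinHom E a ^ n = 1) :
    spinForm ((a : (Cl E)ˣ) : Cl E) (((a : (Cl E)ˣ)⁻¹ : (Cl E)ˣ) : Cl E) =
      detOneSub (pinHom E a) := by
  set u := (a : (Cl E)ˣ) with hu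
  let Ψ : Cl E →ₐ[ℝ] Cl E := AlgHom.ofLinearMap (spinOp (u : Cl E) ((u⁻¹ : (Cl E)ˣ) : Cl E))
    (by simp [spinOp_apply])
    (fun x y => by simp [spinOp_apply, mul_assoc])
  -- Here ε(a) = (-1)^l a and θ(ξ) = (-1)^(l+1) ξ, so a θ(ξ) a⁻¹ = -ε(a) ξ a⁻¹.
  have hΨ : ∀ ξ, Ψ (clι E ξ) = clι E ((-(pinHom E a : E →ₗ[ℝ] E)) ξ) := by
    intro ξ
    change spinOp (u : Cl E) ((u⁻¹ : (Cl E)ˣ) : Cl E) (clι E ξ) = _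
    rw [LinearMap.neg_apply, map_neg, LinearEquiv.coe_coe, clι_pinHom, ← hu, ha, spinOp_apply]
    rcases Nat.even_or_odd (Module.finrank ℝ E) with h | h
    · simp [spinTwist_of_even h, h.neg_one_pow, mul_assoc]
    · simp [spinTwist_of_odd h, h.neg_one_pow, mul_assoc]
  -- The exponent is doubled because the map on E is -p(a).
  have := trace_of_ι_comp (cliffordForm E) hΨ (n := 2 * n) (by omega) (by
    rw [pow_mul, neg_sq, ← pow_mul, mul_comm, pow_mul, coe_pow_eq_one hw, one_pow])
  rw [spinForm, detOneSub, sub_eq_add_neg, ← this]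
  rfl

variable {S₁ S₂ : Type*} [AddCommGroup S₁] [Module ℂ S₁] [FiniteDimensional ℂ S₁]
  [AddCommGroup S₂] [Module ℂ S₂] [FiniteDimensional ℂ S₂]
  {ρ₁ : spinAlgebra E →ₐ[ℝ] Module.End ℂ S₁} {ρ₂ : spinAlgebra E →ₐ[ℝ] Module.End ℂ S₂}

variable {W : Subgroup (E ≃ₗ[ℝ] E)}

theorem isHomogeneousPin_of_mem (hW : ∀ w ∈ W, ∃ a : Pin E, pinHom E a = w ∧ IsHomogeneousPin a)
    {g : Pin E} (hg : g ∈ pinCover W) : IsHomogeneousPin g := by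
  obtain ⟨a, h, ha⟩ := hW _ hg
  exact ha.of_pinHom_eq h

theorem coe_pin_injective :
    Function.Injective fun g : Pin E => ((g : (Cl E)ˣ) : Cl E) :=
  fun _ _ h => Subtype.ext (Units.ext h)

variable (W) in
theorem finite_pinCover' [Finite W] : Finite (pinCover' W) := by
  have hker : Finite (coverProj W).ker := by
    have : Finite ({1, -1} : Set (Cl E)) := Set.toFinite _
    refine Finite.of_injective (β := ({1, -1} : Set (Cl E))) (fun g => ⟨((((g : pinCover' W) : Pin E) : (Cl E)ˣ) : Cl E), ?_⟩) ?_
    · have h := g.2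
      exact eq_one_or_neg_one_of_pinHom_eq_one (congrArg Subtype.val h)
    · intro g h hgh
      exact Subtype.ext (Subtype.ext (coe_pin_injective (congrArg Subtype.val hgh)))
  exact (MonoidHom.finite_iff_finite_ker_range (coverProj W)).2 ⟨hker, inferInstance⟩

theorem coverProj_coe (g : pinCover' W) : ((coverProj W g : W) : E ≃ₗ[ℝ] E) = pinHom E g := rfl

/-- The parity of `g` in the cover agrees with that of `dim E`, unless `dim E` is odd and `g` is
even. -/
theorem hasSpinParity_or (hW : ∀ w ∈ W, ∃ a : Pin E, pinHom E a = w ∧ IsHomogeneousPin a)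
    (g : pinCover' W) : HasSpinParity (((g : Pin E) : (Cl E)ˣ) : Cl E) ∨
      (Odd (Module.finrank ℝ E) ∧
        CliffordAlgebra.involute (((g : Pin E) : (Cl E)ˣ) : Cl E) = (((g : Pin E) : (Cl E)ˣ) : Cl E) ∧
        LinearMap.det (pinHom E g : E →ₗ[ℝ] E) = 1) := by
  rcases Nat.even_or_odd (Module.finrank ℝ E) with h | h
  · left
    rw [HasSpinParity, h.neg_one_pow, one_smul]
    exact (mem_spinAlgebra_iff_of_even h).1 g.2.2
  · rcases isHomogeneousPin_of_mem hW g.2.1 with ⟨h1, h2⟩ | ⟨h1, h2⟩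
    · exact Or.inr ⟨h, h1, h2⟩
    · left
      rw [HasSpinParity, h.neg_one_pow, h1, neg_one_smul]

/-- In odd dimension, `S⁺ - S⁻` vanishes on even elements. -/
theorem spin_sub_eq_zero (hl : Odd (Module.finrank ℝ E)) (hρ₁ : IsSimpleModuleHom ρ₁)
    (hρ₂ : IsSimpleModuleHom ρ₂) (hρ : ¬ AreIsomorphic ρ₁ ρ₂) (a : spinAlgebra E)
    (ha : CliffordAlgebra.involute (a : Cl E) = a) : (moduleTrace ρ₁ - moduleTrace ρ₂) a = 0 := by
  have := spin_comp_neg hl.pos hρ₁ hρ₂ hρ CliffordAlgebra.involute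
    (fun x _ => mem_spinAlgebra_of_odd hl _)
    (fun φ _ hφ => by rw [hφ, hl.neg_one_pow, neg_one_smul]) a a ha.symm
  exact self_eq_neg.1 this

omit [FiniteDimensional ℂ S₁] [FiniteDimensional ℂ S₂] in
theorem spinCharacter_sub_apply (g : pinCover' W) :
    (spinCharacter W ρ₁ - spinCharacter W ρ₂) g =
      (moduleTrace ρ₁ - moduleTrace ρ₂) (toSpinAlgebra W g) := rfl

variable (hρ₁ : IsSimpleModuleHom ρ₁) (hρ₂ : IsSimpleModuleHom ρ₂) (hρ : ¬ AreIsomorphic ρ₁ ρ₂)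
include hρ₁ hρ₂ hρ

/-- `δ(g) δ(g⁻¹) = c det (1 - p(g))` for `δ = S⁺ - S⁻`, with `c = 1` or `2`. -/
theorem spinCharacter_mul_inv [Finite W] (hl : 0 < Module.finrank ℝ E)
    (hW : ∀ w ∈ W, ∃ a : Pin E, pinHom E a = w ∧ IsHomogeneousPin a) (g : pinCover' W) :
    (spinCharacter W ρ₁ - spinCharacter W ρ₂) g * (spinCharacter W ρ₁ - spinCharacter W ρ₂) g⁻¹ =
      (open Classical in if Odd (Module.finrank ℝ E) then 2 else 1) *
        (detOneSub (coverProj W g : E ≃ₗ[ℝ] E) : ℂ) := by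
  have hn := orderOf_pos (coverProj W g)
  have hw : pinHom E (g : Pin E) ^ orderOf (coverProj W g) = 1 :=
    congrArg Subtype.val (pow_orderOf_eq_one (coverProj W g))
  rw [coverProj_coe]
  rcases hasSpinParity_or hW g with h | ⟨h, h1, h2⟩
  · have hi : HasSpinParity ((((g⁻¹ : pinCover' W) : Pin E) : (Cl E)ˣ) : Cl E) :=
      involute_units_inv (by rw [← mul_pow]; norm_num) h
    rw [← spinForm_inv h hn hw]
    exact spin_mul_spin hl hρ₁ hρ₂ hρ (toSpinAlgebra W g) (toSpinAlgebra W g⁻¹) hi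
  -- For l odd and g even, det p(g) = 1 = (-1)^(l+1), so det(1 - p(g)) = 0, and δ(g) = 0 as well.
  · rw [detOneSub_eq_zero hn hw (by rw [h2, h.add_one.neg_one_pow]), spinCharacter_sub_apply,
      spin_sub_eq_zero h hρ₁ hρ₂ hρ _ h1]
    simp

/-- In odd dimension δ vanishes on even elements, and the remaining ones have determinant -1. -/
theorem det_mul_spinCharacter (hl : Odd (Module.finrank ℝ E))
    (hW : ∀ w ∈ W, ∃ a : Pin E, pinHom E a = w ∧ IsHomogeneousPin a) (g : pinCover' W) :
    ((LinearMap.det ((coverProj W g : E ≃ₗ[ℝ] E) : E →ₗ[ℝ] E) : ℝ) : ℂ) *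
      (spinCharacter W ρ₁ - spinCharacter W ρ₂) g =
        -(spinCharacter W ρ₁ - spinCharacter W ρ₂) g := by
  rcases isHomogeneousPin_of_mem hW g.2.1 with ⟨h1, -⟩ | ⟨-, h2⟩
  · rw [spinCharacter_sub_apply, spin_sub_eq_zero hl hρ₁ hρ₂ hρ _ h1]
    simp
  · rw [coverProj_coe, h2]
    simp

/-- The volume element satisfies φ x = ε(x) φ = -x φ for odd x, so conjugation by x negates φ and
`spin_comp_neg` applies. -/
theorem spinCharacter_conj (hl : 0 < Module.finrank ℝ E) (he : Even (Module.finrank ℝ E))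
    (hW : ∀ w ∈ W, ∃ a : Pin E, pinHom E a = w ∧ IsHomogeneousPin a) {x : Pin E}
    (hx : x ∈ pinCover W) (hx' : x ∉ pinCover' W) {g h : pinCover' W}
    (hgh : (h : Pin E) = x * g * x⁻¹) :
    (spinCharacter W ρ₁ - spinCharacter W ρ₂) h = -(spinCharacter W ρ₁ - spinCharacter W ρ₂) g := by
  have hxo : CliffordAlgebra.involute ((x : (Cl E)ˣ) : Cl E) = -((x : (Cl E)ˣ) : Cl E) := by
    rcases isHomogeneousPin_of_mem hW hx with ⟨h1, -⟩ | ⟨h1, -⟩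
    · exact absurd ⟨hx, (mem_spinAlgebra_iff_of_even he).2 h1⟩ hx'
    · exact h1
  set u := (x : (Cl E)ˣ) with hu
  have hui : CliffordAlgebra.involute ((u⁻¹ : (Cl E)ˣ) : Cl E) = -((u⁻¹ : (Cl E)ˣ) : Cl E) := by
    simpa using involute_units_inv (u := u) (r := -1) (by norm_num) (by simpa using hxo)
  let F : Cl E →ₐ[ℝ] Cl E := AlgHom.ofLinearMap
    (LinearMap.mulLeft ℝ (u : Cl E) ∘ₗ LinearMap.mulRight ℝ ((u⁻¹ : (Cl E)ˣ) : Cl E))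
    (by simp) (fun y z => by simp [mul_assoc])
  have hF : ∀ y, F y = (u : Cl E) * (y * ((u⁻¹ : (Cl E)ˣ) : Cl E)) := fun y => rfl
  refine spin_comp_neg hl hρ₁ hρ₂ hρ F ?_ ?_ (toSpinAlgebra W g) (toSpinAlgebra W h) ?_
  · intro y hy
    rw [mem_spinAlgebra_iff_of_even he] at hy ⊢
    rw [hF, map_mul, map_mul, hy, hui, hxo]
    simp
  · intro φ hφ _
    have := hφ (u : Cl E)
    rw [spinTwist_of_even he, hxo] at this
    rw [hF, ← mul_assoc, ← neg_eq_iff_eq_neg, ← neg_mul, ← neg_mul, ← this, mul_assoc,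
      Units.mul_inv, mul_one]
  · have := congrArg (fun y : Pin E => ((y : (Cl E)ˣ) : Cl E)) hgh
    rw [hF, ← mul_assoc]
    exact this

end PinCover

/-! ### Averages over the pin cover -/

section Average

/-- Averages over a finite group factor through homomorphisms. -/
theorem inv_card_mul_sum_comp {G H : Type*} [Group G] [Group H] [Fintype G] (φ : G →* H)
    [Fintype φ.range] (F : H → ℂ) :
    (Nat.card G : ℂ)⁻¹ * ∑ g, F (φ g) = (Nat.card φ.range : ℂ)⁻¹ * ∑ w : φ.range, F w := by
  classical
  have h : ∀ F : H → ℂ, ∑ g, F (φ g) = Nat.card φ.ker * ∑ w : φ.range, F w := by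
    intro F
    rw [← Finset.sum_fiberwise (Finset.univ : Finset G) φ.rangeRestrict, Finset.mul_sum]
    refine Finset.sum_congr rfl fun w _ => ?_
    have h1 : ∀ g ∈ Finset.univ.filter fun g => φ.rangeRestrict g = w, F (φ g) = F w := by
      intro g hg
      rw [← (Finset.mem_filter.1 hg).2]
      rfl
    rw [Finset.sum_congr rfl h1, Finset.sum_const, nsmul_eq_mul]
    congr 2
    rw [MonoidHom.card_fiber_eq_of_mem_range φ.rangeRestrict (y := 1)
      (φ.rangeRestrict_surjective w) ⟨1, map_one _⟩, ← φ.ker_rangeRestrict,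
      Nat.card_eq_fintype_card, Fintype.card_subtype]
    simp only [MonoidHom.mem_ker]
  have h1 := h fun _ => 1
  simp only [Finset.sum_const, Finset.card_univ, nsmul_eq_mul, mul_one,
    ← Nat.card_eq_fintype_card] at h1
  have hk : (Nat.card φ.ker : ℂ) ≠ 0 := Nat.cast_ne_zero.2 Nat.card_pos.ne'
  rw [h, h1, mul_inv, mul_mul_mul_comm, mul_comm (Nat.card φ.ker : ℂ)⁻¹]
  field_simp

variable {E : Type*} [NormedAddCommGroup E] [InnerProductSpace ℝ E] [FiniteDimensional ℝ E]
  {W : Subgroup (E ≃ₗ[ℝ] E)}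

theorem coverProj_surjective_of_odd (hl : Odd (Module.finrank ℝ E))
    (hW : ∀ w ∈ W, ∃ a : Pin E, pinHom E a = w ∧ IsHomogeneousPin a) :
    Function.Surjective (coverProj W) := by
  rintro ⟨w, hw⟩
  obtain ⟨a, rfl, -⟩ := hW w hw
  exact ⟨⟨a, hw, mem_spinAlgebra_of_odd hl _⟩, rfl⟩

theorem mem_range_coverProj_iff_of_even (hl : Even (Module.finrank ℝ E))
    (hW : ∀ w ∈ W, ∃ a : Pin E, pinHom E a = w ∧ IsHomogeneousPin a) (w : W) :
    w ∈ (coverProj W).range ↔ LinearMap.det ((w : E ≃ₗ[ℝ] E) : E →ₗ[ℝ] E) = 1 := by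
  constructor
  · rintro ⟨g, rfl⟩
    rcases isHomogeneousPin_of_mem hW g.2.1 with ⟨-, h⟩ | ⟨h, -⟩
    · exact h
    · exfalso
      have h1 := (mem_spinAlgebra_iff_of_even hl).1 g.2.2
      rw [h, neg_eq_iff_add_eq_zero, ← two_smul ℝ, smul_eq_zero] at h1
      exact ((g : Pin E) : (Cl E)ˣ).ne_zero (h1.resolve_left two_ne_zero)
  · intro hdet
    obtain ⟨a, ha, h⟩ := hW w w.2
    rcases h with ⟨h, -⟩ | ⟨-, h⟩
    · exact ⟨⟨a, by rw [pinCover, Subgroup.mem_comap, ha]; exact w.2,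
        (mem_spinAlgebra_iff_of_even hl).2 h⟩, Subtype.ext ha⟩
    · rw [ha, hdet] at h
      norm_num at h

/-- The element s shows that det is nontrivial on W, so the image, which is the kernel of det, has
index exactly two. -/
theorem card_range_coverProj_of_even [Finite W] (hl : Even (Module.finrank ℝ E))
    (hW : ∀ w ∈ W, ∃ a : Pin E, pinHom E a = w ∧ IsHomogeneousPin a) {s : W}
    (hs : LinearMap.det ((s : E ≃ₗ[ℝ] E) : E →ₗ[ℝ] E) = -1) :
    Nat.card W = 2 * Nat.card (coverProj W).range := by
  rw [← (coverProj W).range.index_mul_card]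
  congr 1
  rw [Subgroup.index_eq_two_iff]
  refine ⟨s, fun b => ?_⟩
  rw [mem_range_coverProj_iff_of_even hl hW, mem_range_coverProj_iff_of_even hl hW]
  have h1 : LinearMap.det (((b * s : W) : E ≃ₗ[ℝ] E) : E →ₗ[ℝ] E) =
      -LinearMap.det ((b : E ≃ₗ[ℝ] E) : E →ₗ[ℝ] E) := by
    rw [← mul_neg_one, ← hs, ← map_mul]
    rfl
  rw [h1]
  obtain ⟨a, ha, h⟩ := hW b b.2
  rcases h with ⟨-, h⟩ | ⟨-, h⟩ <;> rw [ha] at h <;> rw [h] <;> norm_num [Xor]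

theorem detOneSub_eq_zero_of_even [Finite W] (hl : Even (Module.finrank ℝ E))
    (hW : ∀ w ∈ W, ∃ a : Pin E, pinHom E a = w ∧ IsHomogeneousPin a) {w : W}
    (hw : w ∉ (coverProj W).range) : detOneSub (w : E ≃ₗ[ℝ] E) = 0 := by
  refine detOneSub_eq_zero (orderOf_pos w) (congrArg Subtype.val (pow_orderOf_eq_one w)) ?_
  rw [mem_range_coverProj_iff_of_even hl hW] at hw
  obtain ⟨a, ha, h⟩ := hW w w.2
  rw [IsHomogeneousPin, ha] at h
  rw [hl.add_one.neg_one_pow]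
  exact (h.resolve_left fun h => hw h.2).2

/-- Averages over the cover of functions vanishing off the elliptic elements of `W`. -/
theorem inv_card_mul_sum_coverProj [Fintype W] [Fintype (pinCover' W)]
    (hW : ∀ w ∈ W, ∃ a : Pin E, pinHom E a = w ∧ IsHomogeneousPin a) {s : W}
    (hs : LinearMap.det ((s : E ≃ₗ[ℝ] E) : E →ₗ[ℝ] E) = -1) (F : W → ℂ)
    (hF : ∀ w : W, detOneSub (w : E ≃ₗ[ℝ] E) = 0 → F w = 0) :
    (1 / 2) * (open Classical in if Odd (Module.finrank ℝ E) then 2 else 1) *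
      ((Nat.card (pinCover' W) : ℂ)⁻¹ * ∑ g, F (coverProj W g)) =
        (Nat.card W : ℂ)⁻¹ * ∑ w, F w := by
  classical
  rw [inv_card_mul_sum_comp]
  have hsum : (∀ w : W, w ∉ (coverProj W).range → F w = 0) →
      ∑ w : (coverProj W).range, F w = ∑ w, F w := by
    intro h
    rw [← Finset.sum_filter_of_ne (p := (· ∈ (coverProj W).range))
      fun w _ hw => not_not.1 fun hw' => hw (h w hw')]
    exact (Finset.sum_subtype _ (by simp) F).symm
  -- For l even the factor 1/2 compensates for the index two of the image; for l odd the image is W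
  -- and the factors 1/2 and 2 cancel.
  rcases Nat.even_or_odd (Module.finrank ℝ E) with hl | hl
  · rw [hsum fun w hw => hF w (detOneSub_eq_zero_of_even hl hW hw),
      card_range_coverProj_of_even hl hW hs, if_neg (Nat.not_odd_iff_even.2 hl)]
    push_cast
    rw [mul_inv]
    ring
  · have h1 : (coverProj W).range = ⊤ :=
      MonoidHom.range_eq_top.2 (coverProj_surjective_of_odd hl hW)
    rw [hsum fun w hw => absurd (h1 ▸ Subgroup.mem_top w) hw, if_pos hl, h1, Subgroup.card_top]
    ring

end Average

/-! ### The fake degree as a power series -/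

section FakeDegree

open scoped LaurentSeries RatFunc

/-- The power series `H i` inverts `p i`, so in the field of Laurent series it equals the image of
1/`p i`. -/
theorem coe_sum_C_div {F : Type*} [Field F] {ι : Type*} (s : Finset ι) (n : ℕ) (c : F) (a : ι → F)
    (p : ι → Polynomial F) (H : ι → F⟦X⟧) (hp : ∀ i, H i * (p i : F⟦X⟧) = 1) :
    (((RatFunc.X - 1) ^ n * (RatFunc.C c * ∑ i ∈ s, RatFunc.C (a i) /
      algebraMap (Polynomial F) (RatFunc F) (p i)) : RatFunc F) : F⸨X⸩) =
      (((PowerSeries.X - 1) ^ n * (PowerSeries.C c * ∑ i ∈ s, PowerSeries.C (a i) * H i) :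
        F⟦X⟧) : F⸨X⸩) := by
  have hC : ∀ a : F, algebraMap (RatFunc F) F⸨X⸩ (RatFunc.C a) =
      ((PowerSeries.C a : F⟦X⟧) : F⸨X⸩) := by
    intro a
    rw [← RatFunc.algebraMap_C, ← Polynomial.coe_C]
    exact (RatFunc.coe_coe _).symm
  have hX : algebraMap (RatFunc F) F⸨X⸩ RatFunc.X = ((PowerSeries.X : F⟦X⟧) : F⸨X⸩) := by
    rw [← RatFunc.algebraMap_X, ← Polynomial.coe_X]
    exact (RatFunc.coe_coe _).symm
  have hD : ∀ i, (H i : F⸨X⸩) *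
      algebraMap (RatFunc F) F⸨X⸩ (algebraMap (Polynomial F) (RatFunc F) (p i)) = 1 := by
    intro i
    rw [← map_one (HahnSeries.ofPowerSeries ℤ F), ← hp i, map_mul]
    congr 1
    exact (RatFunc.coe_coe _).symm
  simp only [map_mul, map_pow, map_sub, map_one, map_sum, map_div₀, hC, hX]
  congr 2
  refine Finset.sum_congr rfl fun i _ => ?_
  rw [div_eq_mul_inv, eq_comm, ← eq_inv_of_mul_eq_one_left (hD i)]

variable {E : Type*} [AddCommGroup E] [Module ℝ E] [FiniteDimensional ℝ E]
  {W : Subgroup (E ≃ₗ[ℝ] E)}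

/-- The expansion is written with w⁻¹, as in the second argument of the character pairing; this is
harmless because det(1 - q w) = det(1 - q w⁻¹). -/
theorem coe_ellipticFakeDegree [Fintype W] (π : W → ℂ) :
    ((ellipticFakeDegree π : RatFunc ℂ) : ℂ⸨X⸩) =
      (((PowerSeries.X - 1) ^ Module.finrank ℝ E * (PowerSeries.C (Nat.card W : ℂ)⁻¹ *
        ∑ w : W, PowerSeries.C (π w * (detOneSub (w : E ≃ₗ[ℝ] E) : ℂ)) *
          PowerSeries.mk fun i => symPowCharacter W i w⁻¹) : ℂ⟦X⟧) : ℂ⸨X⸩) := by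
  have hD : ∀ w : W, (PowerSeries.mk fun i => symPowCharacter W i w⁻¹) *
      (detOneSubX (w : E ≃ₗ[ℝ] E) : ℂ⟦X⟧) = 1 := by
    intro w
    have hw : (w : E ≃ₗ[ℝ] E) ^ orderOf w = 1 := congrArg Subtype.val (pow_orderOf_eq_one w)
    rw [← detOneSubX_inv (orderOf_pos w) hw]
    exact mk_trace_symPow_mul_detOneSubX (orderOf_pos w) (w := (w : E ≃ₗ[ℝ] E)⁻¹)
      (by rw [inv_pow, hw, inv_one])
  rw [ellipticFakeDegree, finsum_eq_sum_of_fintype]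
  exact coe_sum_C_div Finset.univ _ _ _ _ _ hD

end FakeDegree

/-! ### Spin pairs -/

section SpinPairs

theorem apply_conj_of_mem_virtualCharacters {G : Type*} [Group G] {χ : G → ℂ}
    (hχ : χ ∈ virtualCharacters G) (g h : G) : χ (h * g * h⁻¹) = χ g := by
  obtain ⟨a, b, ⟨n, ρ, rfl⟩, ⟨m, τ, rfl⟩, rfl⟩ := exists_sub_of_mem_virtualCharacters hχ
  simp only [Pi.sub_apply, Representation.char_conj]

variable {E : Type*} [NormedAddCommGroup E] [InnerProductSpace ℝ E] [FiniteDimensional ℝ E]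
  {W : Subgroup (E ≃ₗ[ℝ] E)}

omit [FiniteDimensional ℝ E] in
/-- The determinant is a character of a group of linear automorphisms. -/
theorem isCharacter_det : IsCharacter W fun w =>
    ((LinearMap.det ((w : E ≃ₗ[ℝ] E) : E →ₗ[ℝ] E) : ℝ) : ℂ) := by
  let ρ : Representation ℂ W ℂ := ((algebraMap ℂ (Module.End ℂ ℂ) : ℂ →* Module.End ℂ ℂ).comp
    ((Complex.ofRealHom : ℝ →* ℂ).comp (LinearMap.det.comp
      ((LinearEquiv.automorphismGroup.toLinearMapMonoidHom (R := ℝ) (M := E)).comp W.subtype))))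
  have h := isCharacter_character ρ
  have h2 : ρ.character = fun w : W =>
      ((LinearMap.det ((w : E ≃ₗ[ℝ] E) : E →ₗ[ℝ] E) : ℝ) : ℂ) := by
    ext w
    change LinearMap.trace ℂ ℂ (algebraMap ℂ (Module.End ℂ ℂ)
      ((LinearMap.det ((w : E ≃ₗ[ℝ] E) : E →ₗ[ℝ] E) : ℝ) : ℂ)) = _
    rw [Algebra.algebraMap_eq_smul_one, map_smul, LinearMap.trace_one]
    simp
  rwa [h2] at h

theorem IsGenuineCharacter.isCharacter {χ : pinCover' W → ℂ} (h : IsGenuineCharacter W χ) :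
    IsCharacter (pinCover' W) χ :=
  IsCharacterOn.isCharacter h

theorem coverProj_eq_one {z : pinCover' W} (hz : (((z : Pin E) : (Cl E)ˣ) : Cl E) = -1) :
    coverProj W z = 1 := by
  have hu : ((z : Pin E) : (Cl E)ˣ) = -1 := Units.ext (by rw [hz]; simp)
  refine Subtype.ext (LinearEquiv.ext fun ξ => clι_injective E ?_)
  rw [coverProj_coe, clι_pinHom, hu]
  simp

variable {S : Type*} [AddCommGroup S] [Module ℂ S] [FiniteDimensional ℂ S]

theorem isGenuineCharacter_spinCharacter (ρ : spinAlgebra E →ₐ[ℝ] Module.End ℂ S) :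
    IsGenuineCharacter W (spinCharacter W ρ) := by
  let τ : Representation ℂ (pinCover' W) S :=
    { toFun := fun g => ρ (toSpinAlgebra W g)
      map_one' := by rw [← map_one ρ]; rfl
      map_mul' := fun g h => by rw [← map_mul ρ]; rfl }
  refine isCharacterOn_character (ρ := τ) fun z hz => ?_
  have : toSpinAlgebra W z = -1 := Subtype.ext hz
  change ρ (toSpinAlgebra W z) = -1
  rw [this, map_neg, map_one]

/-- The twist of a genuine character by a character of `W`. -/
theorem isGenuineCharacter_mul {χ : W → ℂ} {ψ : pinCover' W → ℂ} (hχ : IsCharacter W χ)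
    (hψ : IsGenuineCharacter W ψ) : IsGenuineCharacter W (spinInduct W ψ χ) :=
  IsCharacterOn.comp_mul hχ hψ (coverProj W) fun _ hz => coverProj_eq_one hz

theorem conj_mem_pinCover' (he : Even (Module.finrank ℝ E))
    (hW : ∀ w ∈ W, ∃ a : Pin E, pinHom E a = w ∧ IsHomogeneousPin a) {x g : Pin E}
    (hx : x ∈ pinCover W) (hg : g ∈ pinCover' W) : x * g * x⁻¹ ∈ pinCover' W := by
  refine ⟨mul_mem (mul_mem hx hg.1) (inv_mem hx), ?_⟩
  have h1 := (mem_spinAlgebra_iff_of_even he).1 hg.2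
  rw [mem_spinAlgebra_iff_of_even he]
  change CliffordAlgebra.involute (((x : (Cl E)ˣ) : Cl E) * ((g : (Cl E)ˣ) : Cl E) *
    (((x : (Cl E)ˣ)⁻¹ : (Cl E)ˣ) : Cl E)) = ((x : (Cl E)ˣ) : Cl E) * ((g : (Cl E)ˣ) : Cl E) *
    (((x : (Cl E)ˣ)⁻¹ : (Cl E)ˣ) : Cl E)
  rcases isHomogeneousPin_of_mem hW hx with ⟨h, -⟩ | ⟨h, -⟩
  · have h2 := involute_units_inv (u := (x : (Cl E)ˣ)) (r := 1) (by norm_num) (by simpa using h)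
    rw [map_mul, map_mul, h, h1, h2, one_smul]
  · have h2 := involute_units_inv (u := (x : (Cl E)ˣ)) (r := -1) (by norm_num) (by simpa using h)
    rw [map_mul, map_mul, h, h1, h2]
    simp

/-- Conjugation by an element of the full cover, in even dimension. -/
def conjPinCover' (he : Even (Module.finrank ℝ E))
    (hW : ∀ w ∈ W, ∃ a : Pin E, pinHom E a = w ∧ IsHomogeneousPin a) {x : Pin E}
    (hx : x ∈ pinCover W) : pinCover' W ≃* pinCover' W where
  toFun g := ⟨x * g * x⁻¹, conj_mem_pinCover' he hW hx g.2⟩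
  invFun g := ⟨x⁻¹ * g * x, by simpa using conj_mem_pinCover' he hW (inv_mem hx) g.2⟩
  left_inv g := Subtype.ext (by simp [mul_assoc])
  right_inv g := Subtype.ext (by simp [mul_assoc])
  map_mul' g h := Subtype.ext (by simp [mul_assoc])

variable {S₁ S₂ : Type*} [AddCommGroup S₁] [Module ℂ S₁] [FiniteDimensional ℂ S₁]
  [AddCommGroup S₂] [Module ℂ S₂] [FiniteDimensional ℂ S₂]
  {ρ₁ : spinAlgebra E →ₐ[ℝ] Module.End ℂ S₁} {ρ₂ : spinAlgebra E →ₐ[ℝ] Module.End ℂ S₂}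

theorem spinCharacter_sub_mem :
    spinCharacter W ρ₁ - spinCharacter W ρ₂ ∈ virtualCharacters (pinCover' W) :=
  sub_mem (AddSubgroup.subset_closure (isGenuineCharacter_spinCharacter ρ₁).isCharacter)
    (AddSubgroup.subset_closure (isGenuineCharacter_spinCharacter ρ₂).isCharacter)

variable (hρ₁ : IsSimpleModuleHom ρ₁) (hρ₂ : IsSimpleModuleHom ρ₂) (hρ : ¬ AreIsomorphic ρ₁ ρ₂)
  (hl : 0 < Module.finrank ℝ E)
  (hW : ∀ w ∈ W, ∃ a : Pin E, pinHom E a = w ∧ IsHomogeneousPin a)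
include hρ₁ hρ₂ hρ hl hW

/-- On a finite group δ(g⁻¹) is the complex conjugate of δ(g). -/
theorem normSq_spinCharacter_sub [Finite W] (g : pinCover' W) :
    Complex.normSq ((spinCharacter W ρ₁ - spinCharacter W ρ₂) g) =
      (open Classical in if Odd (Module.finrank ℝ E) then 2 else 1) *
        detOneSub (coverProj W g : E ≃ₗ[ℝ] E) := by
  have := finite_pinCover' W
  have h := spinCharacter_mul_inv hρ₁ hρ₂ hρ hl hW g
  rw [inv_apply_of_mem_virtualCharacters spinCharacter_sub_mem, Complex.mul_conj] at h
  split_ifs at h ⊢ <;> exact_mod_cast h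

/-- On the image of the cover this is |δ|² up to a positive factor; off the image, which occurs only
for l even, it is 0. -/
theorem detOneSub_nonneg [Finite W] (w : W) : 0 ≤ detOneSub (w : E ≃ₗ[ℝ] E) := by
  by_cases hw : w ∈ (coverProj W).range
  · obtain ⟨g, rfl⟩ := hw
    have h := normSq_spinCharacter_sub hρ₁ hρ₂ hρ hl hW g
    have h0 := Complex.normSq_nonneg ((spinCharacter W ρ₁ - spinCharacter W ρ₂) g)
    rw [h] at h0
    split_ifs at h0 <;> linarith
  · rcases Nat.even_or_odd (Module.finrank ℝ E) with he | ho
    · exact (detOneSub_eq_zero_of_even he hW hw).ge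
    · exact absurd (coverProj_surjective_of_odd ho hW w) hw

/-- `S⁺ - S⁻` kills the radical of the elliptic pairing. -/
theorem spinInduct_eq_zero_of_mem_radical [Finite W] {r : virtualCharacters W}
    (hr : r ∈ ellipticRadical W) :
    spinInduct W (spinCharacter W ρ₁ - spinCharacter W ρ₂) (r : W → ℂ) = 0 := by
  have := Fintype.ofFinite W
  -- Testing r against its dual gives a sum of nonnegative terms |r(w)|² det(1 - w) equal to 0.
  have h1 := hr ⟨_, inv_mem_virtualCharacters r.2⟩
  rw [ellipticPairing, finsum_eq_sum_of_fintype] at h1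
  have h2 := (mul_eq_zero.1 h1).resolve_left
    (inv_ne_zero (Nat.cast_ne_zero.2 Nat.card_pos.ne'))
  simp only [inv_apply_of_mem_virtualCharacters r.2, Complex.mul_conj, ← Complex.ofReal_mul,
    ← Complex.ofReal_sum, Complex.ofReal_eq_zero] at h2
  rw [Finset.sum_eq_zero_iff_of_nonneg fun w _ =>
    mul_nonneg (Complex.normSq_nonneg _) (detOneSub_nonneg hρ₁ hρ₂ hρ hl hW w)] at h2
  ext g
  rw [spinInduct, Pi.zero_apply, mul_eq_zero]
  rcases mul_eq_zero.1 (h2 (coverProj W g) (Finset.mem_univ _)) with h | h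
  · exact Or.inl (Complex.normSq_eq_zero.1 h)
  · right
    rw [← Complex.normSq_eq_zero, normSq_spinCharacter_sub hρ₁ hρ₂ hρ hl hW, h, mul_zero]

theorem spinInduct_eq_of_mk_eq [Finite W] {π π' : virtualCharacters W}
    (h : (QuotientAddGroup.mk π : EllipticQuotient W) = QuotientAddGroup.mk π') :
    spinInduct W (spinCharacter W ρ₁ - spinCharacter W ρ₂) (π : W → ℂ) =
      spinInduct W (spinCharacter W ρ₁ - spinCharacter W ρ₂) (π' : W → ℂ) := by
  have h1 := spinInduct_eq_zero_of_mem_radical hρ₁ hρ₂ hρ hl hW (QuotientAddGroup.eq.1 h)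
  ext g
  have := congrFun h1 g
  simp only [spinInduct, AddSubgroup.coe_add, AddSubgroup.coe_neg, Pi.add_apply, Pi.neg_apply,
    Pi.zero_apply] at this ⊢
  linear_combination -this

/-- Orthogonal genuine characters with difference `π ⊗ (S⁺ - S⁻)` are associate. -/
theorem isAssociate_of_sub_eq [Finite W] {π : W → ℂ} (hπ : π ∈ virtualCharacters W)
    {a b : pinCover' W → ℂ} (ha : IsGenuineCharacter W a) (hb : IsGenuineCharacter W b)
    (hab : charPairing a b = 0)
    (h : spinInduct W (spinCharacter W ρ₁ - spinCharacter W ρ₂) π = a - b) :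
    IsAssociate W a b := by
  have := finite_pinCover' W
  have := Fintype.ofFinite (pinCover' W)
  have hs : ∀ g, a g - b g =
      π (coverProj W g) * (spinCharacter W ρ₁ - spinCharacter W ρ₂) g := fun g =>
    (congrFun h g).symm
  refine ⟨fun ho => ?_, fun he x hx hx' => ?_⟩
  · let d : W → ℂ := fun w => ((LinearMap.det ((w : E ≃ₗ[ℝ] E) : E →ₗ[ℝ] E) : ℝ) : ℂ)
    have hd : IsCharacter W d := isCharacter_det
    have hdd : ∀ w, d w * d w⁻¹ = 1 := fun w => by
      simp only [d, ← Complex.ofReal_mul, ← map_mul]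
      have : (((w : W) : E ≃ₗ[ℝ] E) : E →ₗ[ℝ] E) *
        (((w⁻¹ : W) : E ≃ₗ[ℝ] E) : E →ₗ[ℝ] E) = 1 := by
        ext ξ
        exact LinearEquiv.apply_symm_apply (w : E ≃ₗ[ℝ] E) ξ
      rw [this, map_one, Complex.ofReal_one]
    -- Twisting by det negates a - b, so (det · b, det · a) is another orthogonal pair with
    -- difference a - b.
    refine congrFun (orthogonal_parts_unique ha.isCharacter hb.isCharacter
      (isGenuineCharacter_mul hd hb).isCharacter (isGenuineCharacter_mul hd ha).isCharacter
      hab ?_ ?_).2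
    · rw [charPairing_comm, ← hab, charPairing_eq_sum, charPairing_eq_sum]
      congr 1
      refine Finset.sum_congr rfl fun g _ => ?_
      simp only [spinInduct, map_inv]
      linear_combination a g * b g⁻¹ * hdd (coverProj W g)
    · ext g
      have h1 := det_mul_spinCharacter hρ₁ hρ₂ hρ ho hW g
      change a g - b g = d (coverProj W g) * b g - d (coverProj W g) * a g
      change d (coverProj W g) * _ = _ at h1
      linear_combination (1 + d (coverProj W g)) * hs g + π (coverProj W g) * h1
  · let e := conjPinCover' he hW hx
    have he1 : ∀ g, ((e g : pinCover' W) : Pin E) = x * g * x⁻¹ := fun g => rfl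
    have hZ : ∀ z : pinCover' W, (((z : Pin E) : (Cl E)ˣ) : Cl E) = -1 →
        (((e z : Pin E) : (Cl E)ˣ) : Cl E) = -1 := by
      intro z hz
      change ((x : (Cl E)ˣ) : Cl E) * (((z : Pin E) : (Cl E)ˣ) : Cl E) *
        (((x : (Cl E)ˣ)⁻¹ : (Cl E)ˣ) : Cl E) = -1
      rw [hz]
      simp
    -- Conjugation by x fixes π and negates δ, so (b ∘ e, a ∘ e) is another orthogonal pair with
    -- difference a - b.
    have h1 := orthogonal_parts_unique ha.isCharacter hb.isCharacter
      (IsCharacterOn.comp hb e.toMonoidHom hZ).isCharacter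
      (IsCharacterOn.comp ha e.toMonoidHom hZ).isCharacter hab
      ((charPairing_comp_equiv e b a).trans (by rw [charPairing_comm, hab])) (by
        ext g
        have h2 := spinCharacter_conj hρ₁ hρ₂ hρ hl he hW hx hx' (he1 g)
        have h3 : π (coverProj W (e g)) = π (coverProj W g) := by
          rw [← apply_conj_of_mem_virtualCharacters hπ (coverProj W g) ⟨pinHom E x, hx⟩]
          congr 1
          refine Subtype.ext ?_
          rw [coverProj_coe, he1, map_mul, map_mul, map_inv]
          rfl
        have h4 := hs (e g)
        rw [h2, h3] at h4
        change a g - b g = b (e g) - a (e g)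
        linear_combination hs g + h4)
    intro g h hgh
    have : h = e g := Subtype.ext hgh
    rw [this]
    exact (congrFun h1.1 g).symm

theorem existsUnique_isSpinPair [Finite W] (c : EllipticQuotient W) :
    ∃! σ : (pinCover' W → ℂ) × (pinCover' W → ℂ),
      IsSpinPair W (spinCharacter W ρ₁ - spinCharacter W ρ₂) c σ := by
  have := finite_pinCover' W
  obtain ⟨π, rfl⟩ := QuotientAddGroup.mk_surjective c
  obtain ⟨a, b, ha, hb, hab⟩ := exists_sub_of_mem_virtualCharacters π.2
  have h1 := isGenuineCharacter_spinCharacter (W := W) ρ₁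
  have h2 := isGenuineCharacter_spinCharacter (W := W) ρ₂
  -- For π = a - b, π ⊗ δ is the difference of the genuine characters a S₁ + b S₂ and a S₂ + b S₁;
  -- their common constituents are cancelled.
  obtain ⟨s, t, hs, ht, hst, hsub⟩ := exists_orthogonal_parts
    (IsCharacterOn.add (isGenuineCharacter_mul ha h1) (isGenuineCharacter_mul hb h2))
    (IsCharacterOn.add (isGenuineCharacter_mul ha h2) (isGenuineCharacter_mul hb h1))
  have hπ : spinInduct W (spinCharacter W ρ₁ - spinCharacter W ρ₂) (π : W → ℂ) = s - t := by
    rw [hsub, hab]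
    ext g
    simp only [spinInduct, Pi.sub_apply, Pi.add_apply]
    ring
  refine ⟨(s, t), ⟨hs, ht, isAssociate_of_sub_eq hρ₁ hρ₂ hρ hl hW π.2 hs ht hst hπ, hst,
    fun π' h => (spinInduct_eq_of_mk_eq hρ₁ hρ₂ hρ hl hW h).trans hπ⟩, ?_⟩
  rintro ⟨s', t'⟩ h
  obtain ⟨h3, h4⟩ := orthogonal_parts_unique h.genuine_fst.isCharacter h.genuine_snd.isCharacter
    hs.isCharacter ht.isCharacter h.orthogonal hst ((h.induct_eq π rfl).symm.trans hπ)
  exact Prod.ext h3 h4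

/-- The pairing with `S_q E ⊗ (S⁺ - S⁻)` as a sum over `W`. -/
theorem symPairing_spinInduct [Fintype W] {s : W}
    (hs : LinearMap.det ((s : E ≃ₗ[ℝ] E) : E →ₗ[ℝ] E) = -1) (π : W → ℂ) :
    PowerSeries.C (1 / 2 : ℂ) * symPairing W
        (spinInduct W (spinCharacter W ρ₁ - spinCharacter W ρ₂) π)
        (spinCharacter W ρ₁ - spinCharacter W ρ₂) =
      PowerSeries.C (Nat.card W : ℂ)⁻¹ * ∑ w : W,
        PowerSeries.C (π w * (detOneSub (w : E ≃ₗ[ℝ] E) : ℂ)) *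
          PowerSeries.mk fun i => symPowCharacter W i w⁻¹ := by
  have := finite_pinCover' W
  have := Fintype.ofFinite (pinCover' W)
  ext i
  rw [PowerSeries.coeff_C_mul, PowerSeries.coeff_C_mul, map_sum]
  simp only [PowerSeries.coeff_C_mul, PowerSeries.coeff_mk, symPairing]
  -- The sum over W is pulled back to the cover, where each c det(1 - w) is replaced by δ(g) δ(g⁻¹).
  rw [← inv_card_mul_sum_coverProj hW hs
    (fun w => π w * (detOneSub (w : E ≃ₗ[ℝ] E) : ℂ) * symPowCharacter W i w⁻¹)
    (fun w hw => by rw [hw]; simp), charPairing_eq_sum, mul_assoc]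
  refine congrArg _ ?_
  rw [mul_left_comm _ (Nat.card (pinCover' W) : ℂ)⁻¹]
  refine congrArg _ ?_
  rw [Finset.mul_sum]
  refine Finset.sum_congr rfl fun g _ => ?_
  have h := spinCharacter_mul_inv hρ₁ hρ₂ hρ hl hW g
  simp only [spinInduct, map_inv]
  linear_combination π (coverProj W g) * symPowCharacter W i (coverProj W g)⁻¹ * h

end SpinPairs

end EllipticSpin

end

theorem mainTheorem8
    {I E N : Type*} [Finite I] [Nonempty I]
    [NormedAddCommGroup E] [InnerProductSpace ℝ E] [FiniteDimensional ℝ E]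
    [AddCommGroup N] [Module ℝ N]
    (P : RootPairing I ℝ E N) [P.IsRootSystem] [P.IsCrystallographic]
    (hP : ∀ (i : I) (x y : E), inner ℝ (P.reflection i x) (P.reflection i y) = inner ℝ x y)
    {S₁ S₂ : Type*} [AddCommGroup S₁] [Module ℂ S₁] [FiniteDimensional ℂ S₁]
    [AddCommGroup S₂] [Module ℂ S₂] [FiniteDimensional ℂ S₂]
    (ρ₁ : spinAlgebra E →ₐ[ℝ] Module.End ℂ S₁)
    (ρ₂ : spinAlgebra E →ₐ[ℝ] Module.End ℂ S₂)
    (hρ₁ : IsSimpleModuleHom ρ₁) (hρ₂ : IsSimpleModuleHom ρ₂)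
    (hρ : ¬ AreIsomorphic ρ₁ ρ₂)
    (δ : pinCover' (weylGroup P) → ℂ)
    (hδ : δ = spinCharacter (weylGroup P) ρ₁ -
      spinCharacter (weylGroup P) ρ₂)
    (c : EllipticQuotient (weylGroup P)) :
    (∃! σ : (pinCover' (weylGroup P) → ℂ) × (pinCover' (weylGroup P) → ℂ),
      IsSpinPair (weylGroup P) δ c σ) ∧
    ∀ σ, IsSpinPair (weylGroup P) δ c σ →
      ∀ π : virtualCharacters (weylGroup P),
        (QuotientAddGroup.mk π : EllipticQuotient (weylGroup P)) = c →
        ((ellipticFakeDegree (π : weylGroup P → ℂ) : RatFunc ℂ) : ℂ⸨X⸩) =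
          ((PowerSeries.C (1 / 2 : ℂ) * (PowerSeries.X - 1) ^ Module.finrank ℝ E *
            symPairing (weylGroup P) (σ.1 - σ.2) δ : ℂ⟦X⟧) : ℂ⸨X⸩) := by
  have hW : ∀ w ∈ weylGroup P, ∃ a : Pin E, pinHom E a = w ∧ IsHomogeneousPin a :=
    fun w hw => exists_pin_lift P hP hw
  have : Fintype (weylGroup P) := Fintype.ofFinite _
  obtain ⟨i⟩ := ‹Nonempty I›
  have hl : 0 < Module.finrank ℝ E :=
    Module.finrank_pos_iff_exists_ne_zero.2 ⟨P.root i, P.ne_zero i⟩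
  -- A reflection supplies the element of determinant -1 needed for the index two count in even
  -- dimension.
  have hs : LinearMap.det (P.reflection i : E →ₗ[ℝ] E) = -1 := by
    obtain ⟨u, hu, h⟩ := exists_pinOfUnit_eq_reflection P hP i
    exact det_sub_inner_smul hu _ fun ξ => by rw [← h]; exact pinHom_pinOfUnit u hu ξ
  subst hδ
  refine ⟨existsUnique_isSpinPair hρ₁ hρ₂ hρ hl hW c, fun σ hσ π hπ => ?_⟩
  -- Only the difference σ⁺ - σ⁻ = π ⊗ δ enters the formula.
  rw [coe_ellipticFakeDegree, ← hσ.induct_eq π hπ, mul_right_comm,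
    symPairing_spinInduct hρ₁ hρ₂ hρ hl hW (s := ⟨P.reflection i, Subgroup.subset_closure ⟨i, rfl⟩⟩)
      hs, mul_comm]
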